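/- Let $\mu,B,c,\hbar,R>0$, $e<0$ and $0<\alpha<\beta<1$; put $\omega_c=|e|B/(\mu c)$, $E_1=(\alpha+\tfrac12)\hbar\omega_c$ and $D=|e|BR^2/(\hbar c)=\mu\omega_cR^2/\hbar$. In $\mathbb R^2$ let $\boldsymbol a=(0,0)$, $\boldsymbol b=(R,0)$, $L_a=(-\infty,0]\times\{0\}$, $L_b=[R,\infty)\times\{0\}$ and $\boldsymbol x\wedge\boldsymbol y=x_1y_2-x_2y_1$. Identifying $\mathbb R^2$ with $\mathbb C$, let $r_a,r_b\ge 0$ and $\theta_a,\theta_b\in(-\pi,\pi]$ be given by $x=r_ae^{i\theta_a}$, $R-x=r_be^{i\theta_b}$; thus the two sides of $L_a$ (of $L_b$) are $\theta_a=\pm\pi$ ($\theta_b=\pm\pi$). Let $$H_B=-\frac{\hbar^2}{2\mu}\left(\Big(\frac{\partial}{\partial x_1}+\frac{ieB}{2\hbar c}x_2\Big)^2+\Big(\frac{\partial}{\partial x_2}-\frac{ieB}{2\hbar c}x_1\Big)^2\right),$$ and let $H_B^{\max}$ be the adjoint in $L^2(\mathbb R^2)$ of the densely defined operator that acts as $H_B$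 on $C_0^\infty(\mathbb R^2\setminus(L_a\cup L_b))$. Define $$\psi_1(\boldsymbol x)=\Big(\frac{\mu\omega_c}{2\pi\Gamma(1+\alpha)\hbar}\Big)^{1/2}\exp\Big(-\frac{\mu\omega_c}{4\hbar}r_a^2+i\frac{\mu\omega_c}{2\hbar}\boldsymbol x\wedge\boldsymbol a\Big)\Big(\sqrt{\tfrac{\mu\omega_c}{2\hbar}}\,r_a\Big)^{\alpha}e^{i\alpha\theta_a},$$ $$\varphi(\boldsymbol x)=-\sqrt{\frac{\mu\omega_c}{2\pi\Gamma(1+\alpha)\hbar}}\,\frac{\sin(\pi\beta)}{\pi}\exp\Big(-\frac{\mu\omega_c}{4\hbar}(R^2+r_b^2)+i\frac{\mu\omega_c}{2\hbar}\boldsymbol x\wedge\boldsymbol b\Big)\int_{-\infty}^{\infty}\Big(\sqrt{\tfrac{\mu\omega_c}{2\hbar}}\,(R+r_be^{-u})\Big)^{\alpha}\exp\Big(-\frac{\mu\omega_cRr_b}{2\hbar}e^{u}\Big)\frac{e^{\beta(u+i\theta_b)}}{1+e^{u+i\theta_b}}\,du ,$$ and $\tilde\psi_2=\psi_1+\varphi$.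 Then: 1. The integral defining $\varphi(\boldsymbol x)$ converges absolutely for every $\boldsymbol x\in\mathbb R^2\setminus(L_a\cup L_b)$. If in addition $r_b<R$, then with $z=\frac{r_b}{R}e^{i\theta_b}$, principal branches of the powers, the Gauss hypergeometric function ${}_2F_1$ and the second confluent hypergeometric function $U$, $$\varphi(\boldsymbol x)=-\sqrt{\frac{\mu\omega_c}{2\pi\Gamma(\alpha+1)\hbar}}\Big(\sqrt{\tfrac{\mu\omega_c}{2\hbar}}R\Big)^{\alpha}\exp\Big(-\frac{\mu\omega_c}{4\hbar}(R^2+r_b^2)+\frac{\mu\omega_cRr_b}{2\hbar}\cos\theta_b\Big)\Big((1-z)^\alpha-\frac{\Gamma(\beta-\alpha)\,{}_2F_1(1,\beta-\alpha;\beta+1;z)\,z^\beta}{\Gamma(-\alpha)\Gamma(\beta+1)}-\frac{\sin(\pi\beta)\Gamma(\beta-\alpha)}{\pi}\Big(\frac{D\bar z}{2}\Big)^{1-\beta}\int_0^1U\Big(-\alpha,1-\beta,\frac{Dz\bar zt}{2}\Big)e^{-D\bar zt/2}t^{-\beta}\,dt\Big),$$ where the last integral converges absolutely. 2. $\varphi$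 and $\tilde\psi_2$ are nonzero elements of $L^2(\mathbb R^2)$, lie in the domain of $H_B^{\max}$, and satisfy $H_B^{\max}\varphi=E_1\varphi$ and $H_B^{\max}\tilde\psi_2=E_1\tilde\psi_2$. Moreover $\tilde\psi_2$ is twice continuously differentiable on $\mathbb R^2\setminus(L_a\cup L_b)$ and satisfies $H_B\tilde\psi_2=E_1\tilde\psi_2$ there pointwise. 3. $\tilde\psi_2$ satisfies the boundary conditions on $L_b$ exactly: for every $r_b>0$, $$\tilde\psi_2(r_b,\theta_b=\pi)=e^{2\pi i\beta}\tilde\psi_2(r_b,\theta_b=-\pi),\qquad \partial_{\theta_b}\tilde\psi_2(r_b,\theta_b=\pi)=e^{2\pi i\beta}\,\partial_{\theta_b}\tilde\psi_2(r_b,\theta_b=-\pi),$$ where the values at $\theta_b=\pm\pi$ are the limits from inside $\mathbb R^2\setminus(L_a\cup L_b)$ (they exist, jointly in $(r_b,\theta_b)$). -/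

import Mathlib

namespace TwoSolenoid

noncomputable section

/-- The data of the model: mass `μ`, charge `e`, magnetic field `B`, speed of light `c`,
reduced Planck constant `hbar`, distance `R` of the solenoids, and the two fluxes `α`, `β`. -/
structure Model where
  μ : ℝ
  e : ℝ
  B : ℝ
  c : ℝ
  hbar : ℝ
  R : ℝ
  α : ℝ
  β : ℝ

/-! The plane `ℝ²` is `ℂ` with its Lebesgue measure; the point `(x₁, x₂)` is `x₁ + i x₂`. -/

/-- `x ∧ y = x₁ y₂ - x₂ y₁`. -/
def wedge (x y : ℂ) : ℝ := x.re * y.im - x.im * y.re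

namespace Model

/-- The cyclotron frequency `ω_c = |e| B / (μ c)`. -/
def ωc (m : Model) : ℝ := |m.e| * m.B / (m.μ * m.c)

/-- The one-solenoid energy `E₁ = (α + 1/2) ħ ω_c`. -/
def E₁ (m : Model) : ℝ := (m.α + 1 / 2) * m.hbar * m.ωc

/-- The dimensionless parameter `D = |e| B R² / (ħ c)`. -/
def D (m : Model) : ℝ := |m.e| * m.B * m.R ^ 2 / (m.hbar * m.c)

/-- The position of the first solenoid, `𝐚 = (0, 0)`. -/
def a (_ : Model) : ℂ := 0

/-- The position of the second solenoid, `𝐛 = (R, 0)`. -/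
def b (m : Model) : ℂ := (m.R : ℂ)

/-- Polar coordinates centred at `𝐚`: `x - 𝐚 = r_a e^{iθ_a}`, so that `θ_a = ±π` on the cut to the
left of `𝐚`. -/
def ra (m : Model) (x : ℂ) : ℝ := ‖x - m.a‖
def θa (m : Model) (x : ℂ) : ℝ := Complex.arg (x - m.a)

/-- Polar coordinates centred at `𝐛`: `𝐛 - x = r_b e^{iθ_b}`, so that `θ_b = 0` on the side of `𝐚`
and `θ_b = ±π` on the cut to the right of `𝐛`. -/
def rb (m : Model) (x : ℂ) : ℝ := ‖m.b - x‖
def θb (m : Model) (x : ℂ) : ℝ := Complex.arg (m.b - x)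

/-- The cut `L_a`, with its end point `𝐚`. -/
def La (m : Model) : Set ℂ := {x | x.im = 0 ∧ x.re ≤ m.a.re}

/-- The cut `L_b`, with its end point `𝐛`. -/
def Lb (m : Model) : Set ℂ := {x | x.im = 0 ∧ m.b.re ≤ x.re}

/-- The open set `ℝ² ∖ (L_a ∪ L_b)`. -/
def cutPlane (m : Model) : Set ℂ := (m.La ∪ m.Lb)ᶜ

/-! ### The magnetic Schrödinger operator -/

/-- `(∂₁ + (ieB / 2ħc) x₂) f`. -/
def cov₁ (m : Model) (f : ℂ → ℂ) (x : ℂ) : ℂ :=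
  fderiv ℝ f x 1 + Complex.I * ((m.e * m.B / (2 * m.hbar * m.c) * x.im : ℝ) : ℂ) * f x

/-- `(∂₂ - (ieB / 2ħc) x₁) f`. -/
def cov₂ (m : Model) (f : ℂ → ℂ) (x : ℂ) : ℂ :=
  fderiv ℝ f x Complex.I - Complex.I * ((m.e * m.B / (2 * m.hbar * m.c) * x.re : ℝ) : ℂ) * f x

/-- The differential expression
`H_B = -(ħ² / 2μ) ((∂₁ + (ieB / 2ħc) x₂)² + (∂₂ - (ieB / 2ħc) x₁)²)`. -/
def HB (m : Model) (f : ℂ → ℂ) (x : ℂ) : ℂ :=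
  ((-(m.hbar ^ 2 / (2 * m.μ)) : ℝ) : ℂ) * (m.cov₁ (m.cov₁ f) x + m.cov₂ (m.cov₂ f) x)

open scoped ContDiff in
/-- `C₀^∞(ℝ² ∖ (L_a ∪ L_b))`. -/
def testSpace (m : Model) : Submodule ℂ (ℂ → ℂ) where
  carrier := {f | ContDiff ℝ ∞ f ∧ HasCompactSupport f ∧ tsupport f ⊆ m.cutPlane}
  add_mem' := fun {f g} hf hg =>
    ⟨hf.1.add hg.1, hf.2.1.add hg.2.1,
      (tsupport_add f g).trans (Set.union_subset hf.2.2 hg.2.2)⟩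
  zero_mem' := ⟨contDiff_const, HasCompactSupport.zero, by
    simp [tsupport, Function.support_zero]⟩
  smul_mem' := fun k f hf =>
    ⟨contDiff_const.smul hf.1, hf.2.1.smul_left (f := fun _ => k),
      (closure_mono (Function.support_const_smul_subset k f)).trans hf.2.2⟩

/-- The Hilbert space `L²(ℝ²)`. -/
abbrev L2 : Type := MeasureTheory.Lp ℂ 2 (MeasureTheory.volume : MeasureTheory.Measure ℂ)

section
open scoped ContDiff

theorem cov₁_smooth (m : Model) {f : ℂ → ℂ} (hf : ContDiff ℝ ∞ f) : ContDiff ℝ ∞ (m.cov₁ f) := by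
  have h1 : ContDiff ℝ ∞ (fun x => fderiv ℝ f x 1) :=
    (hf.fderiv_right (m := ∞) (by simp)).clm_apply contDiff_const
  have h2 : ContDiff ℝ ∞ (fun x : ℂ => ((m.e * m.B / (2 * m.hbar * m.c) * x.im : ℝ) : ℂ)) :=
    Complex.ofRealCLM.contDiff.comp (contDiff_const.mul Complex.imCLM.contDiff)
  exact h1.add ((contDiff_const.mul h2).mul hf)

theorem cov₂_smooth (m : Model) {f : ℂ → ℂ} (hf : ContDiff ℝ ∞ f) : ContDiff ℝ ∞ (m.cov₂ f) := by
  have h1 : ContDiff ℝ ∞ (fun x => fderiv ℝ f x Complex.I) :=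
    (hf.fderiv_right (m := ∞) (by simp)).clm_apply contDiff_const
  have h2 : ContDiff ℝ ∞ (fun x : ℂ => ((m.e * m.B / (2 * m.hbar * m.c) * x.re : ℝ) : ℂ)) :=
    Complex.ofRealCLM.contDiff.comp (contDiff_const.mul Complex.reCLM.contDiff)
  exact h1.sub ((contDiff_const.mul h2).mul hf)

theorem cov₁_supp (m : Model) {f : ℂ → ℂ} (hf : HasCompactSupport f) :
    HasCompactSupport (m.cov₁ f) :=
  (hf.fderiv_apply (𝕜 := ℝ) 1).add hf.mul_left

theorem cov₂_supp (m : Model) {f : ℂ → ℂ} (hf : HasCompactSupport f) :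
    HasCompactSupport (m.cov₂ f) := by
  have h : m.cov₂ f = (fun x => fderiv ℝ f x Complex.I) +
      (fun x : ℂ => -(Complex.I * ((m.e * m.B / (2 * m.hbar * m.c) * x.re : ℝ) : ℂ))) * f := by
    funext x; simp [cov₂]; ring
  rw [h]
  exact (hf.fderiv_apply (𝕜 := ℝ) Complex.I).add hf.mul_left

theorem HB_smooth (m : Model) {f : ℂ → ℂ} (hf : ContDiff ℝ ∞ f) : ContDiff ℝ ∞ (m.HB f) :=
  contDiff_const.mul ((m.cov₁_smooth (m.cov₁_smooth hf)).add (m.cov₂_smooth (m.cov₂_smooth hf)))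

theorem HB_supp (m : Model) {f : ℂ → ℂ} (hf : HasCompactSupport f) : HasCompactSupport (m.HB f) :=
  ((m.cov₁_supp (m.cov₁_supp hf)).add (m.cov₂_supp (m.cov₂_supp hf))).mul_left

theorem cov₁_add (m : Model) {f g : ℂ → ℂ} (hf : ContDiff ℝ ∞ f) (hg : ContDiff ℝ ∞ g) :
    m.cov₁ (f + g) = m.cov₁ f + m.cov₁ g := by
  funext x
  simp only [cov₁, Pi.add_apply]
  rw [fderiv_add (hf.differentiable (by simp) x) (hg.differentiable (by simp) x)]
  simp; ring

theorem cov₂_add (m : Model) {f g : ℂ → ℂ} (hf : ContDiff ℝ ∞ f) (hg : ContDiff ℝ ∞ g) :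
    m.cov₂ (f + g) = m.cov₂ f + m.cov₂ g := by
  funext x
  simp only [cov₂, Pi.add_apply]
  rw [fderiv_add (hf.differentiable (by simp) x) (hg.differentiable (by simp) x)]
  simp; ring

theorem cov₁_smul (m : Model) (k : ℂ) {f : ℂ → ℂ} (hf : ContDiff ℝ ∞ f) :
    m.cov₁ (k • f) = k • m.cov₁ f := by
  funext x
  simp only [cov₁, Pi.smul_apply]
  rw [fderiv_const_smul (hf.differentiable (by simp) x)]
  simp; ring

theorem cov₂_smul (m : Model) (k : ℂ) {f : ℂ → ℂ} (hf : ContDiff ℝ ∞ f) :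
    m.cov₂ (k • f) = k • m.cov₂ f := by
  funext x
  simp only [cov₂, Pi.smul_apply]
  rw [fderiv_const_smul (hf.differentiable (by simp) x)]
  simp; ring

theorem test_memLp (m : Model) (f : m.testSpace) :
    MeasureTheory.MemLp (f : ℂ → ℂ) 2 MeasureTheory.volume :=
  f.2.1.continuous.memLp_of_hasCompactSupport f.2.2.1

theorem HB_test_memLp (m : Model) (f : m.testSpace) :
    MeasureTheory.MemLp (m.HB f) 2 MeasureTheory.volume :=
  (m.HB_smooth f.2.1).continuous.memLp_of_hasCompactSupport (m.HB_supp f.2.2.1)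

end

/-- The inclusion of `C₀^∞(ℝ² ∖ (L_a ∪ L_b))` into `L²(ℝ²)`. -/
def testToL2 (m : Model) : m.testSpace →ₗ[ℂ] L2 where
  toFun f := (m.test_memLp f).toLp f
  map_add' _ _ := rfl
  map_smul' _ _ := rfl

/-- `f ↦ H_B f` from `C₀^∞(ℝ² ∖ (L_a ∪ L_b))` to `L²(ℝ²)`. -/
def HBtest (m : Model) : m.testSpace →ₗ[ℂ] L2 where
  toFun f := (m.HB_test_memLp f).toLp (m.HB f)
  map_add' f g := by
    rw [← MeasureTheory.MemLp.toLp_add]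
    congr 1
    funext x
    simp only [HB, Submodule.coe_add, Pi.add_apply]
    rw [m.cov₁_add f.2.1 g.2.1, m.cov₂_add f.2.1 g.2.1,
      m.cov₁_add (m.cov₁_smooth f.2.1) (m.cov₁_smooth g.2.1),
      m.cov₂_add (m.cov₂_smooth f.2.1) (m.cov₂_smooth g.2.1)]
    simp only [Pi.add_apply]; ring
  map_smul' k f := by
    rw [RingHom.id_apply, ← MeasureTheory.MemLp.toLp_const_smul]
    congr 1
    funext x
    simp only [HB, Submodule.coe_smul, Pi.smul_apply]
    rw [m.cov₁_smul k f.2.1, m.cov₂_smul k f.2.1,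
      m.cov₁_smul k (m.cov₁_smooth f.2.1), m.cov₂_smul k (m.cov₂_smooth f.2.1)]
    simp only [Pi.smul_apply, smul_eq_mul]; ring

theorem testToL2_injective (m : Model) : Function.Injective m.testToL2 := by
  intro f g h
  have h' := (MeasureTheory.MemLp.toLp_eq_toLp_iff (m.test_memLp f) (m.test_memLp g)).1 h
  exact Subtype.ext ((f.2.1.continuous.ae_eq_iff_eq _ g.2.1.continuous).1 h')

/-- The symmetric operator `Ḣ_B` in `L²(ℝ²)`: it acts as `H_B` on the domain
`C₀^∞(ℝ² ∖ (L_a ∪ L_b))`. -/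
def HBdot (m : Model) : L2 →ₗ.[ℂ] L2 where
  domain := LinearMap.range m.testToL2
  toFun := m.HBtest ∘ₗ (LinearEquiv.ofInjective m.testToL2 m.testToL2_injective).symm.toLinearMap

/-- The maximal operator `H_B^max`, the adjoint of `Ḣ_B`. -/
def HBmax (m : Model) : L2 →ₗ.[ℂ] L2 := m.HBdot.adjoint

theorem isOpen_cutPlane (m : Model) : IsOpen m.cutPlane := by
  refine IsClosed.isOpen_compl (self := IsClosed.union ?_ ?_)
  · exact (isClosed_eq Complex.continuous_im continuous_const).inter
      (isClosed_le Complex.continuous_re continuous_const)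
  · exact (isClosed_eq Complex.continuous_im continuous_const).inter
      (isClosed_le continuous_const Complex.continuous_re)

/-- The cuts are a null set. -/
theorem ae_mem_cutPlane (m : Model) :
    ∀ᵐ x ∂(MeasureTheory.volume : MeasureTheory.Measure ℂ), x ∈ m.cutPlane := by
  have h : MeasureTheory.volume ((LinearMap.ker Complex.imLm : Submodule ℝ ℂ) : Set ℂ) = 0 := by
    refine MeasureTheory.Measure.addHaar_submodule _ _ fun h => ?_
    have : Complex.I ∈ (LinearMap.ker Complex.imLm : Submodule ℝ ℂ) := h ▸ Submodule.mem_top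
    simp at this
  refine MeasureTheory.measure_mono_null (fun x hx => ?_) h
  have hx' : x ∈ m.La ∪ m.Lb := not_not.1 hx
  rcases hx' with h | h <;> simpa using h.1

/-- `Ḣ_B` is densely defined, so that its adjoint is the genuine one. -/
theorem HBdot_dense (m : Model) : Dense (m.HBdot.domain : Set L2) := by
  rw [Submodule.dense_iff_topologicalClosure_eq_top, Submodule.topologicalClosure_eq_top_iff,
    Submodule.eq_bot_iff]
  intro v hv
  have hloc : MeasureTheory.LocallyIntegrable (v : ℂ → ℂ) MeasureTheory.volume :=
    (MeasureTheory.Lp.memLp v).locallyIntegrable (by norm_num)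
  have h := m.isOpen_cutPlane.ae_eq_zero_of_integral_contDiff_smul_eq_zero
    (μ := MeasureTheory.volume) (f := (v : ℂ → ℂ)) (hloc.locallyIntegrableOn _) (by
      intro g hg hgc hgs
      have hsub : Function.support (fun x => (g x : ℂ)) = Function.support g := by
        ext x; simp
      have hmem : (fun x => (g x : ℂ)) ∈ m.testSpace := by
        refine ⟨Complex.ofRealCLM.contDiff.comp hg, ?_, ?_⟩
        · simpa [HasCompactSupport, tsupport, hsub] using hgc
        · simpa [tsupport, hsub] using hgs
      have h0 := (Submodule.mem_orthogonal _ v).1 hv (m.testToL2 ⟨_, hmem⟩)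
        (LinearMap.mem_range_self _ _)
      rw [MeasureTheory.L2.inner_def] at h0
      rw [← h0]
      refine MeasureTheory.integral_congr_ae ?_
      filter_upwards [(m.test_memLp ⟨_, hmem⟩).coeFn_toLp] with x hx
      have hx' : (m.testToL2 ⟨_, hmem⟩ : ℂ → ℂ) x = (g x : ℂ) := hx
      rw [hx']
      simp [RCLike.inner_apply, mul_comm])
  rw [MeasureTheory.Lp.eq_zero_iff_ae_eq_zero]
  filter_upwards [h, m.ae_mem_cutPlane] with x hx hx' using hx hx'

/-- `f` is an eigenfunction of `H_B^max` with the eigenvalue `E`: it is a nonzero element of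
`L²(ℝ²)`, lies in the domain of `H_B^max`, and `H_B^max f = E f`. -/
def IsEigenfunction (m : Model) (E : ℝ) (f : ℂ → ℂ) : Prop :=
  ∃ hf : MeasureTheory.MemLp f 2 MeasureTheory.volume, hf.toLp f ≠ 0 ∧
    ∃ hdom : hf.toLp f ∈ m.HBmax.domain, m.HBmax ⟨hf.toLp f, hdom⟩ = (E : ℂ) • hf.toLp f

/-! ### The eigenfunctions -/

/-- The one-solenoid eigenfunction `ψ₁`. -/
def ψ₁ (m : Model) (x : ℂ) : ℂ :=
  (((m.μ * m.ωc / (2 * Real.pi * Real.Gamma (1 + m.α) * m.hbar)) ^ (1 / 2 : ℝ) : ℝ) : ℂ) *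
    Complex.exp (((-(m.μ * m.ωc / (4 * m.hbar)) * m.ra x ^ 2 : ℝ) : ℂ) +
      Complex.I * ((m.μ * m.ωc / (2 * m.hbar) * wedge x m.a : ℝ) : ℂ)) *
    (((√(m.μ * m.ωc / (2 * m.hbar)) * m.ra x) ^ m.α : ℝ) : ℂ) *
    Complex.exp (Complex.I * ((m.α * m.θa x : ℝ) : ℂ))

/-- The integrand in the integral formula for `φ`. -/
def φIntegrand (m : Model) (x : ℂ) (u : ℝ) : ℂ :=
  (((√(m.μ * m.ωc / (2 * m.hbar)) * (m.R + m.rb x * Real.exp (-u))) ^ m.α : ℝ) : ℂ) *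
    ((Real.exp (-(m.μ * m.ωc * m.R * m.rb x / (2 * m.hbar)) * Real.exp u) : ℝ) : ℂ) *
    (Complex.exp ((m.β : ℂ) * ((u : ℂ) + Complex.I * (m.θb x : ℂ))) /
      (1 + Complex.exp ((u : ℂ) + Complex.I * (m.θb x : ℂ))))

/-- The correction `φ`, given by the integral formula. -/
def φ (m : Model) (x : ℂ) : ℂ :=
  -((√(m.μ * m.ωc / (2 * Real.pi * Real.Gamma (1 + m.α) * m.hbar)) *
      (Real.sin (Real.pi * m.β) / Real.pi) : ℝ) : ℂ) *
    Complex.exp (((-(m.μ * m.ωc / (4 * m.hbar)) * (m.R ^ 2 + m.rb x ^ 2) : ℝ) : ℂ) +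
      Complex.I * ((m.μ * m.ωc / (2 * m.hbar) * wedge x m.b : ℝ) : ℂ)) *
    ∫ u : ℝ, m.φIntegrand x u

/-- The approximate two-solenoid eigenfunction `ψ̃₂ = ψ₁ + φ`. -/
def ψ₂approx (m : Model) (x : ℂ) : ℂ := m.ψ₁ x + m.φ x

end Model

/-- Kummer's confluent hypergeometric function `₁F₁(a; c; z) = ∑ (a)ₙ / (c)ₙ zⁿ / n!`
for `c ≠ 0, -1, -2, …`. Mathlib's function carries an extra factor `1 / Γ(c)`. -/
def hyp1F1 (a c z : ℂ) : ℂ := Complex.Gamma c * Complex.regularizedHGFun {a} {c} z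

/-- The second confluent hypergeometric function `U(a, c, z)`, for a non-integral `c`. -/
def hypU (a c z : ℂ) : ℂ :=
  Real.pi / Complex.sin (Real.pi * c) *
    (hyp1F1 a c z / (Complex.Gamma c * Complex.Gamma (1 + a - c)) -
      z ^ (1 - c) * hyp1F1 (1 + a - c) (2 - c) z / (Complex.Gamma a * Complex.Gamma (2 - c)))

namespace Model

/-- The complex coordinate `z = (r_b / R) e^{iθ_b}`. -/
def z (m : Model) (x : ℂ) : ℂ :=
  ((m.rb x / m.R : ℝ) : ℂ) * Complex.exp (Complex.I * (m.θb x : ℂ))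

/-- `z̄ = (r_b / R) e^{-iθ_b}`. -/
def zbar (m : Model) (x : ℂ) : ℂ :=
  ((m.rb x / m.R : ℝ) : ℂ) * Complex.exp (-(Complex.I * (m.θb x : ℂ)))

/-- The integrand `U(-α, 1 - β, D z z̄ t / 2) e^{-D z̄ t / 2} t^{-β}`. -/
def φHypIntegrand (m : Model) (x : ℂ) (t : ℝ) : ℂ :=
  hypU (-(m.α : ℂ)) (1 - (m.β : ℂ)) ((m.D : ℂ) * m.z x * m.zbar x * (t : ℂ) / 2) *
    Complex.exp (-((m.D : ℂ) * m.zbar x * (t : ℂ) / 2)) * ((t ^ (-m.β) : ℝ) : ℂ)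

/-- The second form of `φ`, through hypergeometric functions. -/
def φHyp (m : Model) (x : ℂ) : ℂ :=
  -((√(m.μ * m.ωc / (2 * Real.pi * Real.Gamma (m.α + 1) * m.hbar)) *
      (√(m.μ * m.ωc / (2 * m.hbar)) * m.R) ^ m.α *
      Real.exp (-(m.μ * m.ωc / (4 * m.hbar)) * (m.R ^ 2 + m.rb x ^ 2) +
        m.μ * m.ωc * m.R * m.rb x / (2 * m.hbar) * Real.cos (m.θb x)) : ℝ) : ℂ) *
    ((1 - m.z x) ^ (m.α : ℂ) -
      ((Real.Gamma (m.β - m.α) / (Real.Gamma (-m.α) * Real.Gamma (m.β + 1)) : ℝ) : ℂ) *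
        ordinaryHypergeometric (1 : ℂ) ((m.β : ℂ) - (m.α : ℂ)) ((m.β : ℂ) + 1) (m.z x) *
        m.z x ^ (m.β : ℂ) -
      ((Real.sin (Real.pi * m.β) * Real.Gamma (m.β - m.α) / Real.pi : ℝ) : ℂ) *
        ((m.D : ℂ) * m.zbar x / 2) ^ (1 - (m.β : ℂ)) *
        ∫ t in (0 : ℝ)..1, m.φHypIntegrand x t)

/-! ### The boundary conditions on the cut `L_b` -/

/-- The function `f` in the polar coordinates `(r_b, θ_b)`. -/
def polarB (m : Model) (f : ℂ → ℂ) (r θ : ℝ) : ℂ :=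
  f (m.b - (r : ℂ) * Complex.exp (Complex.I * (θ : ℂ)))

open Filter Topology in
/-- The boundary conditions on `L_b`: for every `r > 0`, with the values at `θ_b = ±π` taken as
limits from inside the cut plane,
`f(r, π) = e^{2πiβ} f(r, -π)` and `∂_θ f(r, π) = e^{2πiβ} ∂_θ f(r, -π)`. -/
def BoundaryConditionsLb (m : Model) (f : ℂ → ℂ) : Prop :=
  ∀ r : ℝ, 0 < r →
    (∀ᶠ p : ℝ × ℝ in 𝓝 r ×ˢ 𝓝[<] Real.pi, DifferentiableAt ℝ (m.polarB f p.1) p.2) ∧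
    (∀ᶠ p : ℝ × ℝ in 𝓝 r ×ˢ 𝓝[>] (-Real.pi), DifferentiableAt ℝ (m.polarB f p.1) p.2) ∧
    ∃ v w : ℂ,
      Tendsto (fun p : ℝ × ℝ => m.polarB f p.1 p.2) (𝓝 r ×ˢ 𝓝[>] (-Real.pi)) (𝓝 v) ∧
      Tendsto (fun p : ℝ × ℝ => m.polarB f p.1 p.2) (𝓝 r ×ˢ 𝓝[<] Real.pi)
        (𝓝 (Complex.exp (2 * Real.pi * Complex.I * (m.β : ℂ)) * v)) ∧
      Tendsto (fun p : ℝ × ℝ => deriv (m.polarB f p.1) p.2) (𝓝 r ×ˢ 𝓝[>] (-Real.pi)) (𝓝 w) ∧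
      Tendsto (fun p : ℝ × ℝ => deriv (m.polarB f p.1) p.2) (𝓝 r ×ˢ 𝓝[<] Real.pi)
        (𝓝 (Complex.exp (2 * Real.pi * Complex.I * (m.β : ℂ)) * w))

end Model

end

end TwoSolenoid

open MeasureTheory Set Filter Topology
open scoped ComplexConjugate

namespace TwoSolenoid

/-! In the coordinate `z = (R - x) / R` the second solenoid is `0`, its cut is the negative axis,
and the first solenoid is `1`. Put `k = μω_c / ħ` and `κ = kR² / 2 = D / 2`. Once the Gaussian
`e^{-k|x|²/4}` is factored out, the eigenvalue equation at `E₁` becomes `∂∂̄G + κ((1 - z)∂G + αG) =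
0` (`HB_gauss_mul_comp`). The function `ψ₁` corresponds to `(1 - z)^α`, which is holomorphic and
killed by `(1 - z)∂ + α`. The substitution `s = (r_b / R) e^{-u}` turns `φ` into `-sin(πβ)/π` times
`corr`, that is `z^β e^{-κz̄} ∫₀^∞ (1 + s)^α s^{-β} e^{-κ|z|²/s} / (s + z) ds`. This solves the same
equation: after differentiation under the integral sign the equation is the integral of an exact
`s`-derivative with vanishing end values (`kernInt_relation`).

The boundary conditions and the hypergeometric formula come from one decomposition,
`corr_eq_incBeta`: `sin(πβ)/π · corr` is `(1 - z)^α` plus `z^β` times a function which is `C¹`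
across the negative axis. To obtain it, `exp_mul_kernInt_eq` writes the integral as its value
without exponentials minus a superposition of Laplace type integrals in which the denominator `s +
z` has disappeared. The first piece, a Stieltjes transform of `(1 + s)^α s^{-β}`, satisfies a first
order linear equation; its singular part at `0` is fixed by `∫₀^∞ s^{-β} / (1 + s) ds = π / sin(πβ)`
and produces exactly `(1 - z)^α`, while the rest is an incomplete Beta integral, hence a `₂F₁`. The
Laplace type integrals satisfy Kummer's equation and are identified with `U` by their behaviour at
`0` (`laplaceInt_eq_kummer`). In `ψ₁ + φ` the terms `(1 - z)^α` cancel. What remains is `z^β T(z)`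
with `T` of class `C¹` across the cut, so that value and angular derivative both jump by the factor
`e^{2πiβ}` of `z^β`.

For the maximal operator no boundary condition is needed: a square integrable `C²` solution off the
cuts is an eigenfunction, by integration by parts against test functions supported away from the
cuts (`isEigenfunction_of_classical`). Square integrability is delicate only near `L_b`, where `1 /
(s + z)` is almost singular; interpolation between two lower bounds of `|s + z|` costs only `|Im
z|^{-1/3}` (`exists_norm_kernInt_le`). Finally, `corr` is nonzero on the positive axis because its
integrand is positive there, and `ψ̃₂` is nonzero because `(1 - z)^α` vanishes at `z = 1` while
`corr` does not. -/

/-! ### Beta integrals over the half line. -/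

theorem image_div_one_add_Ioi : (fun s : ℝ => s / (1 + s)) '' Ioi 0 = Ioo 0 1 := by
  ext y
  simp only [mem_image, mem_Ioi, mem_Ioo]
  constructor
  · rintro ⟨s, hs, rfl⟩
    exact ⟨by positivity, by rw [div_lt_one (by positivity)]; linarith⟩
  · rintro ⟨h0, h1⟩
    refine ⟨y / (1 - y), div_pos h0 (by linarith), ?_⟩
    have : (1 - y) ≠ 0 := by linarith
    field_simp
    ring

theorem hasDerivAt_div_one_add {s : ℝ} (hs : 0 < s) :
    HasDerivAt (fun s : ℝ => s / (1 + s)) (1 / (1 + s) ^ 2) s := by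
  have h := (hasDerivAt_id' s).div ((hasDerivAt_id' s).const_add 1) (by positivity)
  convert! h using 1
  ring

theorem injOn_div_one_add : InjOn (fun s : ℝ => s / (1 + s)) (Ioi 0) := by
  intro s hs t ht h
  have hs' : (0 : ℝ) < s := hs
  have ht' : (0 : ℝ) < t := ht
  have := (div_eq_div_iff (by positivity) (by positivity)).1 h
  linarith

/-- The substitution `x = s / (1 + s)` carries the Beta density on `(0, 1)` to the half line; this
is the integrand together with its Jacobian. -/
theorem div_one_add_rpow_mul {u v s : ℝ} (hs : 0 < s) :
    |1 / (1 + s) ^ 2| • ((s / (1 + s)) ^ (u - 1) * (1 - s / (1 + s)) ^ (v - 1)) =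
      s ^ (u - 1) * (1 + s) ^ (-(u + v)) := by
  have h1 : 0 < 1 + s := by positivity
  have h2 : 1 - s / (1 + s) = (1 + s)⁻¹ := by field_simp; ring
  rw [h2, abs_of_pos (by positivity), Real.div_rpow hs.le h1.le, Real.inv_rpow h1.le,
    ← Real.rpow_neg h1.le, smul_eq_mul, div_eq_mul_inv (s ^ _), ← Real.rpow_neg h1.le,
    one_div, ← Real.rpow_natCast, ← Real.rpow_neg h1.le]
  calc _ = s ^ (u - 1) * ((1 + s) ^ (-((2 : ℕ) : ℝ)) * (1 + s) ^ (-(u - 1)) *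
        (1 + s) ^ (-(v - 1))) := by ring
    _ = _ := by
      rw [← Real.rpow_add h1, ← Real.rpow_add h1]
      congr 2; push_cast; ring

theorem integrableOn_beta {u v : ℝ} (hu : 0 < u) (hv : 0 < v) :
    IntegrableOn (fun x : ℝ => x ^ (u - 1) * (1 - x) ^ (v - 1)) (Ioo 0 1) := by
  have h := Complex.betaIntegral_convergent (u := u) (v := v) (by simpa) (by simpa)
  rw [intervalIntegrable_iff_integrableOn_Ioo_of_le zero_le_one] at h
  refine h.re.congr ?_
  refine (ae_restrict_iff' measurableSet_Ioo).2 (.of_forall fun x hx => ?_)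
  have h1 : (0 : ℝ) ≤ 1 - x := by linarith [hx.2]
  have : (x : ℂ) ^ ((u : ℂ) - 1) * (1 - (x : ℂ)) ^ ((v : ℂ) - 1) =
      ((x ^ (u - 1) * (1 - x) ^ (v - 1) : ℝ) : ℂ) := by
    push_cast [Complex.ofReal_cpow hx.1.le, Complex.ofReal_cpow h1]
    rfl
  simp only [this, RCLike.re_to_complex, Complex.ofReal_re]

theorem integral_beta {u v : ℝ} (hu : 0 < u) (hv : 0 < v) :
    ∫ x in Ioo (0 : ℝ) 1, x ^ (u - 1) * (1 - x) ^ (v - 1) =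
      Real.Gamma u * Real.Gamma v / Real.Gamma (u + v) := by
  have h := Complex.betaIntegral_eq_Gamma_mul_div u v (by simpa) (by simpa)
  rw [Complex.betaIntegral, intervalIntegral.integral_of_le zero_le_one,
    integral_Ioc_eq_integral_Ioo] at h
  have h' : ∫ x in Ioo (0 : ℝ) 1, (x : ℂ) ^ ((u : ℂ) - 1) * (1 - (x : ℂ)) ^ ((v : ℂ) - 1) =
      ∫ x in Ioo (0 : ℝ) 1, ((x ^ (u - 1) * (1 - x) ^ (v - 1) : ℝ) : ℂ) := by
    refine setIntegral_congr_fun measurableSet_Ioo fun x hx => ?_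
    have h1 : (0 : ℝ) ≤ 1 - x := by linarith [hx.2]
    push_cast [Complex.ofReal_cpow hx.1.le, Complex.ofReal_cpow h1]
    rfl
  rw [h', integral_complex_ofReal, ← Complex.ofReal_add, Complex.Gamma_ofReal, Complex.Gamma_ofReal,
    Complex.Gamma_ofReal] at h
  exact_mod_cast h

theorem integrableOn_beta_Ioi {u v : ℝ} (hu : 0 < u) (hv : 0 < v) :
    IntegrableOn (fun s : ℝ => s ^ (u - 1) * (1 + s) ^ (-(u + v))) (Ioi 0) := by
  have h := integrableOn_image_iff_integrableOn_abs_deriv_smul measurableSet_Ioi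
    (fun s hs => (hasDerivAt_div_one_add hs).hasDerivWithinAt) injOn_div_one_add
    (fun x : ℝ => x ^ (u - 1) * (1 - x) ^ (v - 1))
  rw [image_div_one_add_Ioi] at h
  exact (h.1 (integrableOn_beta hu hv)).congr_fun (fun s hs => div_one_add_rpow_mul hs)
    measurableSet_Ioi

/-- The Beta integral over the half line. -/
theorem integral_beta_Ioi {u v : ℝ} (hu : 0 < u) (hv : 0 < v) :
    ∫ s in Ioi (0 : ℝ), s ^ (u - 1) * (1 + s) ^ (-(u + v)) =
      Real.Gamma u * Real.Gamma v / Real.Gamma (u + v) := by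
  have h := integral_image_eq_integral_abs_deriv_smul measurableSet_Ioi
    (fun s hs => (hasDerivAt_div_one_add hs).hasDerivWithinAt) injOn_div_one_add
    (fun x : ℝ => x ^ (u - 1) * (1 - x) ^ (v - 1))
  rw [image_div_one_add_Ioi, integral_beta hu hv] at h
  rw [h]
  exact setIntegral_congr_fun measurableSet_Ioi fun s hs => (div_one_add_rpow_mul hs).symm

/-- Integrability on the half line of a product of powers of `s` and `1 + s`. -/
theorem integrableOn_rpow_mul_one_add_rpow {a b : ℝ} (hb : -1 < b) (hab : a + b < -1) :
    IntegrableOn (fun s : ℝ => (1 + s) ^ a * s ^ b) (Ioi 0) := by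
  have h := integrableOn_beta_Ioi (u := b + 1) (v := -(a + b + 1)) (by linarith) (by linarith)
  refine h.congr_fun (fun s _ => ?_) measurableSet_Ioi
  dsimp only
  rw [mul_comm, add_sub_cancel_right]
  congr 2
  ring

/-- `∫₀^∞ s^{-β} / (1 + s) ds = π / sin (π β)`. -/
theorem integral_rpow_neg_div_one_add {b : ℝ} (hb : 0 < b) (hb1 : b < 1) :
    ∫ s in Ioi (0 : ℝ), s ^ (-b) / (1 + s) = Real.pi / Real.sin (Real.pi * b) := by
  have h := integral_beta_Ioi (u := 1 - b) (v := b) (by linarith) hb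
  rw [sub_add_cancel, Real.Gamma_one, div_one, mul_comm (Real.Gamma _),
    Real.Gamma_mul_Gamma_one_sub] at h
  rw [← h]
  refine setIntegral_congr_fun measurableSet_Ioi fun s hs => ?_
  have h1 : 0 < s := hs
  simp only [Real.rpow_neg_one, div_eq_mul_inv]
  congr 2
  ring

/-! ### Wirtinger calculus. -/

/-- The real-linear map `v ↦ a v + b v̄`. -/
noncomputable def wirtinger (a b : ℂ) : ℂ →L[ℝ] ℂ :=
  a • ContinuousLinearMap.id ℝ ℂ + b • (Complex.conjCLE : ℂ →L[ℝ] ℂ)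

@[simp]
theorem wirtinger_apply (a b v : ℂ) : wirtinger a b v = a * v + b * conj v := by
  simp [wirtinger]

theorem norm_wirtinger_le (a b : ℂ) : ‖wirtinger a b‖ ≤ ‖a‖ + ‖b‖ := by
  refine ContinuousLinearMap.opNorm_le_bound _ (by positivity) fun v => ?_
  rw [wirtinger_apply]
  refine (norm_add_le _ _).trans ?_
  simp [add_mul]

/-- `f` is real differentiable at `z` with the Wirtinger derivatives `∂f = a`, `∂̄f = b`. -/
def HasWirtingerAt (f : ℂ → ℂ) (a b z : ℂ) : Prop := HasFDerivAt f (wirtinger a b) z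

namespace HasWirtingerAt

variable {f g : ℂ → ℂ} {a b a' b' z c : ℂ}

theorem hasFDerivAt (h : HasWirtingerAt f a b z) : HasFDerivAt f (wirtinger a b) z := h

theorem continuousAt (h : HasWirtingerAt f a b z) : ContinuousAt f z :=
  h.hasFDerivAt.continuousAt

theorem congr_val (h : HasWirtingerAt f a b z) (ha : a = a') (hb : b = b') :
    HasWirtingerAt f a' b' z := by subst ha hb; exact h

theorem congr_of_eventuallyEq (h : HasWirtingerAt f a b z) (hg : g =ᶠ[𝓝 z] f) :
    HasWirtingerAt g a b z := HasFDerivAt.congr_of_eventuallyEq h hg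

theorem const (c z : ℂ) : HasWirtingerAt (fun _ => c) 0 0 z := by
  have h : HasFDerivAt (fun _ : ℂ => c) (0 : ℂ →L[ℝ] ℂ) z := hasFDerivAt_const c z
  unfold HasWirtingerAt
  convert h using 1
  ext v; simp

theorem id (z : ℂ) : HasWirtingerAt (fun w => w) 1 0 z := by
  have h : HasFDerivAt (fun w : ℂ => w) (ContinuousLinearMap.id ℝ ℂ) z := hasFDerivAt_id z
  unfold HasWirtingerAt
  convert h using 1
  ext v; simp

theorem conj_id (z : ℂ) : HasWirtingerAt (fun w => conj w) 0 1 z := by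
  have h := (Complex.conjCLE : ℂ →L[ℝ] ℂ).hasFDerivAt (x := z)
  have e : wirtinger 0 1 = (Complex.conjCLE : ℂ →L[ℝ] ℂ) := by ext v; simp
  unfold HasWirtingerAt
  rw [e]
  exact h

theorem add (hf : HasWirtingerAt f a b z) (hg : HasWirtingerAt g a' b' z) :
    HasWirtingerAt (fun w => f w + g w) (a + a') (b + b') z := by
  have h := HasFDerivAt.add hf hg
  unfold HasWirtingerAt
  convert! h using 1
  ext v; simp; ring

theorem mul (hf : HasWirtingerAt f a b z) (hg : HasWirtingerAt g a' b' z) :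
    HasWirtingerAt (fun w => f w * g w) (a * g z + f z * a') (b * g z + f z * b') z := by
  have h := HasFDerivAt.mul hf hg
  unfold HasWirtingerAt
  convert! h using 1
  ext v; simp; ring

theorem const_mul (c : ℂ) (hf : HasWirtingerAt f a b z) :
    HasWirtingerAt (fun w => c * f w) (c * a) (c * b) z :=
  ((const c z).mul hf).congr_val (by ring) (by ring)

theorem neg (hf : HasWirtingerAt f a b z) : HasWirtingerAt (fun w => -f w) (-a) (-b) z := by
  have h := hf.const_mul (-1)
  simpa using h

theorem sub (hf : HasWirtingerAt f a b z) (hg : HasWirtingerAt g a' b' z) :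
    HasWirtingerAt (fun w => f w - g w) (a - a') (b - b') z := by
  have h := hf.add hg.neg
  simpa [sub_eq_add_neg] using h

theorem comp_deriv {φ : ℂ → ℂ} {d : ℂ} (hφ : HasDerivAt φ d (f z)) (hf : HasWirtingerAt f a b z) :
    HasWirtingerAt (fun w => φ (f w)) (d * a) (d * b) z := by
  have h := (hφ.hasFDerivAt.restrictScalars ℝ).comp z hf.hasFDerivAt
  unfold HasWirtingerAt
  convert! h using 1
  ext v; simp; ring

theorem of_hasDerivAt {d : ℂ} (h : HasDerivAt f d z) : HasWirtingerAt f d 0 z :=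
  (comp_deriv (f := fun w => w) h (id z)).congr_val (by ring) (by ring)

/-- A vanishing `∂̄f` is the Cauchy–Riemann equation. -/
theorem hasDerivAt (h : HasWirtingerAt f a 0 z) : HasDerivAt f a z := by
  have h1 := h.hasFDerivAt
  rw [hasDerivAt_iff_hasFDerivAt]
  refine hasFDerivAt_of_restrictScalars ℝ h1 ?_
  ext v; simp [mul_comm]

/-- A real factor `q` is its own conjugate, so both Wirtinger derivatives scale alike. This serves
the passage from `x` to `z = (R - x) / R`. -/
theorem comp_affine (p q : ℝ) (hf : HasWirtingerAt f a b (p + q * z)) :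
    HasWirtingerAt (fun w => f (p + q * w)) (q * a) (q * b) z := by
  have h1 : HasWirtingerAt (fun w : ℂ => (p : ℂ) + q * w) q 0 z :=
    ((const (p : ℂ) z).add ((id z).const_mul (q : ℂ))).congr_val (by ring) (by ring)
  have h := HasFDerivAt.comp (f := fun w : ℂ => (p : ℂ) + q * w) z hf.hasFDerivAt h1.hasFDerivAt
  unfold HasWirtingerAt
  convert! h using 1
  ext v; simp; ring

/-- Differentiation under the integral sign. -/
theorem integral {α : Type*} [MeasurableSpace α] {μ : Measure α} {F F₁ F₂ : ℂ → α → ℂ}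
    {bound : α → ℝ} {s : Set ℂ} (hs : s ∈ 𝓝 z)
    (hF_meas : ∀ w, AEStronglyMeasurable (F w) μ) (hF_int : Integrable (F z) μ)
    (hF₁ : AEStronglyMeasurable (F₁ z) μ) (hF₂ : AEStronglyMeasurable (F₂ z) μ)
    (hbound : Integrable bound μ)
    (h₁ : ∀ᵐ t ∂μ, ∀ w ∈ s, ‖F₁ w t‖ ≤ bound t) (h₂ : ∀ᵐ t ∂μ, ∀ w ∈ s, ‖F₂ w t‖ ≤ bound t)
    (hdiff : ∀ᵐ t ∂μ, ∀ w ∈ s, HasWirtingerAt (fun w => F w t) (F₁ w t) (F₂ w t) w) :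
    HasWirtingerAt (fun w => ∫ t, F w t ∂μ) (∫ t, F₁ z t ∂μ) (∫ t, F₂ z t ∂μ) z := by
  have hi₁ : Integrable (F₁ z) μ :=
    hbound.mono' hF₁ (h₁.mono fun t ht => ht z (mem_of_mem_nhds hs))
  have hi₂ : Integrable (F₂ z) μ :=
    hbound.mono' hF₂ (h₂.mono fun t ht => ht z (mem_of_mem_nhds hs))
  have e1 : Integrable (fun t => F₁ z t • ContinuousLinearMap.id ℝ ℂ) μ := hi₁.smul_const _
  have e2 : Integrable (fun t => F₂ z t • (Complex.conjCLE : ℂ →L[ℝ] ℂ)) μ := hi₂.smul_const _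
  have hw : wirtinger (∫ t, F₁ z t ∂μ) (∫ t, F₂ z t ∂μ) =
      ∫ t, wirtinger (F₁ z t) (F₂ z t) ∂μ := by
    unfold wirtinger
    rw [integral_add e1 e2, integral_smul_const, integral_smul_const]
  have hm : AEStronglyMeasurable (fun t => wirtinger (F₁ z t) (F₂ z t)) μ :=
    e1.aestronglyMeasurable.add e2.aestronglyMeasurable
  unfold HasWirtingerAt
  rw [hw]
  refine hasFDerivAt_integral_of_dominated_of_fderiv_le (bound := fun t => bound t + bound t)
    (F' := fun w t => wirtinger (F₁ w t) (F₂ w t)) hs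
    (.of_forall hF_meas) hF_int hm ?_ (hbound.add hbound) hdiff
  filter_upwards [h₁, h₂] with t h1 h2 w hw
  exact (norm_wirtinger_le _ _).trans (add_le_add (h1 w hw) (h2 w hw))

end HasWirtingerAt

/-- A function whose Wirtinger derivatives are of class `Cⁿ` is of class `Cⁿ⁺¹`. -/
theorem contDiffOn_succ_of_wirtinger {f f₁ f₂ : ℂ → ℂ} {s : Set ℂ} (hs : IsOpen s) {n : ℕ}
    (h : ∀ z ∈ s, HasWirtingerAt f (f₁ z) (f₂ z) z) (h₁ : ContDiffOn ℝ n f₁ s)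
    (h₂ : ContDiffOn ℝ n f₂ s) : ContDiffOn ℝ (n + 1 : ℕ) f s := by
  have h' : ContDiffOn ℝ ((n : WithTop ℕ∞) + 1) f s := by
    rw [contDiffOn_succ_iff_fderiv_of_isOpen hs]
    refine ⟨fun z hz => (h z hz).hasFDerivAt.differentiableAt.differentiableWithinAt, by simp, ?_⟩
    have : ContDiffOn ℝ n (fun z => wirtinger (f₁ z) (f₂ z)) s :=
      (h₁.smul contDiffOn_const).add (h₂.smul contDiffOn_const)
    exact this.congr fun z hz => (h z hz).hasFDerivAt.fderiv
  exact_mod_cast h'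

/-! ### Lower bounds for `|s + z|` on the slit plane. -/

theorem sq_norm_ofReal_add (z : ℂ) (s : ℝ) :
    ‖(s : ℂ) + z‖ ^ 2 = s ^ 2 + 2 * s * z.re + ‖z‖ ^ 2 := by
  rw [Complex.sq_norm, Complex.sq_norm, Complex.normSq_apply, Complex.normSq_apply]
  simp
  ring

/-- With `θ = arg z` this reads `(s + |z|)² cos² (θ / 2) ≤ |s + z|²`. -/
theorem sq_add_norm_mul_le {z : ℂ} (hz : z ≠ 0) (s : ℝ) :
    (s + ‖z‖) ^ 2 * ((‖z‖ + z.re) / (2 * ‖z‖)) ≤ ‖(s : ℂ) + z‖ ^ 2 := by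
  have hz' : 0 < ‖z‖ := norm_pos_iff.2 hz
  have h := (abs_le.1 (Complex.abs_re_le_norm z)).2
  rw [sq_norm_ofReal_add, mul_div_assoc', div_le_iff₀ (by positivity)]
  -- With the denominator `2|z|` cleared, the difference of the two sides is `(s - |z|)² (|z| - Re
  -- z)`.
  nlinarith [mul_nonneg (sq_nonneg (s - ‖z‖)) (sub_nonneg.2 h)]

theorem norm_add_re_pos {z : ℂ} (hz : z ∈ Complex.slitPlane) : 0 < ‖z‖ + z.re := by
  rcases hz with h | h
  · positivity
  · have h1 : |z.re| < ‖z‖ := Complex.abs_re_lt_norm.2 h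
    linarith [neg_abs_le z.re]

theorem ofReal_add_ne_zero {z : ℂ} (hz : z ∈ Complex.slitPlane) {s : ℝ} (hs : 0 ≤ s) :
    (s : ℂ) + z ≠ 0 := by
  have h1 := sq_add_norm_mul_le (Complex.slitPlane_ne_zero hz) s
  have h2 := norm_add_re_pos hz
  have h3 : 0 < ‖z‖ := norm_pos_iff.2 (Complex.slitPlane_ne_zero hz)
  intro h
  rw [h, norm_zero] at h1
  have : 0 < (s + ‖z‖) ^ 2 * ((‖z‖ + z.re) / (2 * ‖z‖)) := by positivity
  linarith

/-- Near a point of the slit plane, `|s + z|` is bounded below by a multiple of `1 + s`. -/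
theorem eventually_le_norm_ofReal_add {z₀ : ℂ} (hz₀ : z₀ ∈ Complex.slitPlane) :
    ∃ δ > 0, ∀ᶠ z in 𝓝 z₀, δ ≤ ‖z‖ ∧ ‖z‖ ≤ δ⁻¹ ∧ z ∈ Complex.slitPlane ∧
      ∀ s : ℝ, 0 < s → δ * (1 + s) ≤ ‖(s : ℂ) + z‖ := by
  have hz0 := Complex.slitPlane_ne_zero hz₀
  have hn : 0 < ‖z₀‖ := norm_pos_iff.2 hz0
  set q : ℂ → ℝ := fun z => (‖z‖ + z.re) / (2 * ‖z‖) with hq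
  have hqc : ContinuousAt q z₀ := by
    refine ContinuousAt.div ?_ ?_ (by positivity)
    · exact (continuous_norm.add Complex.continuous_re).continuousAt
    · exact (continuous_const.mul continuous_norm).continuousAt
  have hq0 : 0 < q z₀ := div_pos (norm_add_re_pos hz₀) (by positivity)
  set m : ℝ := min 1 (‖z₀‖ / 2) with hm
  have hm0 : 0 < m := lt_min one_pos (by positivity)
  -- The three entries serve the three bounds: `m √(q/2)` the one on `|s + z|`, with `m(1 + s) ≤ s +
  -- |z|` and `q = cos²(θ/2)` at least half its value at `z₀`; `m` the lower and `(‖z₀‖ + 1)⁻¹` the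
  -- upper bound of `|z|`.
  set δ : ℝ := min (min (m * √(q z₀ / 2)) m) (‖z₀‖ + 1)⁻¹ with hδ
  have hδ0 : 0 < δ := by
    refine lt_min (lt_min (mul_pos hm0 (Real.sqrt_pos.2 (by positivity))) hm0) (by positivity)
  refine ⟨δ, hδ0, ?_⟩
  filter_upwards [continuous_norm.continuousAt.eventually (lt_mem_nhds (half_lt_self hn)),
    continuous_norm.continuousAt.eventually (gt_mem_nhds (lt_add_one ‖z₀‖)),
    hqc.eventually (lt_mem_nhds (half_lt_self hq0)),
    Complex.isOpen_slitPlane.mem_nhds hz₀] with z h1 h2 h3 h4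
  have hmz : m ≤ ‖z‖ := (min_le_right _ _).trans h1.le
  refine ⟨((min_le_left _ _).trans (min_le_right _ _)).trans hmz, ?_, h4, fun s hs => ?_⟩
  · refine h2.le.trans ?_
    rw [le_inv_comm₀ (by positivity) hδ0]
    exact min_le_right _ _
  · have h5 := sq_add_norm_mul_le (Complex.slitPlane_ne_zero h4) s
    have h6 : m * (1 + s) ≤ s + ‖z‖ := by nlinarith [min_le_left 1 (‖z₀‖ / 2)]
    have h7 : (m * √(q z₀ / 2)) * (1 + s) ≤ ‖(s : ℂ) + z‖ := by
      refine (sq_le_sq₀ (by positivity) (norm_nonneg _)).1 ?_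
      refine le_trans ?_ h5
      calc (m * √(q z₀ / 2) * (1 + s)) ^ 2 = (m * (1 + s)) ^ 2 * (√(q z₀ / 2)) ^ 2 := by ring
        _ = (m * (1 + s)) ^ 2 * (q z₀ / 2) := by rw [Real.sq_sqrt (by positivity)]
        _ ≤ (s + ‖z‖) ^ 2 * q z := by gcongr
    exact le_trans (by gcongr; exact (min_le_left _ _).trans (min_le_left _ _)) h7

/-! ### The kernel integrals and their derivatives. -/

/-- The integrand `(1 + s)^a s^{-b} s^{-p} e^{-κ|z|²/s} (s + z)^{-n}`. -/
noncomputable def kern (a b κ : ℝ) (p n : ℕ) (z : ℂ) (s : ℝ) : ℂ :=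
  (((1 + s) ^ a * s ^ (-b) : ℝ) : ℂ) * (s : ℂ)⁻¹ ^ p *
    Complex.exp (-(κ * (z * conj z)) * (s : ℂ)⁻¹) * ((s : ℂ) + z)⁻¹ ^ n

/-- `∫₀^∞ (1 + s)^a s^{-b-p} e^{-κ|z|²/s} (s + z)^{-n} ds`. -/
noncomputable def kernInt (a b κ : ℝ) (p n : ℕ) (z : ℂ) : ℂ :=
  ∫ s in Ioi (0 : ℝ), kern a b κ p n z s

/-- The family is closed under differentiation, which is why it carries the two exponents: the
exponential yields `-κz̄/s` or `-κz/s` and raises `p`, the power of `s + z` is holomorphic and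
raises `n`. -/
theorem kern_wirtinger (a b κ : ℝ) (p n : ℕ) {z : ℂ} (hz : z ∈ Complex.slitPlane) {s : ℝ}
    (hs : 0 < s) :
    HasWirtingerAt (fun w => kern a b κ p n w s)
      (-(κ * conj z) * kern a b κ (p + 1) n z s - n * kern a b κ p (n + 1) z s)
      (-(κ * z) * kern a b κ (p + 1) n z s) z := by
  have hne := ofReal_add_ne_zero hz hs.le
  have h1 : HasWirtingerAt (fun w : ℂ => -(κ * (w * conj w)) * (s : ℂ)⁻¹)
      (-(κ * conj z) * (s : ℂ)⁻¹) (-(κ * z) * (s : ℂ)⁻¹) z :=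
    ((((HasWirtingerAt.id z).mul (HasWirtingerAt.conj_id z)).const_mul (-κ * (s : ℂ)⁻¹)).congr_val
      (by ring) (by ring)).congr_of_eventuallyEq (.of_forall fun w => by ring)
  have h2 := HasWirtingerAt.comp_deriv (φ := Complex.exp) (Complex.hasDerivAt_exp _) h1
  have h3 : HasDerivAt (fun w : ℂ => ((s : ℂ) + w)⁻¹ ^ n) (-n * ((s : ℂ) + z)⁻¹ ^ (n + 1)) z := by
    have h := (((hasDerivAt_id' z).const_add (s : ℂ)).inv hne).pow n
    convert! h using 1
    rcases n with _ | n
    · simp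
    · simp only [Nat.add_sub_cancel, Pi.inv_apply, pow_succ]
      field_simp
  have h4 := (h2.mul (HasWirtingerAt.of_hasDerivAt h3)).const_mul
    ((((1 + s) ^ a * s ^ (-b) : ℝ) : ℂ) * (s : ℂ)⁻¹ ^ p)
  refine (h4.congr_val ?_ ?_).congr_of_eventuallyEq (.of_forall fun w => ?_)
  · simp only [kern, pow_succ]; ring
  · simp only [kern, pow_succ]; ring
  · simp only [kern]; ring

theorem measurable_kern (a b κ : ℝ) (p n : ℕ) (z : ℂ) : Measurable (kern a b κ p n z) := by
  unfold kern
  fun_prop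

theorem norm_kern (a b κ : ℝ) (p n : ℕ) (z : ℂ) {s : ℝ} (hs : 0 < s) :
    ‖kern a b κ p n z s‖ =
      (1 + s) ^ a * s ^ (-b) * s⁻¹ ^ p * Real.exp (-(κ * ‖z‖ ^ 2) * s⁻¹) * ‖(s : ℂ) + z‖⁻¹ ^ n := by
  have e : (-((κ : ℂ) * (z * conj z)) * (s : ℂ)⁻¹) = ((-(κ * ‖z‖ ^ 2) * s⁻¹ : ℝ) : ℂ) := by
    rw [Complex.mul_conj, Complex.normSq_eq_norm_sq]
    push_cast
    ring
  unfold kern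
  rw [e, ← Complex.ofReal_exp]
  simp only [norm_mul, norm_pow, norm_inv, Complex.norm_real, Real.norm_eq_abs]
  rw [abs_of_pos (Real.rpow_pos_of_pos (by positivity) _), abs_of_pos (Real.rpow_pos_of_pos hs _),
    abs_of_pos hs, abs_of_pos (Real.exp_pos _)]

/-- Take `y^p / p! ≤ e^y` at `y = η(1 + 1/s)` and write `1/s = (1 + 1/s) / (1 + s)`: the exponential
absorbs the singularity at `0` and the decay at infinity is kept. -/
theorem inv_pow_mul_exp_neg_le {η s : ℝ} (hη : 0 < η) (hs : 0 < s) (p : ℕ) :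
    s⁻¹ ^ p * Real.exp (-η * s⁻¹) ≤ p.factorial * Real.exp η / η ^ p * (1 + s)⁻¹ ^ p := by
  have h := Real.pow_div_factorial_le_exp (η * (1 + s⁻¹)) (by positivity) p
  rw [div_le_iff₀ (by positivity)] at h
  have h1 : (s⁻¹ : ℝ) = (1 + s⁻¹) * (1 + s)⁻¹ := by field_simp; ring
  calc s⁻¹ ^ p * Real.exp (-η * s⁻¹)
      = (η * (1 + s⁻¹)) ^ p * (1 + s)⁻¹ ^ p / η ^ p * Real.exp (-η * s⁻¹) := by
        conv_lhs => rw [h1, mul_pow, ← h1]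
        rw [mul_pow]
        field_simp
    _ ≤ (Real.exp (η * (1 + s⁻¹)) * p.factorial) * (1 + s)⁻¹ ^ p / η ^ p *
          Real.exp (-η * s⁻¹) := by gcongr
    _ = _ := by
        have : Real.exp (η * (1 + s⁻¹)) * Real.exp (-η * s⁻¹) = Real.exp η := by
          rw [← Real.exp_add]; ring_nf
        rw [← this]
        ring

/-- A locally uniform integrable bound for the integrands. -/
theorem eventually_norm_kern_le {a b κ : ℝ} (hκ : 0 ≤ κ) {z₀ : ℂ} (hz₀ : z₀ ∈ Complex.slitPlane)
    {p n : ℕ} (hpn : 1 ≤ p + n) (hp : p = 0 ∨ 0 < κ) :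
    ∃ C, ∀ᶠ z in 𝓝 z₀, ∀ s : ℝ, 0 < s →
      ‖kern a b κ p n z s‖ ≤ C * ((1 + s) ^ (a - 1) * s ^ (-b)) := by
  obtain ⟨δ, hδ, hev⟩ := eventually_le_norm_ofReal_add hz₀
  -- Powers of `1/s` are tamed by the exponential, which needs `κ > 0`; for `p = 0` the bound of the
  -- exponential by `1` is enough.
  obtain ⟨C, hC, hC'⟩ : ∃ C : ℝ, 0 ≤ C ∧ ∀ s : ℝ, 0 < s →
      s⁻¹ ^ p * Real.exp (-(κ * δ ^ 2) * s⁻¹) ≤ C * (1 + s)⁻¹ ^ p := by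
    rcases hp with rfl | hκ
    · refine ⟨1, zero_le_one, fun s hs => ?_⟩
      simp only [pow_zero, one_mul, mul_one, Real.exp_le_one_iff]
      have : 0 ≤ κ * δ ^ 2 * s⁻¹ := by positivity
      linarith
    · exact ⟨_, by positivity, fun s hs => inv_pow_mul_exp_neg_le (by positivity) hs p⟩
  refine ⟨C * δ⁻¹ ^ n, hev.mono fun z hz s hs => ?_⟩
  obtain ⟨h1, -, -, h2⟩ := hz
  have hs1 : (0 : ℝ) < 1 + s := by positivity
  have h3 : Real.exp (-(κ * ‖z‖ ^ 2) * s⁻¹) ≤ Real.exp (-(κ * δ ^ 2) * s⁻¹) := by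
    rw [Real.exp_le_exp]
    have : κ * δ ^ 2 * s⁻¹ ≤ κ * ‖z‖ ^ 2 * s⁻¹ := by gcongr
    linarith
  have h4 : ‖(s : ℂ) + z‖⁻¹ ≤ δ⁻¹ * (1 + s)⁻¹ := by
    rw [← mul_inv]
    exact inv_anti₀ (by positivity) (h2 s hs)
  -- Of the `p + n ≥ 1` factors `(1 + s)⁻¹` a single one is kept; with it the majorant is integrable
  -- at infinity as soon as `a < b`.
  have h5 : (1 + s)⁻¹ ^ (p + n) ≤ (1 + s)⁻¹ := by
    refine pow_le_of_le_one (by positivity) ?_ (by omega)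
    exact inv_le_one_of_one_le₀ (by linarith)
  rw [norm_kern _ _ _ _ _ _ hs]
  have hpos : 0 ≤ (1 + s) ^ a * s ^ (-b) :=
    mul_nonneg (Real.rpow_nonneg hs1.le _) (Real.rpow_nonneg hs.le _)
  calc (1 + s) ^ a * s ^ (-b) * s⁻¹ ^ p * Real.exp (-(κ * ‖z‖ ^ 2) * s⁻¹) * ‖(s : ℂ) + z‖⁻¹ ^ n
      = (1 + s) ^ a * s ^ (-b) * ((s⁻¹ ^ p * Real.exp (-(κ * ‖z‖ ^ 2) * s⁻¹)) *
          ‖(s : ℂ) + z‖⁻¹ ^ n) := by ring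
    _ ≤ (1 + s) ^ a * s ^ (-b) * ((s⁻¹ ^ p * Real.exp (-(κ * δ ^ 2) * s⁻¹)) *
          (δ⁻¹ * (1 + s)⁻¹) ^ n) := by gcongr
    _ ≤ (1 + s) ^ a * s ^ (-b) * ((C * (1 + s)⁻¹ ^ p) * (δ⁻¹ * (1 + s)⁻¹) ^ n) := by
          gcongr ((1 + s) ^ a * s ^ (-b)) * (?_ * _)
          exact hC' s hs
    _ = (1 + s) ^ a * s ^ (-b) * (C * δ⁻¹ ^ n * (1 + s)⁻¹ ^ (p + n)) := by
          rw [mul_pow, pow_add]; ring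
    _ ≤ (1 + s) ^ a * s ^ (-b) * (C * δ⁻¹ ^ n * (1 + s)⁻¹) := by gcongr
    _ = _ := by
          rw [Real.rpow_sub hs1, Real.rpow_one]; ring

theorem integrableOn_bound {a b : ℝ} (hab : a < b) (hb : b < 1) (C : ℝ) :
    IntegrableOn (fun s : ℝ => C * ((1 + s) ^ (a - 1) * s ^ (-b))) (Ioi 0) :=
  (integrableOn_rpow_mul_one_add_rpow (by linarith) (by linarith)).const_mul C

theorem integrableOn_kern {a b κ : ℝ} (hab : a < b) (hb : b < 1) (hκ : 0 ≤ κ) {z : ℂ}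
    (hz : z ∈ Complex.slitPlane) {p n : ℕ} (hpn : 1 ≤ p + n) (hp : p = 0 ∨ 0 < κ) :
    IntegrableOn (kern a b κ p n z) (Ioi 0) := by
  obtain ⟨C, hC⟩ := eventually_norm_kern_le (a := a) (b := b) hκ hz hpn hp
  refine (integrableOn_bound hab hb C).mono' (measurable_kern _ _ _ _ _ _).aestronglyMeasurable ?_
  exact (ae_restrict_iff' measurableSet_Ioi).2 (.of_forall fun s hs => hC.self_of_nhds s hs)

theorem kernInt_wirtinger {a b κ : ℝ} (hab : a < b) (hb : b < 1) (hκ : 0 ≤ κ) {z : ℂ}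
    (hz : z ∈ Complex.slitPlane) {p n : ℕ} (hpn : 1 ≤ p + n) (hp : p = 0 ∨ 0 < κ) :
    HasWirtingerAt (kernInt a b κ p n)
      (-(κ * conj z) * kernInt a b κ (p + 1) n z - n * kernInt a b κ p (n + 1) z)
      (-(κ * z) * kernInt a b κ (p + 1) n z) z := by
  -- The bound is for `κ` times the kernel so as to include `κ = 0`, where the integral with `p + 1`
  -- is not controlled but enters the derivative with the coefficient `0`.
  obtain ⟨C₁, hC₁⟩ : ∃ C, ∀ᶠ w in 𝓝 z, ∀ s : ℝ, 0 < s →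
      ‖κ * kern a b κ (p + 1) n w s‖ ≤ C * ((1 + s) ^ (a - 1) * s ^ (-b)) := by
    rcases hκ.eq_or_lt with rfl | h
    · exact ⟨0, .of_forall fun w s _ => by simp⟩
    · obtain ⟨C, hC⟩ := eventually_norm_kern_le (a := a) (b := b) hκ hz
        (show 1 ≤ p + 1 + n by omega) (Or.inr h)
      refine ⟨κ * C, hC.mono fun w hw s hs => ?_⟩
      rw [norm_mul, Complex.norm_real, Real.norm_of_nonneg hκ, mul_assoc]
      exact mul_le_mul_of_nonneg_left (hw s hs) hκ
  obtain ⟨C₂, hC₂⟩ := eventually_norm_kern_le (a := a) (b := b) hκ hz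
    (show 1 ≤ p + (n + 1) by omega) hp
  obtain ⟨δ, hδ, hev⟩ := eventually_le_norm_ofReal_add hz
  have hset := (hC₁.and (hC₂.and hev))
  have key : ∀ w ∈ {w | (∀ s : ℝ, 0 < s →
      ‖κ * kern a b κ (p + 1) n w s‖ ≤ C₁ * ((1 + s) ^ (a - 1) * s ^ (-b))) ∧ (∀ s : ℝ, 0 < s →
      ‖kern a b κ p (n + 1) w s‖ ≤ C₂ * ((1 + s) ^ (a - 1) * s ^ (-b))) ∧ (δ ≤ ‖w‖ ∧ ‖w‖ ≤ δ⁻¹ ∧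
      w ∈ Complex.slitPlane ∧ ∀ s : ℝ, 0 < s → δ * (1 + s) ≤ ‖(s : ℂ) + w‖)}, ∀ s : ℝ, 0 < s →
      ‖κ * kern a b κ (p + 1) n w s‖ * ‖w‖ ≤ δ⁻¹ * C₁ * ((1 + s) ^ (a - 1) * s ^ (-b)) := by
    intro w hw s hs
    have h1 := hw.1 s hs
    calc _ ≤ (C₁ * ((1 + s) ^ (a - 1) * s ^ (-b))) * δ⁻¹ :=
          mul_le_mul h1 hw.2.2.2.1 (norm_nonneg _) ((norm_nonneg _).trans h1)
      _ = _ := by ring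
  have main := HasWirtingerAt.integral (μ := volume.restrict (Ioi (0 : ℝ)))
    (F := kern a b κ p n)
    (F₁ := fun w s => -(κ * conj w) * kern a b κ (p + 1) n w s - n * kern a b κ p (n + 1) w s)
    (F₂ := fun w s => -(κ * w) * kern a b κ (p + 1) n w s) (z := z)
    (bound := fun s => (δ⁻¹ * C₁ + n * C₂) * ((1 + s) ^ (a - 1) * s ^ (-b))) hset
    (fun w => (measurable_kern _ _ _ _ _ _).aestronglyMeasurable)
    (integrableOn_kern hab hb hκ hz hpn hp)
    (((measurable_kern _ _ _ _ _ _).const_mul _).sub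
      ((measurable_kern _ _ _ _ _ _).const_mul _)).aestronglyMeasurable
    ((measurable_kern _ _ _ _ _ _).const_mul _).aestronglyMeasurable
    (integrableOn_bound hab hb _) ?_ ?_ ?_
  · refine main.congr_val ?_ ?_
    · rcases hκ.eq_or_lt with rfl | h
      · simp [kernInt, integral_neg, integral_const_mul]
      · rw [integral_sub, integral_const_mul, integral_const_mul]
        · rfl
        · exact (integrableOn_kern hab hb hκ hz (by omega) (Or.inr h)).const_mul _
        · exact (integrableOn_kern hab hb hκ hz (by omega) hp).const_mul _
    · rw [integral_const_mul]; rfl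
  · refine (ae_restrict_iff' measurableSet_Ioi).2 (.of_forall fun s hs w hw => ?_)
    have h1 := key w hw s hs
    have h2 := hw.2.1 s hs
    calc _ ≤ ‖-(κ * conj w) * kern a b κ (p + 1) n w s‖ + ‖n * kern a b κ p (n + 1) w s‖ :=
          norm_sub_le _ _
      _ = ‖κ * kern a b κ (p + 1) n w s‖ * ‖w‖ + n * ‖kern a b κ p (n + 1) w s‖ := by
          simp only [norm_mul, norm_neg, RCLike.norm_conj, RCLike.norm_natCast]; ring
      _ ≤ δ⁻¹ * C₁ * ((1 + s) ^ (a - 1) * s ^ (-b)) +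
          n * (C₂ * ((1 + s) ^ (a - 1) * s ^ (-b))) := by gcongr
      _ = _ := by ring
  · refine (ae_restrict_iff' measurableSet_Ioi).2 (.of_forall fun s hs w hw => ?_)
    have h1 := key w hw s hs
    have h2 := (norm_nonneg _).trans (hw.2.1 s hs)
    calc _ = ‖κ * kern a b κ (p + 1) n w s‖ * ‖w‖ := by
          simp only [norm_mul, norm_neg]; ring
      _ ≤ δ⁻¹ * C₁ * ((1 + s) ^ (a - 1) * s ^ (-b)) +
          n * (C₂ * ((1 + s) ^ (a - 1) * s ^ (-b))) := by
          have : 0 ≤ (n : ℝ) * (C₂ * ((1 + s) ^ (a - 1) * s ^ (-b))) := by positivity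
          linarith
      _ = _ := by ring
  · exact (ae_restrict_iff' measurableSet_Ioi).2 (.of_forall fun s hs w hw =>
      kern_wirtinger a b κ p n hw.2.2.2.2.1 hs)

/-- Both derivatives stay in the family, so the induction on `k` runs over all `p`, `n` at once. -/
theorem contDiffOn_kernInt {a b κ : ℝ} (hab : a < b) (hb : b < 1) (hκ : 0 < κ) (k : ℕ) :
    ∀ p n : ℕ, 1 ≤ p + n → ContDiffOn ℝ k (kernInt a b κ p n) Complex.slitPlane := by
  induction k with
  | zero =>
    intro p n hpn
    exact contDiffOn_zero.2 fun z hz =>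
      (kernInt_wirtinger hab hb hκ.le hz hpn (Or.inr hκ)).continuousAt.continuousWithinAt
  | succ k ih =>
    intro p n hpn
    have hconj : ContDiffOn ℝ k (fun z : ℂ => conj z) Complex.slitPlane :=
      (Complex.conjCLE : ℂ →L[ℝ] ℂ).contDiff.contDiffOn
    refine contDiffOn_succ_of_wirtinger Complex.isOpen_slitPlane
      (fun z hz => kernInt_wirtinger hab hb hκ.le hz hpn (Or.inr hκ)) ?_ ?_
    · exact ((contDiffOn_const.mul hconj).neg.mul (ih (p + 1) n (by omega))).sub
        (contDiffOn_const.mul (ih p (n + 1) (by omega)))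
    · exact (contDiffOn_const.mul contDiffOn_id).neg.mul (ih (p + 1) n (by omega))

/-! ### Integrals of exact derivatives over the half line. -/

/-- `f` is integrable with integral `v`. -/
def HasInt {α : Type*} [MeasurableSpace α] (μ : Measure α) (f : α → ℂ) (v : ℂ) : Prop :=
  Integrable f μ ∧ ∫ t, f t ∂μ = v

namespace HasInt

variable {α : Type*} [MeasurableSpace α] {μ : Measure α} {f g : α → ℂ} {v w : ℂ}

theorem mk_self (hf : Integrable f μ) : HasInt μ f (∫ t, f t ∂μ) := ⟨hf, rfl⟩

theorem add (hf : HasInt μ f v) (hg : HasInt μ g w) : HasInt μ (fun t => f t + g t) (v + w) :=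
  ⟨hf.1.add hg.1, by rw [integral_add hf.1 hg.1, hf.2, hg.2]⟩

theorem sub (hf : HasInt μ f v) (hg : HasInt μ g w) : HasInt μ (fun t => f t - g t) (v - w) :=
  ⟨hf.1.sub hg.1, by rw [integral_sub hf.1 hg.1, hf.2, hg.2]⟩

theorem neg (hf : HasInt μ f v) : HasInt μ (fun t => -f t) (-v) :=
  ⟨hf.1.neg, by rw [integral_neg, hf.2]⟩

theorem const_mul (c : ℂ) (hf : HasInt μ f v) : HasInt μ (fun t => c * f t) (c * v) :=
  ⟨hf.1.const_mul c, by rw [integral_const_mul, hf.2]⟩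

end HasInt

/-- The primitives used below are products of powers whose formal value at `0` is irrelevant; only
the one-sided limit counts, so `f` is redefined at `0` by that limit. -/
theorem integral_Ioi_of_hasDerivAt_of_tendsto_nhdsGT {f f' : ℝ → ℂ} {m l : ℂ}
    (hd : ∀ s ∈ Ioi (0 : ℝ), HasDerivAt f (f' s) s) (hi : IntegrableOn f' (Ioi 0))
    (h0 : Tendsto f (𝓝[>] 0) (𝓝 m)) (hl : Tendsto f atTop (𝓝 l)) :
    ∫ s in Ioi (0 : ℝ), f' s = l - m := by
  have hne : ∀ s : ℝ, 0 < s → Function.update f 0 m s = f s := fun s hs =>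
    Function.update_of_ne hs.ne' _ _
  have h := integral_Ioi_of_hasDerivAt_of_tendsto (f := Function.update f 0 m) (f' := f') (a := 0)
    (m := l) ?_ ?_ hi ?_
  · simpa using h
  · have h1 : Tendsto (Function.update f 0 m) (𝓝[>] 0) (𝓝 m) :=
      h0.congr' (eventually_mem_nhdsWithin.mono fun s hs => (hne s hs).symm)
    rw [← continuousWithinAt_Ioi_iff_Ici]
    simpa [ContinuousWithinAt] using h1
  · intro s hs
    refine (hd s hs).congr_of_eventuallyEq ?_
    filter_upwards [lt_mem_nhds (show (0 : ℝ) < s from hs)] with t ht using hne t ht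
  · exact hl.congr' ((eventually_gt_atTop 0).mono fun s hs => (hne s hs).symm)

theorem tendsto_one_add_rpow_mul_rpow_atTop {a c : ℝ} (h : a + c < 0) :
    Tendsto (fun s : ℝ => (1 + s) ^ a * s ^ c) atTop (𝓝 0) := by
  have h1 : Tendsto (fun s : ℝ => (1 + s⁻¹) ^ a * s ^ (-(-(a + c)))) atTop (𝓝 (1 ^ a * 0)) := by
    refine Tendsto.mul (Tendsto.rpow_const ?_ (Or.inl (by norm_num)))
      (tendsto_rpow_neg_atTop (by linarith))
    simpa using tendsto_inv_atTop_zero.const_add (1 : ℝ)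
  rw [mul_zero] at h1
  refine h1.congr' ((eventually_gt_atTop 0).mono fun s hs => ?_)
  have e : 1 + s = (1 + s⁻¹) * s := by field_simp; ring
  dsimp only
  rw [e, Real.mul_rpow (by positivity) hs.le, mul_assoc, ← Real.rpow_add hs, neg_neg]

theorem tendsto_one_add_rpow_mul_rpow_nhdsGT {a c : ℝ} (h : 0 < c) :
    Tendsto (fun s : ℝ => (1 + s) ^ a * s ^ c) (𝓝[>] 0) (𝓝 0) := by
  have h1 : ContinuousAt (fun s : ℝ => (1 + s) ^ a * s ^ c) 0 := by
    refine ContinuousAt.mul ?_ (Real.continuousAt_rpow_const _ _ (Or.inr h.le))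
    exact ContinuousAt.rpow_const (by fun_prop) (Or.inl (by norm_num))
  have h2 := h1.tendsto
  simp only [Real.zero_rpow h.ne', mul_zero] at h2
  exact h2.mono_left nhdsWithin_le_nhds

theorem hasDerivAt_one_add_rpow_mul_rpow (a c : ℝ) {s : ℝ} (hs : 0 < s) :
    HasDerivAt (fun s : ℝ => (((1 + s) ^ a * s ^ c : ℝ) : ℂ))
      ((((1 + s) ^ a * s ^ c : ℝ) : ℂ) * (a / (1 + s) + c / s)) s := by
  have hs1 : 0 < 1 + s := by positivity
  have h1 := ((hasDerivAt_id' s).const_add 1).rpow_const (p := a) (Or.inl hs1.ne')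
  have h2 := (hasDerivAt_id' s).rpow_const (p := c) (Or.inl hs.ne')
  have h3 := (h1.mul h2).ofReal_comp
  convert! h3 using 1
  rw [Real.rpow_sub_one hs1.ne', Real.rpow_sub_one hs.ne']
  have e1 : (1 : ℂ) + s ≠ 0 := by exact_mod_cast hs1.ne'
  have e2 : (s : ℂ) ≠ 0 := by exact_mod_cast hs.ne'
  push_cast
  field_simp

/-! ### The differential relation of the kernel integrals. -/

theorem one_add_rpow_sub_one_mul {a b s : ℝ} (hs : 0 < s) :
    (1 + s) * ((1 + s) ^ (a - 1) * s ^ (-b)) = (1 + s) ^ a * s ^ (-b) := by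
  rw [Real.rpow_sub_one (by positivity)]
  field_simp

theorem kern_succ_left (a b κ : ℝ) (p n : ℕ) (z : ℂ) (s : ℝ) :
    kern a b κ (p + 1) n z s = (s : ℂ)⁻¹ * kern a b κ p n z s := by
  simp only [kern, pow_succ]; ring

theorem kern_succ_right (a b κ : ℝ) (p n : ℕ) (z : ℂ) (s : ℝ) :
    kern a b κ p (n + 1) z s = ((s : ℂ) + z)⁻¹ * kern a b κ p n z s := by
  simp only [kern, pow_succ]; ring

/-- Partial fractions, `1/(s + z) + z/(s(s + z)) = 1/s`. Through this identity `∂̄` of `corr` loses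
the denominator `s + z`. -/
theorem kern_zero_one_add (a b κ : ℝ) (p : ℕ) {z : ℂ} (hz : z ∈ Complex.slitPlane) {s : ℝ}
    (hs : 0 < s) : kern a b κ p 1 z s + z * kern a b κ (p + 1) 1 z s = kern a b κ (p + 1) 0 z s := by
  have h1 := ofReal_add_ne_zero hz hs.le
  have h2 : (s : ℂ) ≠ 0 := by exact_mod_cast hs.ne'
  simp only [kern_succ_left, kern_succ_right _ _ _ _ 0]
  field_simp

theorem hasDerivAt_kern (a b κ : ℝ) {z : ℂ} (hz : z ∈ Complex.slitPlane) {s : ℝ} (hs : 0 < s) :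
    HasDerivAt (kern a b κ 0 1 z) (kern a b κ 0 1 z s *
      (a / (1 + s) - b / s + κ * (z * conj z) / s ^ 2 - ((s : ℂ) + z)⁻¹)) s := by
  have hs1 : 0 < 1 + s := by positivity
  have h0 : (s : ℂ) ≠ 0 := by exact_mod_cast hs.ne'
  have hne := ofReal_add_ne_zero hz hs.le
  have h1 := hasDerivAt_one_add_rpow_mul_rpow a (-b) hs
  have hid : HasDerivAt (fun s : ℝ => (s : ℂ)) 1 s := (hasDerivAt_id' s).ofReal_comp
  have h2 := ((hid.inv h0).const_mul (-(κ * (z * conj z)))).cexp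
  have h3 := (hid.add_const z).inv hne
  have h4 := (h1.mul h2).mul h3
  have e : kern a b κ 0 1 z = fun s : ℝ => (((1 + s) ^ a * s ^ (-b) : ℝ) : ℂ) *
      Complex.exp (-(κ * (z * conj z)) * (s : ℂ)⁻¹) * ((s : ℂ) + z)⁻¹ := by
    funext t; simp [kern]
  rw [e]
  convert! h4 using 1
  simp only [Pi.mul_apply, Pi.inv_apply]
  push_cast
  have e1 : (1 : ℂ) + s ≠ 0 := by exact_mod_cast hs1.ne'
  field_simp
  ring

/-- The relation between the integrals behind the eigenvalue equation. -/
theorem kernInt_relation {a b κ : ℝ} (hab : a < b) (hb : b < 1) (hκ : 0 < κ) {z : ℂ}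
    (hz : z ∈ Complex.slitPlane) :
    -(b / z * kernInt a b κ 1 0 z - κ * conj z * kernInt a b κ 2 0 z) +
      (1 - z) * (b / z * kernInt a b κ 0 1 z - κ * conj z * kernInt a b κ 1 1 z -
        kernInt a b κ 0 2 z) + a * kernInt a b κ 0 1 z = 0 := by
  have hz0 := Complex.slitPlane_ne_zero hz
  have hi : ∀ p n, 1 ≤ p + n → IntegrableOn (kern a b κ p n z) (Ioi 0) := fun p n h =>
    integrableOn_kern hab hb hκ.le hz h (Or.inr hκ)
  -- The integrand of the claimed relation is the `s`-derivative of `(1 + s)^(a+1) s^{-b}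
  -- e^{-κ|z|²/s} / (s + z)`.
  have hd : ∀ s ∈ Ioi (0 : ℝ), HasDerivAt (fun s : ℝ => (1 + (s : ℂ)) * kern a b κ 0 1 z s)
      (-(b / z * kern a b κ 1 0 z s - κ * conj z * kern a b κ 2 0 z s) +
      (1 - z) * (b / z * kern a b κ 0 1 z s - κ * conj z * kern a b κ 1 1 z s -
        kern a b κ 0 2 z s) + a * kern a b κ 0 1 z s) s := by
    intro s hs
    have hs0 : (0 : ℝ) < s := hs
    have h0 : (s : ℂ) ≠ 0 := by exact_mod_cast hs0.ne'
    have h1 : (1 : ℂ) + s ≠ 0 := by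
      have : (0 : ℝ) < 1 + s := by positivity
      exact_mod_cast this.ne'
    have hne := ofReal_add_ne_zero hz hs0.le
    have hid : HasDerivAt (fun s : ℝ => 1 + (s : ℂ)) 1 s :=
      (hasDerivAt_id' s).ofReal_comp.const_add 1
    convert! hid.mul (hasDerivAt_kern a b κ hz hs0) using 1
    simp only [kern_succ_left, kern_succ_right]
    field_simp
    ring
  have hI : ∀ p n, 1 ≤ p + n → HasInt (volume.restrict (Ioi 0)) (kern a b κ p n z)
      (kernInt a b κ p n z) := fun p n h => ⟨hi p n h, rfl⟩
  have hint := ((((hI 1 0 (by omega)).const_mul (b / z)).sub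
    ((hI 2 0 (by omega)).const_mul (κ * conj z))).neg.add
    (((((hI 0 1 (by omega)).const_mul (b / z)).sub
    ((hI 1 1 (by omega)).const_mul (κ * conj z))).sub (hI 0 2 (by omega))).const_mul (1 - z))).add
    ((hI 0 1 (by omega)).const_mul (a : ℂ))
  obtain ⟨C₁, hC₁⟩ := eventually_norm_kern_le (a := a) (b := b) hκ.le hz
    (show 1 ≤ 0 + 1 by omega) (Or.inr hκ)
  -- The bound at `p = 1` gains a factor `s` for the kernel with `p = 0`, and gives `O(s^{1-b})` at
  -- the origin; `C₁` is used at infinity only.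
  obtain ⟨C₂, hC₂⟩ := eventually_norm_kern_le (a := a) (b := b) hκ.le hz
    (show 1 ≤ 1 + 1 by omega) (Or.inr hκ)
  have hn : ∀ s : ℝ, 0 < s → ‖(1 : ℂ) + s‖ = 1 + s := fun s hs => by
    rw [← Complex.ofReal_one, ← Complex.ofReal_add, Complex.norm_real, Real.norm_of_nonneg]
    positivity
  have key := integral_Ioi_of_hasDerivAt_of_tendsto_nhdsGT hd hint.1 (m := 0) (l := 0)
    ?_ ?_
  · rw [← hint.2, key, sub_zero]
  · have h1 := (tendsto_one_add_rpow_mul_rpow_nhdsGT (a := a) (c := 1 - b)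
      (by linarith)).const_mul C₂
    rw [mul_zero] at h1
    refine squeeze_zero_norm' (eventually_mem_nhdsWithin.mono fun s hs => ?_) h1
    have hs0 : (0 : ℝ) < s := hs
    have h0 : (s : ℂ) ≠ 0 := by exact_mod_cast hs0.ne'
    have h2 := hC₂.self_of_nhds s hs0
    rw [kern_succ_left _ _ _ 0, norm_mul, norm_inv, Complex.norm_real, Real.norm_of_nonneg hs0.le,
      inv_mul_le_iff₀ hs0] at h2
    rw [norm_mul, hn s hs0]
    calc _ ≤ (1 + s) * (s * (C₂ * ((1 + s) ^ (a - 1) * s ^ (-b)))) := by gcongr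
      _ = C₂ * s * ((1 + s) * ((1 + s) ^ (a - 1) * s ^ (-b))) := by ring
      _ = _ := by
        rw [one_add_rpow_sub_one_mul hs0, sub_eq_add_neg, Real.rpow_add hs0, Real.rpow_one]; ring
  · have h1 := (tendsto_one_add_rpow_mul_rpow_atTop (a := a) (c := -b) (by linarith)).const_mul C₁
    rw [mul_zero] at h1
    refine squeeze_zero_norm' ((eventually_gt_atTop 0).mono fun s hs0 => ?_) h1
    have h2 := hC₁.self_of_nhds s hs0
    rw [norm_mul, hn s hs0]
    calc _ ≤ (1 + s) * (C₁ * ((1 + s) ^ (a - 1) * s ^ (-b))) := by gcongr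
      _ = C₁ * ((1 + s) * ((1 + s) ^ (a - 1) * s ^ (-b))) := by ring
      _ = _ := by rw [one_add_rpow_sub_one_mul hs0]

/-! ### The correction and its reduced equation. -/

/-- `z^b e^{-κ z̄} ∫₀^∞ (1 + s)^a s^{-b} e^{-κ|z|²/s} / (s + z) ds`. -/
noncomputable def corr (a b κ : ℝ) (z : ℂ) : ℂ :=
  z ^ (b : ℂ) * Complex.exp (-(κ * conj z)) * kernInt a b κ 0 1 z

/-- The holomorphic derivative of `corr`. -/
noncomputable def corr₁ (a b κ : ℝ) (z : ℂ) : ℂ :=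
  z ^ (b : ℂ) * Complex.exp (-(κ * conj z)) *
    (b / z * kernInt a b κ 0 1 z - κ * conj z * kernInt a b κ 1 1 z - kernInt a b κ 0 2 z)

/-- The antiholomorphic derivative of `corr`. -/
noncomputable def corr₂ (a b κ : ℝ) (z : ℂ) : ℂ :=
  -κ * (z ^ (b : ℂ) * Complex.exp (-(κ * conj z)) * kernInt a b κ 1 0 z)

theorem prefactor_wirtinger (b κ : ℝ) {z : ℂ} (hz : z ∈ Complex.slitPlane) :
    HasWirtingerAt (fun z => z ^ (b : ℂ) * Complex.exp (-(κ * conj z)))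
      (b / z * (z ^ (b : ℂ) * Complex.exp (-(κ * conj z))))
      (-κ * (z ^ (b : ℂ) * Complex.exp (-(κ * conj z)))) z := by
  have h1 : HasDerivAt (fun w : ℂ => w ^ (b : ℂ)) (b * z ^ ((b : ℂ) - 1)) z := by
    simpa using (hasDerivAt_id' z).cpow_const (c := (b : ℂ)) hz
  have h2 := HasWirtingerAt.comp_deriv (φ := Complex.exp) (Complex.hasDerivAt_exp _)
    ((HasWirtingerAt.conj_id z).const_mul (κ : ℂ)).neg
  refine ((HasWirtingerAt.of_hasDerivAt h1).mul h2).congr_val ?_ ?_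
  · rw [Complex.cpow_sub _ _ (Complex.slitPlane_ne_zero hz), Complex.cpow_one]; ring
  · ring

theorem corr_wirtinger {a b κ : ℝ} (hab : a < b) (hb : b < 1) (hκ : 0 < κ) {z : ℂ}
    (hz : z ∈ Complex.slitPlane) :
    HasWirtingerAt (corr a b κ) (corr₁ a b κ z) (corr₂ a b κ z) z := by
  have e : kernInt a b κ 0 1 z + z * kernInt a b κ 1 1 z = kernInt a b κ 1 0 z := by
    have h1 := integrableOn_kern (a := a) hab hb hκ.le hz (p := 0) (n := 1) le_rfl (Or.inr hκ)
    have h2 := integrableOn_kern (a := a) hab hb hκ.le hz (p := 1) (n := 1) (by omega) (Or.inr hκ)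
    simp only [kernInt]
    rw [← integral_const_mul, ← integral_add h1 (h2.const_mul z)]
    exact setIntegral_congr_fun measurableSet_Ioi fun s hs => kern_zero_one_add a b κ 0 hz hs
  refine ((prefactor_wirtinger b κ hz).mul
    (kernInt_wirtinger hab hb hκ.le hz (p := 0) (n := 1) le_rfl (Or.inr hκ))).congr_val ?_ ?_
  · simp only [corr₁]; push_cast; ring
  · simp only [corr₂, ← e]; ring

/-- This is the equation `∂∂̄G = -κ((1 - z)∂G + aG)`, namely `kernInt_relation` times the prefactor.
The pure derivative `∂̄∂̄G` may stay unspecified, since it cancels in `H_B`. -/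
theorem corr₂_wirtinger {a b κ : ℝ} (hab : a < b) (hb : b < 1) (hκ : 0 < κ) {z : ℂ}
    (hz : z ∈ Complex.slitPlane) :
    ∃ d, HasWirtingerAt (corr₂ a b κ) (-κ * ((1 - z) * corr₁ a b κ z + a * corr a b κ z)) d z := by
  refine ⟨_, (((prefactor_wirtinger b κ hz).mul (kernInt_wirtinger hab hb hκ.le hz
    (p := 1) (n := 0) le_rfl (Or.inr hκ))).const_mul (-κ : ℂ)).congr_val ?_ rfl⟩
  have h := kernInt_relation hab hb hκ hz
  simp only [corr₁, corr]
  push_cast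
  linear_combination (-κ * z ^ (b : ℂ) * Complex.exp (-(κ * conj z))) * (-h)

theorem contDiffOn_corr_aux {b κ : ℝ} (k : ℕ) :
    ContDiffOn ℝ k (fun z : ℂ => z ^ (b : ℂ) * Complex.exp (-(κ * conj z))) Complex.slitPlane := by
  induction k with
  | zero =>
    exact contDiffOn_zero.2 fun z hz => (prefactor_wirtinger b κ hz).continuousAt.continuousWithinAt
  | succ k ih =>
    refine contDiffOn_succ_of_wirtinger Complex.isOpen_slitPlane
      (fun z hz => prefactor_wirtinger b κ hz) ?_ (contDiffOn_const.mul ih)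
    exact (contDiffOn_const.mul (contDiffOn_id.inv fun z hz => Complex.slitPlane_ne_zero hz)).mul ih

theorem contDiffOn_corr {a b κ : ℝ} (hab : a < b) (hb : b < 1) (hκ : 0 < κ) (k : ℕ) :
    ContDiffOn ℝ k (corr a b κ) Complex.slitPlane :=
  (contDiffOn_corr_aux k).mul (contDiffOn_kernInt hab hb hκ k 0 1 le_rfl)

theorem differentiableOn_corr₁ {a b κ : ℝ} (hab : a < b) (hb : b < 1) (hκ : 0 < κ) :
    DifferentiableOn ℝ (corr₁ a b κ) Complex.slitPlane := by
  have hinv : ContDiffOn ℝ 1 (fun z : ℂ => z⁻¹) Complex.slitPlane :=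
    contDiffOn_id.inv fun z hz => Complex.slitPlane_ne_zero hz
  have hconj : ContDiffOn ℝ 1 (fun z : ℂ => conj z) Complex.slitPlane :=
    (Complex.conjCLE : ℂ →L[ℝ] ℂ).contDiff.contDiffOn
  have h := fun p n hpn => contDiffOn_kernInt (a := a) hab hb hκ 1 p n hpn
  have h1 : ContDiffOn ℝ 1 (corr₁ a b κ) Complex.slitPlane :=
    (contDiffOn_corr_aux 1).mul ((((contDiffOn_const.mul hinv).mul (h 0 1 (by omega))).sub
      ((contDiffOn_const.mul hconj).mul (h 1 1 (by omega)))).sub (h 0 2 (by omega)))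
  exact h1.differentiableOn (by simp)

/-! ### Power series and the Euler operator. -/

section PowerSeries

theorem powerSeries_hasSum {A : ℕ → ℂ} {r : ℝ} (hr : Summable fun n => ‖A n‖ * r ^ n) {z : ℂ}
    (hz : ‖z‖ < r) : HasSum (fun n => A n * z ^ n) (∑' n, A n * z ^ n) := by
  refine (Summable.of_norm_bounded hr fun n => ?_).hasSum
  rw [norm_mul, norm_pow]
  gcongr

theorem powerSeries_differentiableOn {A : ℕ → ℂ} {r : ℝ} (hr : Summable fun n => ‖A n‖ * r ^ n) :
    DifferentiableOn ℂ (fun z => ∑' n, A n * z ^ n) (Metric.ball 0 r) := by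
  refine Complex.differentiableOn_tsum_of_summable_norm hr (fun n => by fun_prop)
    Metric.isOpen_ball fun n w hw => ?_
  rw [mem_ball_zero_iff] at hw
  rw [norm_mul, norm_pow]
  gcongr

theorem powerSeries_hasSum_deriv {A : ℕ → ℂ} {r : ℝ} (hr : Summable fun n => ‖A n‖ * r ^ n) {z : ℂ}
    (hz : ‖z‖ < r) :
    HasSum (fun n : ℕ => n * A n * z ^ n) (z * deriv (fun z => ∑' n, A n * z ^ n) z) := by
  have h := Complex.hasSum_deriv_of_summable_norm (F := fun n (z : ℂ) => A n * z ^ n) hr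
    (fun n => by fun_prop) (Metric.isOpen_ball (x := (0 : ℂ)) (ε := r)) (fun n w hw => ?_)
    (mem_ball_zero_iff.2 hz)
  · refine (h.mul_left z).congr_fun fun n => ?_
    rw [deriv_const_mul_field, deriv_pow_field]
    rcases n with _ | n
    · simp
    · rw [Nat.add_sub_cancel, pow_succ]; push_cast; ring
  · rw [mem_ball_zero_iff] at hw
    rw [norm_mul, norm_pow]
    gcongr

end PowerSeries

/-! ### The function `₂F₁(1, u; v; z)`. -/

section Gauss

/-- The coefficients `(u)ₙ / (v)ₙ`. -/
noncomputable def pochQuot (u v : ℝ) (n : ℕ) : ℂ :=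
  (ascPochhammer ℂ n).eval (u : ℂ) * ((ascPochhammer ℂ n).eval (v : ℂ))⁻¹

theorem pochQuot_zero (u v : ℝ) : pochQuot u v 0 = 1 := by simp [pochQuot]

theorem pochQuot_succ {u v : ℝ} (hv : 0 < v) (n : ℕ) :
    (v + n) * pochQuot u v (n + 1) = (u + n) * pochQuot u v n := by
  have h : (v : ℂ) + n ≠ 0 := by
    have : 0 < v + n := by positivity
    exact_mod_cast this.ne'
  simp only [pochQuot, ascPochhammer_succ_eval, mul_inv]
  field_simp

/-- The successive ratios `(u + n)/(v + n)` lie in `(0, 1]`. -/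
theorem norm_pochQuot_le {u v : ℝ} (hu : 0 < u) (huv : u ≤ v) (n : ℕ) : ‖pochQuot u v n‖ ≤ 1 := by
  induction n with
  | zero => simp [pochQuot_zero]
  | succ n ih =>
    have hv := hu.trans_le huv
    have h := congrArg norm (pochQuot_succ (u := u) hv n)
    rw [norm_mul, norm_mul] at h
    have e1 : ‖(v : ℂ) + n‖ = v + n := by
      rw [← Complex.ofReal_natCast, ← Complex.ofReal_add, Complex.norm_real,
        Real.norm_of_nonneg (by positivity)]
    have e2 : ‖(u : ℂ) + n‖ = u + n := by
      rw [← Complex.ofReal_natCast, ← Complex.ofReal_add, Complex.norm_real,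
        Real.norm_of_nonneg (by positivity)]
    rw [e1, e2] at h
    have h0 : 0 < v + n := by positivity
    have : (v + n) * ‖pochQuot u v (n + 1)‖ ≤ (v + n) * 1 := by
      rw [h]
      exact mul_le_mul (by linarith) ih (norm_nonneg _) h0.le
    exact le_of_mul_le_mul_left this h0

theorem hypergeometric_one_eq_tsum (u v : ℝ) (z : ℂ) :
    ordinaryHypergeometric (1 : ℂ) (u : ℂ) (v : ℂ) z = ∑' n, pochQuot u v n * z ^ n := by
  rw [ordinaryHypergeometric_eq_tsum]
  refine tsum_congr fun n => ?_
  rw [pochQuot, smul_eq_mul, ascPochhammer_eval_one]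
  have : ((n.factorial : ℕ) : ℂ) ≠ 0 := by exact_mod_cast n.factorial_ne_zero
  field_simp

theorem summable_pochQuot {u v : ℝ} (hu : 0 < u) (huv : u ≤ v) {r : ℝ} (h0 : 0 ≤ r) (h1 : r < 1) :
    Summable fun n => ‖pochQuot u v n‖ * r ^ n := by
  refine Summable.of_nonneg_of_le (fun n => by positivity) (fun n => ?_)
    (summable_geometric_of_lt_one h0 h1)
  exact mul_le_of_le_one_left (by positivity) (norm_pochQuot_le hu huv n)

/-- The first order equation of `₂F₁(1, u; v; z)`. -/
theorem hypergeometric_one_ode {u v : ℝ} (hu : 0 < u) (huv : u ≤ v) {z : ℂ} (hz : ‖z‖ < 1) :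
    ∃ d, HasDerivAt (ordinaryHypergeometric (1 : ℂ) (u : ℂ) (v : ℂ)) d z ∧
      z * (1 - z) * d + ((v - 1) - u * z) *
        ordinaryHypergeometric (1 : ℂ) (u : ℂ) (v : ℂ) z = v - 1 := by
  obtain ⟨r, hzr, hr1⟩ := exists_between hz
  have hs := summable_pochQuot hu huv ((norm_nonneg _).trans hzr.le) hr1
  have e : (ordinaryHypergeometric (1 : ℂ) (u : ℂ) (v : ℂ)) = fun z => ∑' n, pochQuot u v n * z ^ n :=
    funext (hypergeometric_one_eq_tsum u v)
  rw [e]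
  have hd := (powerSeries_differentiableOn hs).differentiableAt
    (Metric.isOpen_ball.mem_nhds (mem_ball_zero_iff.2 hzr))
  refine ⟨_, hd.hasDerivAt, ?_⟩
  have h1 := powerSeries_hasSum hs hzr
  have h2 := powerSeries_hasSum_deriv hs hzr
  -- With `θ = z d/dz`, the recursion of the coefficients says that `(θ + v - 1)F` without its
  -- constant term `v - 1` equals `z(θ + u)F`.
  have h3 := h2.add (h1.mul_left ((v : ℂ) - 1))
  have h4 := (h2.add (h1.mul_left (u : ℂ))).mul_left z
  have h5 := (hasSum_nat_add_iff' 1).2 h3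
  have h6 := h5.unique (h4.congr_fun fun n => ?_)
  · simp only [Finset.sum_range_one, pochQuot_zero] at h6
    simp only at h6 ⊢
    linear_combination h6
  · have := pochQuot_succ (u := u) (hu.trans_le huv) n
    push_cast
    rw [pow_succ]
    linear_combination (z ^ n * z) * this

end Gauss

/-! ### The Stieltjes transform, the case `κ = 0`. -/

section Stieltjes

/-- `∫₀^∞ (1 + s)^(a - 1) s^{-b} ds`. -/
noncomputable def betaConst (a b : ℝ) : ℝ := ∫ s in Ioi (0 : ℝ), (1 + s) ^ (a - 1) * s ^ (-b)

theorem betaConst_eq {a b : ℝ} (hab : a < b) (hb : b < 1) :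
    betaConst a b = Real.Gamma (1 - b) * Real.Gamma (b - a) / Real.Gamma (1 - a) := by
  have h := integral_beta_Ioi (u := 1 - b) (v := b - a) (by linarith) (by linarith)
  rw [show 1 - b + (b - a) = 1 - a by ring] at h
  rw [← h, betaConst]
  refine setIntegral_congr_fun measurableSet_Ioi fun s _ => ?_
  rw [mul_comm]
  congr 2 <;> ring

theorem kern_zero_zero (a b : ℝ) (n : ℕ) (z : ℂ) (s : ℝ) :
    kern a b 0 0 n z s = (((1 + s) ^ a * s ^ (-b) : ℝ) : ℂ) * ((s : ℂ) + z)⁻¹ ^ n := by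
  simp [kern]

theorem stieltjes_hasDerivAt {a b : ℝ} (hab : a < b) (hb : b < 1) {z : ℂ}
    (hz : z ∈ Complex.slitPlane) :
    HasDerivAt (kernInt a b 0 0 1) (-kernInt a b 0 0 2 z) z :=
  ((kernInt_wirtinger hab hb le_rfl hz (p := 0) (n := 1) le_rfl (Or.inl rfl)).congr_val
    (by simp) (by simp)).hasDerivAt

/-- The first order equation of `∫₀^∞ (1 + s)^a s^{-b} / (s + z) ds`. -/
theorem stieltjes_ode {a b : ℝ} (hab : a < b) (hb : b < 1) {z : ℂ}
    (hz : z ∈ Complex.slitPlane) :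
    z * (1 - z) * (-kernInt a b 0 0 2 z) + (b - (b - a) * z) * kernInt a b 0 0 1 z =
      a * betaConst a b := by
  have hI : ∀ n, 1 ≤ n → HasInt (volume.restrict (Ioi 0)) (kern a b 0 0 n z)
      (kernInt a b 0 0 n z) := fun n h =>
    ⟨integrableOn_kern hab hb le_rfl hz (by omega) (Or.inl rfl), rfl⟩
  have hK : HasInt (volume.restrict (Ioi 0))
      (fun s : ℝ => (((1 + s) ^ (a - 1) * s ^ (-b) : ℝ) : ℂ)) (betaConst a b) :=
    ⟨(integrableOn_rpow_mul_one_add_rpow (by linarith) (by linarith)).ofReal,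
      integral_complex_ofReal⟩
  have hint := (((hI 2 (by omega)).const_mul (z * (1 - z))).sub
    ((hI 1 (by omega)).const_mul (b - (b - a) * z))).add (hK.const_mul a)
  -- The equation is the integral of the derivative of `(1 - z) s (1 + s)^a s^{-b} / (s + z)`, which
  -- vanishes at both ends because `a < b < 1`.
  have hd : ∀ s ∈ Ioi (0 : ℝ), HasDerivAt (fun s : ℝ => (1 - z) * ((s : ℂ) * kern a b 0 0 1 z s))
      (z * (1 - z) * kern a b 0 0 2 z s - (b - (b - a) * z) * kern a b 0 0 1 z s +
        a * (((1 + s) ^ (a - 1) * s ^ (-b) : ℝ) : ℂ)) s := by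
    intro s hs
    have hs0 : (0 : ℝ) < s := hs
    have h0 : (s : ℂ) ≠ 0 := by exact_mod_cast hs0.ne'
    have hs1 : (0 : ℝ) < 1 + s := by positivity
    have h1 : (1 : ℂ) + s ≠ 0 := by exact_mod_cast hs1.ne'
    have hne := ofReal_add_ne_zero hz hs0.le
    have hid : HasDerivAt (fun s : ℝ => (s : ℂ)) 1 s := (hasDerivAt_id' s).ofReal_comp
    convert! (hid.mul (hasDerivAt_kern a b 0 hz hs0)).const_mul (1 - z) using 1
    simp only [kern_zero_zero, Real.rpow_sub_one hs1.ne']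
    push_cast
    field_simp
    ring
  obtain ⟨C, hC⟩ := eventually_norm_kern_le (a := a) (b := b) le_rfl hz
    (show 1 ≤ 0 + 1 by omega) (Or.inl rfl)
  have hle : ∀ s : ℝ, 0 < s → ‖(1 - z) * ((s : ℂ) * kern a b 0 0 1 z s)‖ ≤
      ‖1 - z‖ * C * ((1 + s) ^ (a - 1) * s ^ (1 - b)) := by
    intro s hs
    rw [norm_mul, norm_mul, Complex.norm_real, Real.norm_of_nonneg hs.le]
    calc _ ≤ ‖1 - z‖ * (s * (C * ((1 + s) ^ (a - 1) * s ^ (-b)))) := by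
          gcongr
          exact hC.self_of_nhds s hs
      _ = _ := by
        rw [show (1 - b) = 1 + -b by ring, Real.rpow_add hs, Real.rpow_one]; ring
  have key := integral_Ioi_of_hasDerivAt_of_tendsto_nhdsGT hd hint.1 (m := 0) (l := 0) ?_ ?_
  · have h2 := hint.2
    rw [key, sub_zero] at h2
    linear_combination h2
  · have h1 := (tendsto_one_add_rpow_mul_rpow_nhdsGT (a := a - 1) (c := 1 - b)
      (by linarith)).const_mul (‖1 - z‖ * C)
    rw [mul_zero] at h1
    exact squeeze_zero_norm' (eventually_mem_nhdsWithin.mono fun s hs => hle s hs) h1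
  · have h1 := (tendsto_one_add_rpow_mul_rpow_atTop (a := a - 1) (c := 1 - b)
      (by linarith)).const_mul (‖1 - z‖ * C)
    rw [mul_zero] at h1
    exact squeeze_zero_norm' ((eventually_gt_atTop 0).mono fun s hs => hle s hs) h1

/-- `z^b ∫₀^∞ s^{-b} / (s + z) ds = π / sin (π b)`. -/
theorem stieltjes_zero {b : ℝ} (hb0 : 0 < b) (hb : b < 1) {z : ℂ} (hz : z ∈ Complex.slitPlane) :
    z ^ (b : ℂ) * kernInt 0 b 0 0 1 z = ((Real.pi / Real.sin (Real.pi * b) : ℝ) : ℂ) := by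
  -- The product is shown to be locally constant; on the connected slit plane it then equals its
  -- value at `1`, a Beta integral.
  have hd : ∀ w ∈ Complex.slitPlane, HasDerivAt (fun w : ℂ => w ^ (b : ℂ) * kernInt 0 b 0 0 1 w)
      0 w := by
    intro w hw
    have hw0 := Complex.slitPlane_ne_zero hw
    have h1 : HasDerivAt (fun w : ℂ => w ^ (b : ℂ)) (b * w ^ ((b : ℂ) - 1)) w := by
      simpa using (hasDerivAt_id' w).cpow_const (c := (b : ℂ)) hw
    rw [Complex.cpow_sub _ _ hw0, Complex.cpow_one] at h1
    have h2 := stieltjes_ode hb0 hb hw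
    convert! h1.mul (stieltjes_hasDerivAt hb0 hb hw) using 1
    -- For `a = 0` the first order equation carries the factor `1 - w`. At `w = 1` it says nothing,
    -- and the identity is recovered by continuity.
    by_cases h : w = 1
    · subst h
      have hb1 : ∀ w : ℂ, w ∈ Complex.slitPlane → w ≠ 1 →
          b * kernInt 0 b 0 0 1 w - w * kernInt 0 b 0 0 2 w = 0 := by
        intro w hw hw1
        have h3 := stieltjes_ode hb0 hb hw
        have h4 : (1 - w) * (b * kernInt 0 b 0 0 1 w - w * kernInt 0 b 0 0 2 w) = 0 := by
          push_cast at h3; linear_combination h3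
        exact (mul_eq_zero.1 h4).resolve_left (sub_ne_zero.2 (Ne.symm hw1))
      have hc1 := (kernInt_wirtinger hb0 hb le_rfl hw (p := 0) (n := 1) le_rfl
        (Or.inl rfl)).continuousAt
      have hc2 := (kernInt_wirtinger hb0 hb le_rfl hw (p := 0) (n := 2) (by omega)
        (Or.inl rfl)).continuousAt
      have hc : ContinuousAt (fun w : ℂ => b * kernInt 0 b 0 0 1 w - w * kernInt 0 b 0 0 2 w) 1 :=
        (continuousAt_const.mul hc1).sub (continuousAt_id.mul hc2)
      have hlim : Tendsto (fun w : ℂ => b * kernInt 0 b 0 0 1 w - w * kernInt 0 b 0 0 2 w)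
          (𝓝[≠] 1) (𝓝 0) := by
        refine tendsto_const_nhds.congr' ?_
        filter_upwards [nhdsWithin_le_nhds (Complex.isOpen_slitPlane.mem_nhds hw),
          self_mem_nhdsWithin] with w h1 h2 using (hb1 w h1 h2).symm
      have h5 := tendsto_nhds_unique (hc.tendsto.mono_left nhdsWithin_le_nhds) hlim
      simp only [Complex.one_cpow]
      linear_combination -h5
    · have h4 : (1 - w) * (b * kernInt 0 b 0 0 1 w - w * kernInt 0 b 0 0 2 w) = 0 := by
        push_cast at h2; linear_combination h2
      have h5 := (mul_eq_zero.1 h4).resolve_left (sub_ne_zero.2 (Ne.symm h))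
      field_simp
      linear_combination -(w ^ (b : ℂ)) * h5
  have hpre : IsPreconnected Complex.slitPlane :=
    (Complex.starConvex_one_slitPlane.isPathConnected
      Complex.one_mem_slitPlane).isConnected.isPreconnected
  have h := Complex.isOpen_slitPlane.is_const_of_deriv_eq_zero hpre
    (fun w hw => (hd w hw).differentiableAt.differentiableWithinAt)
    (fun w hw => (hd w hw).deriv) hz Complex.one_mem_slitPlane
  rw [h, Complex.one_cpow, one_mul, ← integral_rpow_neg_div_one_add hb0 hb,
    ← integral_complex_ofReal, kernInt]
  refine setIntegral_congr_fun measurableSet_Ioi fun s _ => ?_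
  rw [kern_zero_zero]
  push_cast
  simp [div_eq_mul_inv, add_comm]

end Stieltjes

/-! ### Integration of the first order equation. -/

theorem ofReal_mul_mem_slitPlane {z : ℂ} (hz : z ∈ Complex.slitPlane) {t : ℝ} (ht : 0 < t) :
    (t : ℂ) * z ∈ Complex.slitPlane := by
  rw [Complex.mem_slitPlane_iff] at hz ⊢
  rcases hz with h | h
  · left; simpa using mul_pos ht h
  · right; simpa using ⟨ht.ne', h⟩

theorem one_sub_mul_mem_slitPlane {z : ℂ} (hz : 1 - z ∈ Complex.slitPlane) {t : ℝ} (ht : 0 ≤ t)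
    (ht1 : t ≤ 1) : 1 - (t : ℂ) * z ∈ Complex.slitPlane := by
  have h := Complex.starConvex_one_slitPlane hz (sub_nonneg.2 ht1) ht (sub_add_cancel 1 t)
  convert h using 1
  simp only [Complex.real_smul]
  push_cast
  ring

/-- `∫₀¹ t^(b - 1) (1 - t z)^(-a - 1) dt`. -/
noncomputable def incBeta (a b : ℝ) (z : ℂ) : ℂ :=
  ∫ t in (0 : ℝ)..1, ((t ^ (b - 1) : ℝ) : ℂ) * (1 - (t : ℂ) * z) ^ (-(a : ℂ) - 1)

/-- A solution of `z(1 - z) f' + (b - (b - a) z) f = c` is determined by `c` and its behaviour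
at `0`. -/
theorem first_order_ode_solution {a b : ℝ} (hb : 0 < b) {z : ℂ}
    (hz1 : 1 - z ∈ Complex.slitPlane) {f : ℂ → ℂ} {c l : ℂ}
    (hf : ∀ t : ℝ, 0 < t → t ≤ 1 → ∃ d, HasDerivAt f d (t * z) ∧
      (t * z) * (1 - t * z) * d + (b - (b - a) * (t * z)) * f (t * z) = c)
    (hl : Tendsto (fun t : ℝ => ((t ^ b : ℝ) : ℂ) * f (t * z)) (𝓝[>] 0) (𝓝 l)) :
    (1 - z) ^ (-(a : ℂ)) * f z = l + c * incBeta a b z := by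
  set g : ℝ → ℂ := fun t => ((t ^ b : ℝ) : ℂ) * f (t * z) with hg
  have hmem : ∀ t : ℝ, 0 ≤ t → t ≤ 1 → 1 - (t : ℂ) * z ∈ Complex.slitPlane := fun t h0 h1 =>
    one_sub_mul_mem_slitPlane hz1 h0 h1
  have hid : ∀ t : ℝ, HasDerivAt (fun t : ℝ => (t : ℂ) * z) z t := fun t => by
    simpa using ((hasDerivAt_id' t).ofReal_comp.mul_const z)
  have hpow : ∀ t : ℝ, 0 ≤ t → t ≤ 1 →
      HasDerivAt (fun t : ℝ => (1 - (t : ℂ) * z) ^ (-(a : ℂ)))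
        (a * z * (1 - (t : ℂ) * z) ^ (-(a : ℂ) - 1)) t := by
    intro t h0 h1
    have h := HasDerivAt.comp (h₂ := fun w : ℂ => w ^ (-(a : ℂ))) t
      ((hasDerivAt_id' (1 - (t : ℂ) * z)).cpow_const (c := -(a : ℂ)) (hmem t h0 h1))
      ((hid t).const_sub 1)
    convert! h using 1
    ring
  -- Along the segment from `0` to `z` the integrating factor is `t^b (1 - tz)^{-a}`, and the
  -- equation becomes an explicit derivative with right side proportional to `c`.
  have hderiv : ∀ t ∈ Ioc (0 : ℝ) 1, HasDerivAt (fun t : ℝ => (1 - (t : ℂ) * z) ^ (-(a : ℂ)) * g t)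
      (c * (((t ^ (b - 1) : ℝ) : ℂ) * (1 - (t : ℂ) * z) ^ (-(a : ℂ) - 1))) t := by
    intro t ht
    obtain ⟨d, hd, hode⟩ := hf t ht.1 ht.2
    have h1 := ((hasDerivAt_id' t).rpow_const (p := b) (Or.inl ht.1.ne')).ofReal_comp
    have h2 := HasDerivAt.comp (h₂ := f) t hd (hid t)
    have h3 := (hpow t ht.1.le ht.2).mul (h1.mul h2)
    convert! h3 using 1
    have hne := Complex.slitPlane_ne_zero (hmem t ht.1.le ht.2)
    have ht0 : (t : ℂ) ≠ 0 := by exact_mod_cast ht.1.ne'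
    rw [← hode, Complex.cpow_sub _ _ hne, Complex.cpow_one, Real.rpow_sub_one ht.1.ne']
    simp only [Function.comp, Pi.mul_apply]
    push_cast
    field_simp
    ring
  have hint : IntervalIntegrable (fun t : ℝ => c * (((t ^ (b - 1) : ℝ) : ℂ) *
      (1 - (t : ℂ) * z) ^ (-(a : ℂ) - 1))) volume 0 1 := by
    refine IntervalIntegrable.const_mul (IntervalIntegrable.mul_continuousOn ?_ ?_) c
    · have h := intervalIntegral.intervalIntegrable_rpow' (a := 0) (b := 1) (r := b - 1)
        (by linarith)
      exact ⟨h.1.ofReal, h.2.ofReal⟩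
    · rw [uIcc_of_le zero_le_one]
      refine ContinuousOn.cpow_const (by fun_prop) fun t ht => hmem t ht.1 ht.2
  have h0 : Tendsto (fun t : ℝ => (1 - (t : ℂ) * z) ^ (-(a : ℂ)) * g t) (𝓝[>] 0) (𝓝 (1 * l)) := by
    refine Tendsto.mul ?_ hl
    have h := (hpow 0 le_rfl zero_le_one).continuousAt.tendsto
    simp only [Complex.ofReal_zero, zero_mul, sub_zero, Complex.one_cpow] at h
    exact h.mono_left nhdsWithin_le_nhds
  have h1 : Tendsto (fun t : ℝ => (1 - (t : ℂ) * z) ^ (-(a : ℂ)) * g t) (𝓝[<] 1)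
      (𝓝 ((1 - z) ^ (-(a : ℂ)) * f z)) := by
    have h := (hderiv 1 ⟨one_pos, le_rfl⟩).continuousAt.tendsto
    simp only [hg, Complex.ofReal_one, one_mul, Real.one_rpow] at h
    exact h.mono_left nhdsWithin_le_nhds
  have key := intervalIntegral.integral_eq_sub_of_hasDerivAt_of_tendsto zero_lt_one
    (fun t ht => hderiv t ⟨ht.1, ht.2.le⟩) hint h0 h1
  rw [intervalIntegral.integral_const_mul] at key
  rw [incBeta, key]
  ring

theorem one_sub_cpow_mul {a : ℂ} {z : ℂ} (hz1 : 1 - z ≠ 0) :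
    (1 - z) ^ a * (1 - z) ^ (-a) = 1 := by
  rw [← Complex.cpow_add _ _ hz1, add_neg_cancel, Complex.cpow_zero]

/-- After `s ↦ ts` the left side is `∫ (1 + ts)^a s^{-b} / (s + z) ds`. As `t → 0` the factor `(1 +
ts)^a` tends to `1`, with domination by its value at `t = 1`; so the singular part at `0` is that of
the case `a = 0`. -/
theorem tendsto_rpow_mul_stieltjes {a b : ℝ} (ha : 0 ≤ a) (hab : a < b) (hb : b < 1) {z : ℂ}
    (hz : z ∈ Complex.slitPlane) :
    Tendsto (fun t : ℝ => ((t ^ b : ℝ) : ℂ) * kernInt a b 0 0 1 (t * z)) (𝓝[>] 0)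
      (𝓝 (kernInt 0 b 0 0 1 z)) := by
  have e : ∀ t : ℝ, 0 < t → ((t ^ b : ℝ) : ℂ) * kernInt a b 0 0 1 (t * z) =
      ∫ s in Ioi (0 : ℝ), (((1 + t * s) ^ a * s ^ (-b) : ℝ) : ℂ) * ((s : ℂ) + z)⁻¹ := by
    intro t ht
    have h := integral_comp_mul_left_Ioi (fun s => kern a b 0 0 1 (t * z) s) 0 ht
    rw [mul_zero] at h
    have ht0 : (t : ℂ) ≠ 0 := by exact_mod_cast ht.ne'
    have h2 : kernInt a b 0 0 1 (t * z) = t * ∫ s in Ioi (0 : ℝ), kern a b 0 0 1 (t * z) (t * s) := by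
      rw [h, Complex.real_smul, kernInt]
      push_cast
      field_simp
    rw [h2, ← mul_assoc, ← integral_const_mul]
    refine setIntegral_congr_fun measurableSet_Ioi fun s hs => ?_
    have hs0 : (0 : ℝ) < s := hs
    have hne := ofReal_add_ne_zero hz hs0.le
    rw [kern_zero_zero, Real.mul_rpow ht.le hs0.le, Real.rpow_neg ht.le]
    have hb0 : ((t ^ b : ℝ) : ℂ) ≠ 0 := by exact_mod_cast (Real.rpow_pos_of_pos ht b).ne'
    push_cast
    rw [← mul_add, pow_one, mul_inv]
    field_simp
  have h0 := integrableOn_kern (a := a) hab hb le_rfl hz (p := 0) (n := 1) le_rfl (Or.inl rfl)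
  have main : Tendsto (fun t : ℝ => ∫ s in Ioi (0 : ℝ),
      (((1 + t * s) ^ a * s ^ (-b) : ℝ) : ℂ) * ((s : ℂ) + z)⁻¹) (𝓝[>] 0)
      (𝓝 (kernInt 0 b 0 0 1 z)) := by
    refine tendsto_integral_filter_of_dominated_convergence (fun s => ‖kern a b 0 0 1 z s‖)
      (.of_forall fun t => (by fun_prop : Measurable _).aestronglyMeasurable) ?_ h0.norm ?_
    · filter_upwards [Ioo_mem_nhdsGT (show (0 : ℝ) < 1 by norm_num)] with t ht
      refine (ae_restrict_iff' measurableSet_Ioi).2 (.of_forall fun s hs => ?_)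
      have hs0 : (0 : ℝ) < s := hs
      have ht0 := ht.1
      rw [kern_zero_zero, norm_mul, norm_mul, pow_one, Complex.norm_real, Complex.norm_real,
        Real.norm_of_nonneg (mul_nonneg (Real.rpow_nonneg (by positivity) _)
          (Real.rpow_nonneg hs0.le _)),
        Real.norm_of_nonneg (mul_nonneg (Real.rpow_nonneg (by positivity) _)
          (Real.rpow_nonneg hs0.le _))]
      have h1 : t * s ≤ 1 * s := by gcongr; exact ht.2.le
      gcongr
      linarith
    · refine (ae_restrict_iff' measurableSet_Ioi).2 (.of_forall fun s hs => ?_)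
      have hc : ContinuousAt (fun t : ℝ => (((1 + t * s) ^ a * s ^ (-b) : ℝ) : ℂ) *
          ((s : ℂ) + z)⁻¹) 0 := by
        refine ContinuousAt.mul (Complex.continuous_ofReal.continuousAt.comp
          (ContinuousAt.mul ?_ continuousAt_const)) continuousAt_const
        exact ContinuousAt.rpow_const (by fun_prop) (Or.inr ha)
      have h := hc.tendsto.mono_left (nhdsWithin_le_nhds (s := Ioi 0))
      convert h using 2
      rw [kern_zero_zero]
      simp
  exact main.congr' (eventually_mem_nhdsWithin.mono fun t ht => (e t ht).symm)

/-- The solution of the equation is its singular part plus the inhomogeneity. The singular part,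
multiplied by `z^b`, is the constant `π / sin(πb)`: this is the source of the isolated term `(1 -
z)^a`. -/
theorem stieltjes_eq {a b : ℝ} (ha : 0 ≤ a) (hab : a < b) (hb : b < 1) {z : ℂ}
    (hz : z ∈ Complex.slitPlane) (hz1 : 1 - z ∈ Complex.slitPlane) :
    z ^ (b : ℂ) * kernInt a b 0 0 1 z =
      (1 - z) ^ (a : ℂ) * (((Real.pi / Real.sin (Real.pi * b) : ℝ) : ℂ) +
        a * betaConst a b * z ^ (b : ℂ) * incBeta a b z) := by
  have h := first_order_ode_solution (a := a) (f := kernInt a b 0 0 1) (c := a * betaConst a b)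
    (ha.trans_lt hab) hz1
    (fun t h0 _ => ⟨_, stieltjes_hasDerivAt hab hb (ofReal_mul_mem_slitPlane hz h0),
      stieltjes_ode hab hb (ofReal_mul_mem_slitPlane hz h0)⟩)
    (tendsto_rpow_mul_stieltjes ha hab hb hz)
  rw [← stieltjes_zero (ha.trans_lt hab) hb hz]
  have h1 := one_sub_cpow_mul (a := (a : ℂ)) (Complex.slitPlane_ne_zero hz1)
  linear_combination z ^ (b : ℂ) * (1 - z) ^ (a : ℂ) * h - (z ^ (b : ℂ) * kernInt a b 0 0 1 z) * h1

/-- The hypergeometric function obeys the same first order equation with right side `b`, and being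
regular at `0` it has no singular part there. -/
theorem incBeta_eq_hypergeometric {a b : ℝ} (ha : 0 ≤ a) (hab : a < b) {z : ℂ} (hz : ‖z‖ < 1) :
    b * ((1 - z) ^ (a : ℂ) * incBeta a b z) =
      ordinaryHypergeometric (1 : ℂ) ((b : ℂ) - a) ((b : ℂ) + 1) z := by
  have hz1 : 1 - z ∈ Complex.slitPlane := by
    left
    have := (Complex.re_le_norm z).trans_lt hz
    simpa using this
  have hode : ∀ w : ℂ, ‖w‖ < 1 → _ := fun w hw =>
    hypergeometric_one_ode (u := b - a) (v := b + 1) (by linarith) (by linarith) hw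
  push_cast at hode
  have hb0 := ha.trans_lt hab
  have h := first_order_ode_solution (a := a) (b := b)
    (f := ordinaryHypergeometric (1 : ℂ) ((b : ℂ) - a) ((b : ℂ) + 1)) (c := b) (l := 0) hb0 hz1 ?_ ?_
  · have h1 := one_sub_cpow_mul (a := (a : ℂ)) (Complex.slitPlane_ne_zero hz1)
    linear_combination -(1 - z) ^ (a : ℂ) * h +
      (ordinaryHypergeometric (1 : ℂ) ((b : ℂ) - a) ((b : ℂ) + 1) z) * h1
  · intro t h0 h1
    obtain ⟨d, hd, h2⟩ := hode (t * z) (by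
      rw [norm_mul, Complex.norm_real, Real.norm_of_nonneg h0.le]
      exact (mul_le_of_le_one_left (norm_nonneg _) h1).trans_lt hz)
    refine ⟨d, hd, ?_⟩
    linear_combination h2
  · obtain ⟨d, hd, -⟩ := hode 0 (by simp)
    have hc : ContinuousAt (fun t : ℝ => ((t ^ b : ℝ) : ℂ) *
        ordinaryHypergeometric (1 : ℂ) ((b : ℂ) - a) ((b : ℂ) + 1) (t * z)) 0 := by
      refine ContinuousAt.mul (Complex.continuous_ofReal.continuousAt.comp
        (Real.continuousAt_rpow_const _ _ (Or.inr hb0.le))) ?_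
      refine ContinuousAt.comp (f := fun t : ℝ => (t : ℂ) * z) ?_ (by fun_prop)
      rw [Complex.ofReal_zero, zero_mul]
      exact hd.continuousAt
    have h := hc.tendsto.mono_left (nhdsWithin_le_nhds (s := Ioi 0))
    simpa [Real.zero_rpow hb0.ne'] using h

/-! ### Kummer's function and a uniqueness principle for its equation. -/

section Kummer

/-- The coefficients of Kummer's series. -/
noncomputable def kummerCoeff (a c : ℂ) (n : ℕ) : ℂ :=
  Complex.Gamma c * Complex.regularizedHGFunCoeff {a} {c} n

theorem hyp1F1_eq_tsum (a c z : ℂ) : hyp1F1 a c z = ∑' n, kummerCoeff a c n * z ^ n := by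
  rw [hyp1F1, Complex.regularizedHGFun, FormalMultilinearSeries.sum, ← tsum_mul_left]
  refine tsum_congr fun n => ?_
  rw [Complex.regularizedHGFunSeries, FormalMultilinearSeries.ofScalars_apply_eq, kummerCoeff,
    smul_eq_mul, mul_assoc]

theorem summable_kummerCoeff (a c : ℂ) {r : ℝ} (hr : 0 ≤ r) :
    Summable fun n => ‖kummerCoeff a c n‖ * r ^ n := by
  lift r to NNReal using hr
  have h := (Complex.regularizedHGFunSeries {a} {c}).summable_norm_mul_pow (r := r) (by
    rw [Complex.radius_regularizedHGFunSeries_eq_top (by simp)]; exact ENNReal.coe_lt_top)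
  refine (h.mul_left ‖Complex.Gamma c‖).congr fun n => ?_
  rw [Complex.regularizedHGFunSeries, FormalMultilinearSeries.ofScalars_norm, kummerCoeff, norm_mul,
    mul_assoc]

variable {c : ℝ}

theorem kummerCoeff_zero (a : ℂ) (hc : 0 < c) : kummerCoeff a c 0 = 1 := by
  have : Complex.Gamma c ≠ 0 := Complex.Gamma_ne_zero_of_re_pos (by simpa using hc)
  simp [kummerCoeff, Complex.regularizedHGFunCoeff, this]

theorem kummerCoeff_succ (a : ℂ) (hc : 0 < c) (n : ℕ) :
    (n + 1) * (c + n) * kummerCoeff a c (n + 1) = (a + n) * kummerCoeff a c n := by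
  have h1 : (c : ℂ) + n ≠ 0 := by
    have : 0 < c + n := by positivity
    exact_mod_cast this.ne'
  have h2 : (n : ℂ) + 1 ≠ 0 := by exact_mod_cast n.succ_ne_zero
  rw [kummerCoeff, kummerCoeff, Complex.regularizedHGFunCoeff_add_one]
  · simp only [Multiset.map_singleton, Multiset.prod_singleton]
    field_simp
  · intro k hk
    rw [Multiset.mem_singleton] at hk
    subst hk
    intro h
    exact h1 (by rw [h]; ring)

theorem hyp1F1_zero (a : ℂ) (hc : 0 < c) : hyp1F1 a c 0 = 1 := by
  rw [hyp1F1_eq_tsum, tsum_eq_single 0 (fun n hn => by simp [hn])]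
  simp [kummerCoeff_zero a hc]

theorem differentiable_hyp1F1 (a c : ℂ) : Differentiable ℂ (hyp1F1 a c) := by
  intro z
  have e : hyp1F1 a c = fun z => ∑' n, kummerCoeff a c n * z ^ n := funext (hyp1F1_eq_tsum a c)
  rw [e]
  exact (powerSeries_differentiableOn (summable_kummerCoeff a c (r := ‖z‖ + 1)
    (by positivity))).differentiableAt
    (Metric.isOpen_ball.mem_nhds (mem_ball_zero_iff.2 (lt_add_one _)))

theorem differentiable_deriv_hyp1F1 (a c : ℂ) : Differentiable ℂ (deriv (hyp1F1 a c)) :=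
  ((differentiable_hyp1F1 a c).contDiff (n := 2)).differentiable_deriv_two

/-- Kummer's equation. -/
theorem kummer_ode (a : ℂ) (hc : 0 < c) {z : ℂ} (hz : z ≠ 0) :
    z * deriv (deriv (hyp1F1 a c)) z + (c - z) * deriv (hyp1F1 a c) z - a * hyp1F1 a c z = 0 := by
  have e : hyp1F1 a c = fun z => ∑' n, kummerCoeff a c n * z ^ n := funext (hyp1F1_eq_tsum a c)
  have hr : ∀ w : ℂ, ‖w‖ < ‖w‖ + 1 := fun w => lt_add_one _
  have hs : ∀ r : ℝ, 0 ≤ r → Summable fun n => ‖kummerCoeff a c n‖ * r ^ n := fun r h =>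
    summable_kummerCoeff a c h
  have h1 : ∀ w : ℂ, HasSum (fun n => kummerCoeff a c n * w ^ n) (hyp1F1 a c w) := fun w => by
    rw [e]; exact powerSeries_hasSum (hs (‖w‖ + 1) (by positivity)) (hr w)
  have h2 : ∀ w : ℂ, HasSum (fun n : ℕ => n * kummerCoeff a c n * w ^ n)
      (w * deriv (hyp1F1 a c) w) := fun w => by
    rw [e]; exact powerSeries_hasSum_deriv (hs (‖w‖ + 1) (by positivity)) (hr w)
  have hs2 : ∀ r : ℝ, 0 ≤ r → Summable fun n : ℕ => ‖n * kummerCoeff a c n‖ * r ^ n := by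
    intro r h
    have h3 := (h2 r).summable.norm
    refine h3.congr fun n => ?_
    simp [abs_of_nonneg h]
  have e2 : (fun w => w * deriv (hyp1F1 a c) w) =
      fun w => ∑' n : ℕ, (n * kummerCoeff a c n) * w ^ n := funext fun w => (h2 w).tsum_eq.symm
  have h3 : HasSum (fun n : ℕ => n * (n * kummerCoeff a c n) * z ^ n)
      (z * deriv (fun w => w * deriv (hyp1F1 a c) w) z) := by
    rw [e2]; exact powerSeries_hasSum_deriv (hs2 (‖z‖ + 1) (by positivity)) (hr z)
  have e3 : deriv (fun w => w * deriv (hyp1F1 a c) w) z =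
      deriv (hyp1F1 a c) z + z * deriv (deriv (hyp1F1 a c)) z := by
    have := (hasDerivAt_id' z).mul (differentiable_deriv_hyp1F1 a c z).hasDerivAt
    refine this.deriv.trans ?_
    ring
  rw [e3] at h3
  -- In terms of `θ = z d/dz` the coefficient recursion reads `θ(θ + c - 1)F = z(θ + a)F`; Kummer's
  -- equation is this identity divided by `z`.
  have h4 := h3.add ((h2 z).mul_left ((c : ℂ) - 1))
  have h5 := (((h1 z).mul_left a).add (h2 z)).mul_left z
  have h6 := ((hasSum_nat_add_iff' 1).2 h4).unique (h5.congr_fun fun n => ?_)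
  · simp only [Finset.sum_range_one] at h6
    push_cast at h6
    have : z * (z * deriv (deriv (hyp1F1 a c)) z + (c - z) * deriv (hyp1F1 a c) z -
        a * hyp1F1 a c z) = 0 := by linear_combination h6
    exact (mul_eq_zero.1 this).resolve_left hz
  · have := kummerCoeff_succ a hc n
    push_cast
    rw [pow_succ]
    linear_combination (z ^ n * z) * this

/-- All coefficients are nonnegative and the first is `1`, so the value is at least `1`. It makes
this solution a legitimate divisor in `kummer_unique`. -/
theorem hyp1F1_ne_zero {a : ℝ} (ha : 0 < a) (hc : 0 < c) {x : ℝ} (hx : 0 ≤ x) :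
    hyp1F1 a c x ≠ 0 := by
  have hpos : ∀ n, ∃ r : ℝ, 0 ≤ r ∧ kummerCoeff a c n = r := by
    intro n
    induction n with
    | zero => exact ⟨1, zero_le_one, by rw [kummerCoeff_zero _ hc]; simp⟩
    | succ n ih =>
      obtain ⟨r, hr, h⟩ := ih
      refine ⟨(a + n) * r / ((n + 1) * (c + n)), by positivity, ?_⟩
      have h1 := kummerCoeff_succ a hc n
      rw [h] at h1
      have h2 : (c : ℂ) + n ≠ 0 := by
        have : 0 < c + n := by positivity
        exact_mod_cast this.ne'
      have h3 : (n : ℂ) + 1 ≠ 0 := by exact_mod_cast n.succ_ne_zero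
      push_cast
      rw [eq_div_iff (mul_ne_zero h3 h2)]
      linear_combination h1
  choose r hr0 hr using hpos
  have h := powerSeries_hasSum (summable_kummerCoeff a c (r := ‖(x : ℂ)‖ + 1) (by positivity))
    (lt_add_one ‖(x : ℂ)‖)
  rw [← hyp1F1_eq_tsum] at h
  have h1 := Complex.hasSum_re h
  have h2 : ∀ n, (kummerCoeff a c n * (x : ℂ) ^ n).re = r n * x ^ n := fun n => by
    rw [hr, ← Complex.ofReal_pow, ← Complex.ofReal_mul, Complex.ofReal_re]
  simp only [h2] at h1
  have h3 := le_hasSum h1 0 fun n _ => mul_nonneg (hr0 n) (pow_nonneg hx n)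
  have h4 : r 0 = 1 := by
    have := hr 0
    rw [kummerCoeff_zero _ hc] at this
    exact_mod_cast this.symm
  rw [h4] at h3
  intro h5
  rw [h5] at h3
  norm_num at h3

/-- A solution of Kummer's equation with `c > 1` which tends to `0` at `0` vanishes. -/
theorem kummer_unique {a : ℂ} (hc : 1 ≤ c) {d d₁ d₂ m m₁ m₂ : ℝ → ℂ}
    (hd : ∀ x : ℝ, 0 < x → HasDerivAt d (d₁ x) x) (hd₁ : ∀ x : ℝ, 0 < x → HasDerivAt d₁ (d₂ x) x)
    (hm : ∀ x : ℝ, 0 < x → HasDerivAt m (m₁ x) x) (hm₁ : ∀ x : ℝ, 0 < x → HasDerivAt m₁ (m₂ x) x)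
    (hdo : ∀ x : ℝ, 0 < x → x * d₂ x + (c - x) * d₁ x - a * d x = 0)
    (hmo : ∀ x : ℝ, 0 < x → x * m₂ x + (c - x) * m₁ x - a * m x = 0)
    (hm0 : ∀ x : ℝ, 0 < x → m x ≠ 0)
    {l : ℂ} (hdl : Tendsto d (𝓝[>] (0 : ℝ)) (𝓝 0)) (hml : Tendsto m (𝓝[>] 0) (𝓝 1))
    (hml₁ : Tendsto m₁ (𝓝[>] 0) (𝓝 l)) {x : ℝ} (hx : 0 < x) : d x = 0 := by
  have hconst : ∀ f : ℝ → ℂ, (∀ x : ℝ, 0 < x → HasDerivAt f 0 x) →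
      ∃ C, ∀ x : ℝ, 0 < x → f x = C := fun f hf =>
    isOpen_Ioi.exists_is_const_of_deriv_eq_zero isPreconnected_Ioi
      (fun x hx => (hf x hx).differentiableAt.differentiableWithinAt) fun x hx => (hf x hx).deriv
  -- Abel's identity: the Wronskian of two solutions times `x^c e^{-x}` is constant.
  obtain ⟨C, hC⟩ := hconst (fun x => ((x ^ c * Real.exp (-x) : ℝ) : ℂ) * (d₁ x * m x - d x * m₁ x))
    fun x hx => by
      have h1 := (((hasDerivAt_id' x).rpow_const (p := c) (Or.inl hx.ne')).mul
        (hasDerivAt_neg' x).exp).ofReal_comp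
      have h2 := h1.mul (((hd₁ x hx).mul (hm x hx)).sub ((hd x hx).mul (hm₁ x hx)))
      convert! h2 using 1
      have hx0 : (x : ℂ) ≠ 0 := by exact_mod_cast hx.ne'
      have h3 := hdo x hx
      have h4 := hmo x hx
      rw [Real.rpow_sub_one hx.ne']
      have h5 : (Complex.exp (-x)) ≠ 0 := Complex.exp_ne_zero _
      simp only [Pi.mul_apply, Pi.sub_apply]
      push_cast
      field_simp
      linear_combination ((x ^ c : ℝ) : ℂ) * Complex.exp (-x) * ((d x) * h4 - (m x) * h3)
  have hxc : Tendsto (fun x : ℝ => ((x ^ c : ℝ) : ℂ) * d₁ x) (𝓝[>] 0) (𝓝 C) := by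
    have e1 : Tendsto (fun x : ℝ => ((Real.exp x : ℝ) : ℂ)) (𝓝[>] 0) (𝓝 1) := by
      have h : ContinuousAt (fun x : ℝ => ((Real.exp x : ℝ) : ℂ)) 0 := by fun_prop
      simpa using h.tendsto.mono_left (nhdsWithin_le_nhds (s := Ioi 0))
    have e2 : Tendsto (fun x : ℝ => ((x ^ c : ℝ) : ℂ)) (𝓝[>] 0) (𝓝 0) := by
      have h : ContinuousAt (fun x : ℝ => ((x ^ c : ℝ) : ℂ)) 0 :=
        Complex.continuous_ofReal.continuousAt.comp
          (Real.continuousAt_rpow_const _ _ (Or.inr (by linarith)))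
      have h' := h.tendsto.mono_left (nhdsWithin_le_nhds (s := Ioi 0))
      simpa [Real.zero_rpow (show c ≠ 0 by linarith)] using h'
    have h := ((e1.mul_const C).add ((e2.mul hdl).mul hml₁)).div hml one_ne_zero
    simp only [one_mul, zero_mul, add_zero, div_one] at h
    refine h.congr' (eventually_mem_nhdsWithin.mono fun x hx => ?_)
    have hx' : 0 < x := hx
    have h1 := hC x hx'
    have h2 := hm0 x hx'
    have h3 : ((Real.exp x : ℝ) : ℂ) * ((Real.exp (-x) : ℝ) : ℂ) = 1 := by
      rw [← Complex.ofReal_mul, ← Real.exp_add]; simp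
    simp only [Pi.div_apply]
    rw [div_eq_iff h2, ← h1]
    push_cast at h3 ⊢
    linear_combination (((x ^ c : ℝ) : ℂ) * (d₁ x * m x - d x * m₁ x)) * h3
  -- If `C ≠ 0`, then `d₁` behaves like `C x^{-c}` near `0`, which is not integrable for `c ≥ 1`.
  -- The real part of `d / C` would then grow by a fixed amount over arbitrarily small intervals
  -- `[y, 2y]`, against its limit `0`.
  have hC0 : C = 0 := by
    by_contra hne
    set f : ℝ → ℝ := fun x => (d x / C).re with hf
    have hfd : ∀ x : ℝ, 0 < x → HasDerivAt f (d₁ x / C).re x := fun x hx =>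
      (Complex.reCLM.hasFDerivAt.comp_hasDerivAt x ((hd x hx).div_const C))
    have h1 : Tendsto (fun x : ℝ => (((x ^ c : ℝ) : ℂ) * d₁ x / C).re) (𝓝[>] 0) (𝓝 1) := by
      have h := (Complex.continuous_re.tendsto _).comp (hxc.div_const C)
      simpa [div_self hne, Function.comp_def] using h
    have h2 : Tendsto f (𝓝[>] 0) (𝓝 0) := by
      have h := (Complex.continuous_re.tendsto _).comp (hdl.div_const C)
      simpa [Function.comp_def] using h
    -- A lower bound for that growth: `2⁻¹ (2y)^{-c} · y = η y^{1-c} ≥ η`, where `2⁻¹` comes from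
    -- asking only for half of the limit `1`.
    set η : ℝ := 2⁻¹ * (2 : ℝ) ^ (-c) with hη
    have hη0 : 0 < η := by positivity
    have h3 := h1.eventually (lt_mem_nhds (show (2⁻¹ : ℝ) < 1 by norm_num))
    have h4 := h2.eventually (Metric.ball_mem_nhds 0 (half_pos hη0))
    obtain ⟨ε, hε, h5⟩ := mem_nhdsGT_iff_exists_Ioo_subset.1 (h3.and h4)
    have hε0 : (0 : ℝ) < ε := hε
    set y := min (ε / 3) (1 / 2) with hy
    have hy0 : 0 < y := lt_min (by positivity) (by norm_num)
    have hyε : 2 * y < ε := by linarith [min_le_left (ε / 3) (1 / 2)]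
    have hy1 : y ≤ 1 / 2 := min_le_right _ _
    have h6 := Convex.mul_sub_le_image_sub_of_le_deriv (convex_Icc y (2 * y)) (f := f)
      (fun t ht => (hfd t (hy0.trans_le ht.1)).continuousAt.continuousWithinAt)
      (fun t ht => (hfd t (hy0.trans_le (interior_subset ht).1)).differentiableAt.differentiableWithinAt)
      (C := 2⁻¹ * (2 * y) ^ (-c)) (fun t ht => ?_) y ⟨le_rfl, by linarith⟩ (2 * y)
      ⟨by linarith, le_rfl⟩ (by linarith)
    · have h7 : η ≤ 2⁻¹ * (2 * y) ^ (-c) * (2 * y - y) := by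
        rw [Real.mul_rpow (by norm_num) hy0.le, hη]
        have h8 : 1 ≤ y ^ (-c) * y := by
          rw [← Real.rpow_add_one hy0.ne']
          exact Real.one_le_rpow_of_pos_of_le_one_of_nonpos hy0 (by linarith) (by linarith)
        calc 2⁻¹ * (2 : ℝ) ^ (-c) = 2⁻¹ * (2 : ℝ) ^ (-c) * 1 := by ring
          _ ≤ 2⁻¹ * (2 : ℝ) ^ (-c) * (y ^ (-c) * y) := by gcongr
          _ = _ := by ring
      have h9 := (h5 (show y ∈ Ioo 0 ε from ⟨hy0, by linarith⟩)).2
      have h10 := (h5 (show 2 * y ∈ Ioo 0 ε from ⟨by positivity, hyε⟩)).2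
      rw [dist_zero_right, Real.norm_eq_abs, abs_lt] at h9 h10
      linarith
    · have ht' := interior_subset ht
      have ht0 : 0 < t := hy0.trans_le ht'.1
      have h7 := (h5 (show t ∈ Ioo 0 ε from ⟨ht0, by linarith [ht'.2]⟩)).1
      rw [(hfd t ht0).deriv]
      rw [mul_div_assoc, Complex.re_ofReal_mul] at h7
      have h8 : t ^ (-c) * t ^ c = 1 := by rw [← Real.rpow_add ht0]; simp
      have h9 : (2 * y) ^ (-c) ≤ t ^ (-c) :=
        Real.rpow_le_rpow_of_nonpos ht0 ht'.2 (by linarith)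
      calc 2⁻¹ * (2 * y) ^ (-c) ≤ 2⁻¹ * t ^ (-c) := by gcongr
        _ ≤ (t ^ c * (d₁ t / C).re) * t ^ (-c) := by gcongr
        _ = (d₁ t / C).re * (t ^ (-c) * t ^ c) := by ring
        _ = _ := by rw [h8, mul_one]
  -- With vanishing Wronskian the quotient `d / m` is constant, and its limit at `0` is `0 / 1`.
  obtain ⟨C', hC'⟩ := hconst (fun x => d x / m x) fun x hx => by
    have h1 := (hd x hx).div (hm x hx) (hm0 x hx)
    convert! h1 using 1
    have h2 := hC x hx
    rw [hC0] at h2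
    have h3 : ((x ^ c * Real.exp (-x) : ℝ) : ℂ) ≠ 0 := by
      exact_mod_cast (mul_pos (Real.rpow_pos_of_pos hx c) (Real.exp_pos _)).ne'
    rw [(mul_eq_zero.1 h2).resolve_left h3, zero_div]
  have h1 : Tendsto (fun x => d x / m x) (𝓝[>] 0) (𝓝 (0 / 1)) := hdl.div hml one_ne_zero
  have h2 : C' = 0 / 1 := tendsto_nhds_unique (l := 𝓝[>] (0 : ℝ)) (tendsto_const_nhds.congr'
    (eventually_mem_nhdsWithin.mono fun x hx => (hC' x hx).symm)) h1
  have h3 := hC' x hx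
  rw [h2, zero_div, div_eq_zero_iff] at h3
  exact h3.resolve_right (hm0 x hx)

end Kummer

/-! ### The Laplace type integral and the confluent functions. -/

/-- `∫₀^∞ (1 + s)^a s^{-b-p} e^{-x/s} ds`. -/
noncomputable def laplaceInt (a b : ℝ) (p : ℕ) (x : ℝ) : ℂ := kernInt a b 1 p 0 (√x : ℝ)

theorem kern_zero_right (a b κ : ℝ) (p : ℕ) (z : ℂ) (s : ℝ) :
    kern a b κ p 0 z s = (((1 + s) ^ a * s ^ (-b) : ℝ) : ℂ) * (s : ℂ)⁻¹ ^ p *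
      Complex.exp (-((κ * ‖z‖ ^ 2 : ℝ) : ℂ) * (s : ℂ)⁻¹) := by
  rw [kern, Complex.mul_conj, Complex.normSq_eq_norm_sq]
  push_cast
  simp

/-- The choice `z = √x`, `κ = 1` makes `κ|z|² = x`, so that integrability and differentiation are
inherited from the kernel integrals. -/
theorem kern_sqrt (a b : ℝ) (p : ℕ) {x : ℝ} (hx : 0 ≤ x) (s : ℝ) :
    kern a b 1 p 0 (√x : ℝ) s = (((1 + s) ^ a * s ^ (-b) : ℝ) : ℂ) * (s : ℂ)⁻¹ ^ p *
      Complex.exp (-(x : ℂ) * (s : ℂ)⁻¹) := by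
  rw [kern_zero_right, Complex.norm_real, Real.norm_of_nonneg (Real.sqrt_nonneg x),
    Real.sq_sqrt hx, one_mul]

theorem laplaceInt_eq (a b : ℝ) (p : ℕ) {x : ℝ} (hx : 0 ≤ x) :
    laplaceInt a b p x = ∫ s in Ioi (0 : ℝ), (((1 + s) ^ a * s ^ (-b) : ℝ) : ℂ) * (s : ℂ)⁻¹ ^ p *
      Complex.exp (-(x : ℂ) * (s : ℂ)⁻¹) := by
  simp only [laplaceInt, kernInt, kern_sqrt a b p hx]

theorem sqrt_mem_slitPlane {x : ℝ} (hx : 0 < x) : ((√x : ℝ) : ℂ) ∈ Complex.slitPlane :=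
  Complex.ofReal_mem_slitPlane.2 (Real.sqrt_pos.2 hx)

theorem integrableOn_laplace {a b : ℝ} (hab : a < b) (hb : b < 1) {p : ℕ} (hp : 1 ≤ p) {x : ℝ}
    (hx : 0 < x) : IntegrableOn (fun s : ℝ => (((1 + s) ^ a * s ^ (-b) : ℝ) : ℂ) * (s : ℂ)⁻¹ ^ p *
      Complex.exp (-(x : ℂ) * (s : ℂ)⁻¹)) (Ioi 0) := by
  have h := integrableOn_kern (a := a) hab hb zero_le_one (sqrt_mem_slitPlane hx) (p := p) (n := 0)
    (by omega) (Or.inr one_pos)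
  exact h.congr_fun (fun s _ => kern_sqrt a b p hx.le s) measurableSet_Ioi

theorem laplaceInt_hasDerivAt {a b : ℝ} (hab : a < b) (hb : b < 1) {p : ℕ} (hp : 1 ≤ p) {x : ℝ}
    (hx : 0 < x) : HasDerivAt (laplaceInt a b p) (-laplaceInt a b (p + 1) x) x := by
  have h1 := (kernInt_wirtinger (a := a) hab hb zero_le_one (sqrt_mem_slitPlane hx) (p := p) (n := 0)
    (by omega) (Or.inr one_pos)).hasFDerivAt
  have h2 := (Real.hasDerivAt_sqrt hx.ne').ofReal_comp
  have h3 := h1.comp_hasDerivAt x h2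
  convert! h3 using 1
  have hs : ((√x : ℝ) : ℂ) ≠ 0 := by exact_mod_cast (Real.sqrt_pos.2 hx).ne'
  simp only [wirtinger_apply, Complex.conj_ofReal, laplaceInt]
  push_cast
  field_simp
  ring

/-- Since each `x`-derivative raises `p` by one with a sign, this is Kummer's equation with
parameters `b - a` and `b + 1`. It is the integral of the `s`-derivative of `(1 + s)^(a+1) s^{-b-1}
e^{-x/s}`. -/
theorem laplaceInt_ode {a b : ℝ} (hab : a < b) (hb : b < 1) {x : ℝ} (hx : 0 < x) :
    x * laplaceInt a b 3 x + (((b + 1 : ℝ) : ℂ) - x) * -laplaceInt a b 2 x -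
      ((b - a : ℝ) : ℂ) * laplaceInt a b 1 x = 0 := by
  set k : ℕ → ℝ → ℂ := fun p s => (((1 + s) ^ a * s ^ (-b) : ℝ) : ℂ) * (s : ℂ)⁻¹ ^ p *
      Complex.exp (-(x : ℂ) * (s : ℂ)⁻¹) with hk
  have hI : ∀ p, 1 ≤ p → HasInt (volume.restrict (Ioi 0)) (k p) (laplaceInt a b p x) := fun p hp =>
    ⟨integrableOn_laplace hab hb hp hx, (laplaceInt_eq a b p hx.le).symm⟩
  have hint := (((hI 3 (by omega)).const_mul x).sub
    ((hI 2 (by omega)).const_mul (((b + 1 : ℝ) : ℂ) - x))).sub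
    ((hI 1 (by omega)).const_mul ((b - a : ℝ) : ℂ))
  have hd : ∀ s ∈ Ioi (0 : ℝ), HasDerivAt (fun s : ℝ => (1 + (s : ℂ)) * k 1 s)
      (x * k 3 s - (((b + 1 : ℝ) : ℂ) - x) * k 2 s - ((b - a : ℝ) : ℂ) * k 1 s) s := by
    intro s hs
    have hs0 : (0 : ℝ) < s := hs
    have h0 : (s : ℂ) ≠ 0 := by exact_mod_cast hs0.ne'
    have h1 : (1 : ℂ) + s ≠ 0 := by
      have : (0 : ℝ) < 1 + s := by positivity
      exact_mod_cast this.ne'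
    have hid : HasDerivAt (fun s : ℝ => (s : ℂ)) 1 s := (hasDerivAt_id' s).ofReal_comp
    have h2 := ((hid.inv h0).const_mul (-(x : ℂ))).cexp
    have h3 := (hid.const_add 1).mul (((hasDerivAt_one_add_rpow_mul_rpow a (-b) hs0).mul
      ((hid.inv h0).pow 1)).mul h2)
    convert! h3 using 1
    simp only [hk, Pi.mul_apply, Pi.inv_apply, Pi.pow_apply]
    push_cast
    field_simp
    ring
  obtain ⟨C, hC⟩ := eventually_norm_kern_le (a := a) (b := b) zero_le_one (sqrt_mem_slitPlane hx)
    (show 1 ≤ 2 + 0 by omega) (Or.inr one_pos)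
  obtain ⟨C₁, hC₁⟩ := eventually_norm_kern_le (a := a) (b := b) zero_le_one (sqrt_mem_slitPlane hx)
    (show 1 ≤ 1 + 0 by omega) (Or.inr one_pos)
  have hk' : ∀ p s, k p s = kern a b 1 p 0 (√x : ℝ) s := fun p s => (kern_sqrt a b p hx.le s).symm
  have hn : ∀ s : ℝ, 0 < s → ‖(1 : ℂ) + s‖ = 1 + s := fun s hs => by
    rw [← Complex.ofReal_one, ← Complex.ofReal_add, Complex.norm_real, Real.norm_of_nonneg]
    positivity
  have key := integral_Ioi_of_hasDerivAt_of_tendsto_nhdsGT hd hint.1 (m := 0) (l := 0) ?_ ?_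
  · have h2 := hint.2
    rw [key, sub_zero] at h2
    linear_combination -h2
  · have h1 := (tendsto_one_add_rpow_mul_rpow_nhdsGT (a := a) (c := 1 - b)
      (by linarith)).const_mul C
    rw [mul_zero] at h1
    refine squeeze_zero_norm' (eventually_mem_nhdsWithin.mono fun s hs => ?_) h1
    have hs0 : (0 : ℝ) < s := hs
    have h2 := hC.self_of_nhds s hs0
    rw [kern_succ_left _ _ _ 1, norm_mul, norm_inv, Complex.norm_real, Real.norm_of_nonneg hs0.le,
      inv_mul_le_iff₀ hs0] at h2
    rw [norm_mul, hn s hs0, hk']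
    calc _ ≤ (1 + s) * (s * (C * ((1 + s) ^ (a - 1) * s ^ (-b)))) := by gcongr
      _ = C * s * ((1 + s) * ((1 + s) ^ (a - 1) * s ^ (-b))) := by ring
      _ = _ := by
        rw [one_add_rpow_sub_one_mul hs0, sub_eq_add_neg, Real.rpow_add hs0, Real.rpow_one]; ring
  · have h1 := (tendsto_one_add_rpow_mul_rpow_atTop (a := a) (c := -b) (by linarith)).const_mul C₁
    rw [mul_zero] at h1
    refine squeeze_zero_norm' ((eventually_gt_atTop 0).mono fun s hs0 => ?_) h1
    have h2 := hC₁.self_of_nhds s hs0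
    rw [norm_mul, hn s hs0, hk']
    calc _ ≤ (1 + s) * (C₁ * ((1 + s) ^ (a - 1) * s ^ (-b))) := by gcongr
      _ = C₁ * ((1 + s) * ((1 + s) ^ (a - 1) * s ^ (-b))) := by ring
      _ = _ := by rw [one_add_rpow_sub_one_mul hs0]

/-- Under `t = 1/s` this is Euler's integral for `Γ(b)`. -/
theorem laplaceInt_zero {b : ℝ} (hb : 0 < b) {x : ℝ} (hx : 0 < x) :
    laplaceInt 0 b 1 x = ((Real.Gamma b * x ^ (-b) : ℝ) : ℂ) := by
  have h1 := integral_comp_rpow_Ioi (fun t : ℝ => t ^ (b - 1) * Real.exp (-(x * t)))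
    (p := -1) (by norm_num)
  rw [Real.integral_rpow_mul_exp_neg_mul_Ioi hb hx] at h1
  rw [Real.rpow_neg hx.le, ← Real.inv_rpow hx.le, ← one_div, mul_comm, ← h1, laplaceInt_eq _ _ _ hx.le,
    ← integral_complex_ofReal]
  refine setIntegral_congr_fun measurableSet_Ioi fun s hs => ?_
  have hs0 : (0 : ℝ) < s := hs
  have e : |(-1 : ℝ)| * s ^ ((-1 : ℝ) - 1) * (s ^ (-1 : ℝ)) ^ (b - 1) = s ^ (-b) * s⁻¹ := by
    rw [← Real.rpow_mul hs0.le, ← Real.rpow_neg_one s, abs_neg, abs_one, one_mul,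
      ← Real.rpow_add hs0, ← Real.rpow_add hs0]
    congr 1; ring
  rw [smul_eq_mul]
  rw [← mul_assoc, e, Real.rpow_zero, one_mul, pow_one, Real.rpow_neg_one]
  push_cast
  ring_nf

theorem one_add_rpow_sub_one_bounds {a : ℝ} (ha : 0 ≤ a) (ha1 : a ≤ 1) {s : ℝ} (hs : 0 < s) :
    0 ≤ (1 + s) ^ a - 1 ∧ (1 + s) ^ a - 1 ≤ s * (1 + s) ^ (a - 1) := by
  have h1 : (1 : ℝ) ≤ 1 + s := by linarith
  refine ⟨sub_nonneg.2 (Real.one_le_rpow h1 ha), ?_⟩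
  have h2 : (1 + s) ^ (a - 1) ≤ 1 := Real.rpow_le_one_of_one_le_of_nonpos h1 (by linarith)
  have h3 : (1 + s) ^ a = (1 + s) ^ (a - 1) * (1 + s) := by
    rw [← Real.rpow_add_one (by positivity)]; congr 1; ring
  rw [h3]
  linarith

/-- `∫₀^∞ ((1 + s)^a - 1) s^{-b-1} ds` by parts. -/
theorem integral_one_add_rpow_sub_one {a b : ℝ} (ha : 0 ≤ a) (hab : a < b) (hb : b < 1) :
    HasInt (volume.restrict (Ioi 0))
      (fun s : ℝ => ((((1 + s) ^ a - 1) * (s ^ (-b) * s⁻¹) : ℝ) : ℂ))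
      ((a / b * betaConst a b : ℝ) : ℂ) := by
  have hb0 := ha.trans_lt hab
  have hbd : ∀ s : ℝ, 0 < s → ‖((((1 + s) ^ a - 1) * s ^ (-b) : ℝ) : ℂ)‖ ≤
      (1 + s) ^ (a - 1) * s ^ (1 - b) := by
    intro s hs
    obtain ⟨h1, h2⟩ := one_add_rpow_sub_one_bounds ha (by linarith) hs
    rw [Complex.norm_real, Real.norm_of_nonneg (mul_nonneg h1 (Real.rpow_nonneg hs.le _)),
      show 1 - b = 1 + -b by ring, Real.rpow_add hs, Real.rpow_one]
    calc _ ≤ (s * (1 + s) ^ (a - 1)) * s ^ (-b) := by gcongr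
      _ = _ := by ring
  have hint0 : IntegrableOn (fun s : ℝ => (1 + s) ^ (a - 1) * s ^ (-b)) (Ioi 0) :=
    integrableOn_rpow_mul_one_add_rpow (by linarith) (by linarith)
  have hi : IntegrableOn (fun s : ℝ => ((((1 + s) ^ a - 1) * (s ^ (-b) * s⁻¹) : ℝ) : ℂ)) (Ioi 0) := by
    refine hint0.mono' (by fun_prop : Measurable _).aestronglyMeasurable
      ((ae_restrict_iff' measurableSet_Ioi).2 (.of_forall fun s hs => ?_))
    have hs0 : (0 : ℝ) < s := hs
    have h := hbd s hs0
    rw [← mul_assoc, Complex.ofReal_mul, norm_mul, Complex.norm_real s⁻¹, Real.norm_of_nonneg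
      (inv_nonneg.2 hs0.le), ← div_eq_mul_inv, div_le_iff₀ hs0]
    refine h.trans_eq ?_
    rw [show 1 - b = -b + 1 by ring, Real.rpow_add_one hs0.ne', mul_assoc]
  have hK : HasInt (volume.restrict (Ioi 0))
      (fun s : ℝ => (((1 + s) ^ (a - 1) * s ^ (-b) : ℝ) : ℂ)) (betaConst a b) :=
    ⟨hint0.ofReal, integral_complex_ofReal⟩
  have hint := (hK.const_mul (a / b)).sub (HasInt.mk_self hi)
  have hd : ∀ s ∈ Ioi (0 : ℝ), HasDerivAt
      (fun s : ℝ => (b : ℂ)⁻¹ * ((((1 + s) ^ a - 1) * s ^ (-b) : ℝ) : ℂ))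
      (a / b * (((1 + s) ^ (a - 1) * s ^ (-b) : ℝ) : ℂ) -
        ((((1 + s) ^ a - 1) * (s ^ (-b) * s⁻¹) : ℝ) : ℂ)) s := by
    intro s hs
    have hs0 : (0 : ℝ) < s := hs
    have hs1 : (0 : ℝ) < 1 + s := by positivity
    have h1 := ((hasDerivAt_id' s).const_add 1).rpow_const (p := a) (Or.inl hs1.ne')
    have h2 := (hasDerivAt_id' s).rpow_const (p := -b) (Or.inl hs0.ne')
    have h3 := (((h1.sub_const 1).mul h2).ofReal_comp).const_mul (b : ℂ)⁻¹
    convert! h3 using 1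
    have e2 : (s : ℂ) ≠ 0 := by exact_mod_cast hs0.ne'
    have e3 : (b : ℂ) ≠ 0 := by exact_mod_cast hb0.ne'
    rw [Real.rpow_sub_one hs0.ne']
    push_cast
    field_simp
    ring
  have hbd' : ∀ s : ℝ, 0 < s → ‖(b : ℂ)⁻¹ * ((((1 + s) ^ a - 1) * s ^ (-b) : ℝ) : ℂ)‖ ≤
      b⁻¹ * ((1 + s) ^ (a - 1) * s ^ (1 - b)) := by
    intro s hs
    rw [norm_mul, norm_inv, Complex.norm_real, Real.norm_of_nonneg hb0.le]
    gcongr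
    exact hbd s hs
  have key := integral_Ioi_of_hasDerivAt_of_tendsto_nhdsGT hd hint.1 (m := 0) (l := 0) ?_ ?_
  · have h2 := hint.2
    rw [key, sub_zero] at h2
    refine ⟨hi, ?_⟩
    push_cast at h2 ⊢
    linear_combination h2
  · have h1 := (tendsto_one_add_rpow_mul_rpow_nhdsGT (a := a - 1) (c := 1 - b)
      (by linarith)).const_mul b⁻¹
    rw [mul_zero] at h1
    exact squeeze_zero_norm' (eventually_mem_nhdsWithin.mono fun s hs => hbd' s hs) h1
  · have h1 := (tendsto_one_add_rpow_mul_rpow_atTop (a := a - 1) (c := 1 - b)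
      (by linarith)).const_mul b⁻¹
    rw [mul_zero] at h1
    exact squeeze_zero_norm' ((eventually_gt_atTop 0).mono fun s hs => hbd' s hs) h1

/-- Subtraction of the case `a = 0` removes the non-integrable singularity `s^{-b-1}`; then `x → 0`
passes under the integral. This supplies the second coefficient of the two-term expansion. -/
theorem tendsto_laplaceInt_sub {a b : ℝ} (ha : 0 ≤ a) (hab : a < b) (hb : b < 1) :
    Tendsto (fun x => laplaceInt a b 1 x - laplaceInt 0 b 1 x) (𝓝[>] 0)
      (𝓝 ((a / b * betaConst a b : ℝ) : ℂ)) := by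
  have h0 := integral_one_add_rpow_sub_one ha hab hb
  rw [← h0.2]
  have e : ∀ x : ℝ, 0 < x → laplaceInt a b 1 x - laplaceInt 0 b 1 x =
      ∫ s in Ioi (0 : ℝ), ((((1 + s) ^ a - 1) * (s ^ (-b) * s⁻¹) : ℝ) : ℂ) *
        ((Real.exp (-x * s⁻¹) : ℝ) : ℂ) := by
    intro x hx
    rw [laplaceInt_eq _ _ _ hx.le, laplaceInt_eq _ _ _ hx.le,
      ← integral_sub (integrableOn_laplace hab hb le_rfl hx)
        (integrableOn_laplace (ha.trans_lt hab) hb le_rfl hx)]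
    congr 1
    funext s
    push_cast
    simp
    ring
  refine (Tendsto.congr' (eventually_mem_nhdsWithin.mono fun x hx => (e x hx).symm) ?_)
  refine tendsto_integral_filter_of_dominated_convergence _ (.of_forall fun t =>
    (by fun_prop : Measurable _).aestronglyMeasurable) ?_ h0.1.norm ?_
  · refine eventually_mem_nhdsWithin.mono fun x hx => ?_
    refine (ae_restrict_iff' measurableSet_Ioi).2 (.of_forall fun s hs => ?_)
    have hs0 : (0 : ℝ) < s := hs
    have hx0 : (0 : ℝ) < x := hx
    rw [norm_mul, Complex.norm_real (Real.exp _), Real.norm_of_nonneg (Real.exp_pos _).le]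
    refine mul_le_of_le_one_right (norm_nonneg _) (Real.exp_le_one_iff.2 ?_)
    have : 0 < x * s⁻¹ := by positivity
    linarith
  · refine .of_forall fun s => ?_
    have hc : ContinuousAt (fun x : ℝ => ((((1 + s) ^ a - 1) * (s ^ (-b) * s⁻¹) : ℝ) : ℂ) *
        ((Real.exp (-x * s⁻¹) : ℝ) : ℂ)) 0 := by fun_prop
    have h := hc.tendsto.mono_left (nhdsWithin_le_nhds (s := Ioi 0))
    simpa using h

/-- The two-term expansion of the Laplace type integral through Kummer's functions. -/
theorem laplaceInt_eq_kummer {a b : ℝ} (ha : 0 ≤ a) (hab : a < b) (hb : b < 1) {x : ℝ}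
    (hx : 0 < x) :
    laplaceInt a b 1 x = ((Real.Gamma b * x ^ (-b) : ℝ) : ℂ) *
      hyp1F1 (-(a : ℂ)) ((1 - b : ℝ) : ℂ) x +
      ((a / b * betaConst a b : ℝ) : ℂ) * hyp1F1 ((b - a : ℝ) : ℂ) ((b + 1 : ℝ) : ℂ) x := by
  have hb0 := ha.trans_lt hab
  set u := hyp1F1 (-(a : ℂ)) ((1 - b : ℝ) : ℂ) with hu
  set m := hyp1F1 ((b - a : ℝ) : ℂ) ((b + 1 : ℝ) : ℂ) with hm
  set B : ℂ := ((a / b * betaConst a b : ℝ) : ℂ) with hB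
  have hu1 : ∀ x : ℝ, HasDerivAt (fun x : ℝ => u x) (deriv u x) x := fun x =>
    (differentiable_hyp1F1 _ _ _).hasDerivAt.comp_ofReal
  have hu2 : ∀ x : ℝ, HasDerivAt (fun x : ℝ => deriv u x) (deriv (deriv u) x) x := fun x =>
    (differentiable_deriv_hyp1F1 _ _ _).hasDerivAt.comp_ofReal
  have hm1 : ∀ x : ℝ, HasDerivAt (fun x : ℝ => m x) (deriv m x) x := fun x =>
    (differentiable_hyp1F1 _ _ _).hasDerivAt.comp_ofReal
  have hm2 : ∀ x : ℝ, HasDerivAt (fun x : ℝ => deriv m x) (deriv (deriv m) x) x := fun x =>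
    (differentiable_deriv_hyp1F1 _ _ _).hasDerivAt.comp_ofReal
  have hp : ∀ (e : ℝ) {x : ℝ}, 0 < x → HasDerivAt (fun x : ℝ => ((Real.Gamma b * x ^ e : ℝ) : ℂ))
      (((Real.Gamma b * x ^ e : ℝ) : ℂ) * (e / x)) x := by
    intro e x hx
    have h := ((((hasDerivAt_id' x).rpow_const (p := e) (Or.inl hx.ne')).const_mul
      (Real.Gamma b))).ofReal_comp
    convert! h using 1
    have e2 : (x : ℂ) ≠ 0 := by exact_mod_cast hx.ne'
    rw [Real.rpow_sub_one hx.ne']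
    push_cast
    field_simp
  have hinv : ∀ {x : ℝ}, 0 < x → HasDerivAt (fun x : ℝ => (b : ℂ) / x) (-b / x ^ 2) x := by
    intro x hx
    have e2 : (x : ℂ) ≠ 0 := by exact_mod_cast hx.ne'
    have h := (((hasDerivAt_id' x).ofReal_comp).inv e2).const_mul (b : ℂ)
    convert! h using 1
    push_cast
    field_simp
  have h1m : m 0 = 1 := hyp1F1_zero _ (by linarith)
  have h1u : u 0 = 1 := hyp1F1_zero _ (by linarith)
  -- `d` is the integral minus its claimed expansion, with formal derivatives `d₁`, `d₂`. It solves
  -- Kummer's equation and tends to `0` at `0`, so `kummer_unique` with `c = b + 1` makes it vanish.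
  set d : ℝ → ℂ := fun x => laplaceInt a b 1 x - ((Real.Gamma b * x ^ (-b) : ℝ) : ℂ) * u x - B * m x
    with hd
  set d₁ : ℝ → ℂ := fun x => -laplaceInt a b 2 x -
    ((Real.Gamma b * x ^ (-b) : ℝ) : ℂ) * (deriv u x - b / x * u x) - B * deriv m x with hd₁
  set d₂ : ℝ → ℂ := fun x => laplaceInt a b 3 x -
    ((Real.Gamma b * x ^ (-b) : ℝ) : ℂ) * (deriv (deriv u) x - 2 * (b / x) * deriv u x +
      b * (b + 1) / x ^ 2 * u x) - B * deriv (deriv m) x with hd₂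
  have key := kummer_unique (a := ((b - a : ℝ) : ℂ)) (c := b + 1) (d := d) (d₁ := d₁) (d₂ := d₂)
    (m := fun x => m x) (m₁ := fun x => deriv m x) (m₂ := fun x => deriv (deriv m) x)
    (l := deriv m 0) (by linarith) ?_ ?_ (fun x _ => hm1 x) (fun x _ => hm2 x) ?_ ?_ ?_ ?_ ?_ ?_ hx
  · linear_combination key
  · intro x hx
    have e2 : (x : ℂ) ≠ 0 := by exact_mod_cast hx.ne'
    have h := ((laplaceInt_hasDerivAt hab hb (p := 1) le_rfl hx).sub
      ((hp (-b) hx).mul (hu1 x))).sub ((hm1 x).const_mul B)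
    convert! h using 1
    simp only [hd₁]
    push_cast
    field_simp
    ring
  · intro x hx
    have e2 : (x : ℂ) ≠ 0 := by exact_mod_cast hx.ne'
    have h := (((laplaceInt_hasDerivAt hab hb (p := 2) (by omega) hx).neg).sub
      ((hp (-b) hx).mul ((hu2 x).sub ((hinv hx).mul (hu1 x))))).sub ((hm2 x).const_mul B)
    convert! h using 1
    simp only [hd₂, Pi.sub_apply, Pi.mul_apply]
    push_cast
    field_simp
    ring
  · intro x hx
    have e2 : (x : ℂ) ≠ 0 := by exact_mod_cast hx.ne'
    have h1 := laplaceInt_ode hab hb hx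
    have h2 := kummer_ode (-(a : ℂ)) (c := 1 - b) (by linarith) e2
    have h3 := kummer_ode ((b - a : ℝ) : ℂ) (c := b + 1) (by linarith) e2
    rw [← hu] at h2
    rw [← hm] at h3
    simp only [hd, hd₁, hd₂]
    -- Conjugation by `x^{-b}` carries Kummer's operator with parameters `(b - a, b + 1)` to the one
    -- with `(-a, 1 - b)`.
    have h4 : ∀ P : ℂ, x * (P * (deriv (deriv u) x - 2 * (b / x) * deriv u x +
        b * (b + 1) / x ^ 2 * u x)) + (((b + 1 : ℝ) : ℂ) - x) * (P * (deriv u x - b / x * u x)) -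
        ((b - a : ℝ) : ℂ) * (P * u x) = P * (x * deriv (deriv u) x +
        (((1 - b : ℝ) : ℂ) - x) * deriv u x - -(a : ℂ) * u x) := by
      intro P
      push_cast
      field_simp
      ring
    have h5 := h4 ((Real.Gamma b * x ^ (-b) : ℝ) : ℂ)
    rw [h2, mul_zero] at h5
    linear_combination h1 - h5 - B * h3
  · intro x hx
    have h3 := kummer_ode ((b - a : ℝ) : ℂ) (c := b + 1) (by linarith) (z := x)
      (by exact_mod_cast hx.ne')
    exact h3
  · intro x hx
    exact hyp1F1_ne_zero (by linarith) (by linarith) hx.le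
  · have h1 := tendsto_laplaceInt_sub ha hab hb
    -- The singular term differs from `Γ(b) x^{-b}` by `Γ(b) x^{1-b}` times the difference quotient
    -- of `u` at `0`, which tends to `0` since `b < 1`.
    have h2 : Tendsto (fun x : ℝ => ((Real.Gamma b * x ^ (1 - b) : ℝ) : ℂ) *
        ((x : ℂ)⁻¹ * (u x - u 0))) (𝓝[>] 0) (𝓝 (0 * deriv u 0)) := by
      refine Tendsto.mul ?_ ?_
      · have hc : ContinuousAt (fun x : ℝ => ((Real.Gamma b * x ^ (1 - b) : ℝ) : ℂ)) 0 :=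
          Complex.continuous_ofReal.continuousAt.comp (continuousAt_const.mul
            (Real.continuousAt_rpow_const _ _ (Or.inr (by linarith))))
        have h := hc.tendsto.mono_left (nhdsWithin_le_nhds (s := Ioi 0))
        simpa [Real.zero_rpow (show 1 - b ≠ 0 by linarith)] using h
      · have h := (hasDerivAt_iff_tendsto_slope.1 (hu1 0)).mono_left
          (nhdsWithin_mono (0 : ℝ)
          (show Ioi (0 : ℝ) ⊆ {0}ᶜ from fun x hx => (ne_of_gt hx)))
        simpa [slope_fun_def] using h
    have h3 : Tendsto (fun x : ℝ => B * (m x - 1)) (𝓝[>] 0) (𝓝 (B * (m 0 - 1))) := by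
      have h := ((hm1 0).continuousAt.tendsto.mono_left
        (nhdsWithin_le_nhds (s := Ioi 0))).sub_const 1 |>.const_mul B
      simpa using h
    have h4 := ((h1.sub_const B).sub h2).sub h3
    rw [h1m, sub_self, sub_self, mul_zero, zero_mul, sub_zero, sub_zero] at h4
    refine h4.congr' (eventually_mem_nhdsWithin.mono fun x hx => ?_)
    have hx0 : (0 : ℝ) < x := hx
    have e2 : (x : ℂ) ≠ 0 := by exact_mod_cast hx0.ne'
    rw [laplaceInt_zero hb0 hx0, show 1 - b = -b + 1 by ring, Real.rpow_add_one hx0.ne', h1u]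
    simp only [hd]
    push_cast
    field_simp
    ring
  · have h := (hm1 0).continuousAt.tendsto.mono_left (nhdsWithin_le_nhds (s := Ioi 0))
    simpa [h1m] using h
  · have h := (hm2 0).continuousAt.tendsto.mono_left (nhdsWithin_le_nhds (s := Ioi 0))
    simpa using h

/-- The Laplace type integral in terms of the second confluent hypergeometric function. -/
theorem laplaceInt_eq_hypU {a b : ℝ} (ha : 0 < a) (hab : a < b) (hb : b < 1) {x : ℝ}
    (hx : 0 < x) :
    laplaceInt a b 1 x = ((Real.Gamma (b - a) * x ^ (-b) : ℝ) : ℂ) *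
      hypU (-(a : ℂ)) (1 - (b : ℂ)) x := by
  have hb0 := ha.trans hab
  rw [laplaceInt_eq_kummer ha.le hab hb hx, hypU, betaConst_eq hab hb]
  have e1 : (1 : ℂ) + -(a : ℂ) - (1 - b) = ((b - a : ℝ) : ℂ) := by push_cast; ring
  have e2 : (2 : ℂ) - (1 - (b : ℂ)) = ((b + 1 : ℝ) : ℂ) := by push_cast; ring
  have e3 : (1 : ℂ) - (1 - (b : ℂ)) = (b : ℂ) := by ring
  have e4 : (1 : ℂ) - (b : ℂ) = ((1 - b : ℝ) : ℂ) := by push_cast; ring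
  have e5 : Complex.sin (Real.pi * (1 - (b : ℂ))) = ((Real.sin (Real.pi * b) : ℝ) : ℂ) := by
    rw [mul_sub, mul_one, Complex.sin_pi_sub]
    push_cast; ring
  rw [e1, e2, e3, e5, e4, Complex.Gamma_ofReal, Complex.Gamma_ofReal, Complex.Gamma_ofReal,
    ← Complex.ofReal_neg, Complex.Gamma_ofReal]
  have hsin : Real.sin (Real.pi * b) ≠ 0 := by
    refine (Real.sin_pos_of_pos_of_lt_pi (by positivity) ?_).ne'
    nlinarith [Real.pi_pos]
  -- The two coefficients match those in the definition of `U` by reflection, `Γ(b)Γ(1 - b) = π /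
  -- sin(πb)`, and by `Γ(b + 1) = bΓ(b)`, `Γ(1 - a) = -aΓ(-a)`.
  have hG := Real.Gamma_mul_Gamma_one_sub b
  have g1 := Real.Gamma_add_one hb0.ne'
  have g2 := Real.Gamma_add_one (neg_ne_zero.2 ha.ne')
  rw [show -a + 1 = 1 - a by ring] at g2
  have n1 : Real.Gamma (b - a) ≠ 0 := (Real.Gamma_pos_of_pos (by linarith)).ne'
  have n2 : Real.Gamma (1 - b) ≠ 0 := (Real.Gamma_pos_of_pos (by linarith)).ne'
  have n3 : Real.Gamma b ≠ 0 := (Real.Gamma_pos_of_pos hb0).ne'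
  have n4 : Real.Gamma (1 - a) ≠ 0 := (Real.Gamma_pos_of_pos (by linarith)).ne'
  have n5 : Real.Gamma (-a) ≠ 0 := fun h => n4 (by rw [g2, h, mul_zero])
  have hxb : (x : ℂ) ^ (b : ℂ) = ((x ^ b : ℝ) : ℂ) := by rw [Complex.ofReal_cpow hx.le]
  have hxx : x ^ (-b) * x ^ b = 1 := by rw [← Real.rpow_add hx]; simp
  have c1 : Real.Gamma b * x ^ (-b) = Real.Gamma (b - a) * x ^ (-b) *
      (Real.pi / Real.sin (Real.pi * b)) / (Real.Gamma (1 - b) * Real.Gamma (b - a)) := by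
    rw [← hG]; field_simp
  have c2 : a / b * (Real.Gamma (1 - b) * Real.Gamma (b - a) / Real.Gamma (1 - a)) =
      -(Real.Gamma (b - a) * (x ^ (-b) * x ^ b) * (Real.pi / Real.sin (Real.pi * b)) /
        (Real.Gamma (-a) * Real.Gamma (b + 1))) := by
    rw [← hG, g1, g2, hxx]
    field_simp
  rw [hxb, c1, c2]
  push_cast
  ring

/-- By the two-term expansion the only singularity at `t = 0` is `t^{-b}` with `b < 1`. -/
theorem integrableOn_laplaceInt {a b : ℝ} (ha : 0 ≤ a) (hab : a < b) (hb : b < 1) {c : ℝ}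
    (hc : 0 < c) : IntegrableOn (fun t : ℝ => laplaceInt a b 1 (c * t)) (Ioo 0 1) := by
  set u := hyp1F1 (-(a : ℂ)) ((1 - b : ℝ) : ℂ) with hu
  set m := hyp1F1 ((b - a : ℝ) : ℂ) ((b + 1 : ℝ) : ℂ) with hm
  have hcu : Continuous u := (differentiable_hyp1F1 _ _).continuous
  have hcm : Continuous m := (differentiable_hyp1F1 _ _).continuous
  have h1 : IntegrableOn (fun t : ℝ => ((t ^ (-b) : ℝ) : ℂ)) (Ioo 0 1) := by
    have h := (intervalIntegral.intervalIntegrable_rpow' (a := 0) (b := 1) (r := -b) (by linarith))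
    rw [intervalIntegrable_iff_integrableOn_Ioo_of_le zero_le_one] at h
    exact h.ofReal
  have h2 : IntegrableOn (fun t : ℝ => ((t ^ (-b) : ℝ) : ℂ) *
      (((Real.Gamma b * c ^ (-b) : ℝ) : ℂ) * u (c * t))) (Ioo 0 1) :=
    (((integrableOn_Icc_iff_integrableOn_Ioo).2 h1).mul_continuousOn
      (g' := fun t : ℝ => ((Real.Gamma b * c ^ (-b) : ℝ) : ℂ) * u (c * t)) (by fun_prop)
      isCompact_Icc).mono_set Ioo_subset_Icc_self
  have h3 : IntegrableOn (fun t : ℝ => ((a / b * betaConst a b : ℝ) : ℂ) * m (c * t)) (Ioo 0 1) :=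
    (ContinuousOn.integrableOn_compact (f := fun t : ℝ => ((a / b * betaConst a b : ℝ) : ℂ) * m (c * t))
      isCompact_Icc (by fun_prop)).mono_set Ioo_subset_Icc_self
  refine (h2.add h3).congr_fun (fun t ht => ?_) measurableSet_Ioo
  have ht0 : 0 < t := ht.1
  rw [laplaceInt_eq_kummer ha hab hb (mul_pos hc ht0), Real.mul_rpow hc.le ht0.le]
  simp only [Pi.add_apply, hu, hm]
  push_cast
  ring_nf

/-! ### Separation of the Stieltjes transform from the exponentials. -/

/-- The fundamental theorem of calculus for `e^{-ωt(s+z)/s} / (s + z)` on `[0, 1]`. The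
`t`-derivative cancels the denominator, so the whole singularity at `s = -z` is left in the term
`1/(s + z)`. -/
theorem exp_neg_mul_div_eq_integral (ω z : ℂ) {s : ℝ} (hs : 0 < s) (hz : (s : ℂ) + z ≠ 0) :
    Complex.exp (-ω) * (Complex.exp (-(ω * z) * (s : ℂ)⁻¹) * ((s : ℂ) + z)⁻¹) = ((s : ℂ) + z)⁻¹ -
      ∫ t in Ioo (0 : ℝ) 1, ω * (s : ℂ)⁻¹ *
        (Complex.exp (-(ω * t)) * Complex.exp (-(ω * z * t) * (s : ℂ)⁻¹)) := by
  have h0 : (s : ℂ) ≠ 0 := by exact_mod_cast hs.ne'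
  have hd : ∀ t ∈ uIcc (0 : ℝ) 1, HasDerivAt
      (fun t : ℝ => -(((s : ℂ) + z)⁻¹ * Complex.exp (-(ω * (s + z) * (s : ℂ)⁻¹) * t)))
      (ω * (s : ℂ)⁻¹ * (Complex.exp (-(ω * t)) * Complex.exp (-(ω * z * t) * (s : ℂ)⁻¹))) t := by
    intro t _
    have h1 := ((((hasDerivAt_id' t).ofReal_comp).const_mul
      (-(ω * (s + z) * (s : ℂ)⁻¹))).cexp.const_mul ((s : ℂ) + z)⁻¹).neg
    convert! h1 using 1
    rw [← Complex.exp_add, show -(ω * (t : ℂ)) + -(ω * z * t) * (s : ℂ)⁻¹ =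
      -(ω * (s + z) * (s : ℂ)⁻¹) * t by field_simp; ring]
    push_cast
    field_simp
  have h2 := intervalIntegral.integral_eq_sub_of_hasDerivAt hd
    (Continuous.intervalIntegrable (by fun_prop) _ _)
  rw [← integral_Ioc_eq_integral_Ioo, ← intervalIntegral.integral_of_le zero_le_one, h2, ← mul_assoc,
    ← Complex.exp_add, show -ω + -(ω * z) * (s : ℂ)⁻¹ = -(ω * (s + z) * (s : ℂ)⁻¹) by
      field_simp; ring]
  simp
  ring_nf

/-- Separation of the Stieltjes transform from the Gaussian factor. -/
theorem exp_mul_kernInt_eq {a b κ : ℝ} (ha : 0 ≤ a) (hab : a < b) (hb : b < 1) (hκ : 0 < κ) {z : ℂ}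
    (hz : z ∈ Complex.slitPlane) :
    Complex.exp (-(κ * conj z)) * kernInt a b κ 0 1 z = kernInt a b 0 0 1 z -
      κ * conj z * ∫ t in Ioo (0 : ℝ) 1, Complex.exp (-(κ * conj z * t)) *
        laplaceInt a b 1 (κ * ‖z‖ ^ 2 * t) := by
  set ω : ℂ := κ * conj z with hω
  set c : ℝ := κ * ‖z‖ ^ 2 with hc
  have hz0 := Complex.slitPlane_ne_zero hz
  have hc0 : 0 < c := by have := norm_pos_iff.2 hz0; positivity
  have hωz : ω * z = c := by
    rw [hω, hc, mul_assoc, mul_comm (conj z), Complex.mul_conj, Complex.normSq_eq_norm_sq]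
    push_cast; ring
  set F : ℝ → ℝ → ℂ := fun s t => Complex.exp (-(ω * t)) *
    ((((1 + s) ^ a * s ^ (-b) : ℝ) : ℂ) * (s : ℂ)⁻¹ ^ 1 *
      Complex.exp (-((c * t : ℝ) : ℂ) * (s : ℂ)⁻¹)) with hF
  have hi1 := integrableOn_kern (a := a) hab hb hκ.le hz (p := 0) (n := 1) le_rfl (Or.inr hκ)
  have hi0 := integrableOn_kern (a := a) hab hb le_rfl hz (p := 0) (n := 1) le_rfl (Or.inl rfl)
  have hFm : Measurable (Function.uncurry F) := by
    simp only [hF, Function.uncurry_def]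
    fun_prop
  have hFn : ∀ s t : ℝ, 0 < s → ‖F s t‖ = Real.exp (-(ω.re * t)) *
      ((1 + s) ^ a * s ^ (-b) * s⁻¹ ^ 1 * Real.exp (-(c * t) * s⁻¹)) := by
    intro s t hs
    have h1 : (0 : ℝ) ≤ (1 + s) ^ a * s ^ (-b) := by positivity
    simp only [hF, norm_mul, Complex.norm_exp, norm_pow, norm_inv, Complex.norm_real,
      Real.norm_of_nonneg h1, Real.norm_of_nonneg hs.le]
    congr 2
    · simp
    · rw [← Complex.ofReal_inv, ← Complex.ofReal_neg, ← Complex.ofReal_mul, Complex.ofReal_re]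
  have hFi : ∀ t : ℝ, 0 < t → IntegrableOn (fun s => F s t) (Ioi 0) := fun t ht =>
    (integrableOn_laplace hab hb le_rfl (mul_pos hc0 ht)).const_mul _
  have hFI : ∀ t : ℝ, 0 < t → ∫ s in Ioi (0 : ℝ), F s t =
      Complex.exp (-(ω * t)) * laplaceInt a b 1 (c * t) := by
    intro t ht
    rw [laplaceInt_eq _ _ _ (mul_pos hc0 ht).le, ← integral_const_mul]
  -- For Fubini: apart from the factor in `t`, the integrand is positive, so the `s`-integral of its
  -- norm is again the Laplace type integral, whose integrability in `t` is known.
  have hprod : Integrable (Function.uncurry F)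
      ((volume.restrict (Ioi (0 : ℝ))).prod (volume.restrict (Ioo (0 : ℝ) 1))) := by
    rw [integrable_prod_iff' hFm.aestronglyMeasurable]
    refine ⟨(ae_restrict_iff' measurableSet_Ioo).2 (.of_forall fun t ht => hFi t ht.1), ?_⟩
    have h1 : IntegrableOn (fun t : ℝ => ‖((Real.exp (-(ω.re * t)) : ℝ) : ℂ) *
        laplaceInt a b 1 (c * t)‖) (Ioo 0 1) := by
      refine Integrable.norm ?_
      exact (((integrableOn_Icc_iff_integrableOn_Ioo).2
        (integrableOn_laplaceInt ha hab hb hc0)).continuousOn_mul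
        (g := fun t : ℝ => ((Real.exp (-(ω.re * t)) : ℝ) : ℂ)) (by fun_prop)
        isCompact_Icc).mono_set Ioo_subset_Icc_self
    refine h1.congr_fun (fun t ht => ?_) measurableSet_Ioo
    have e1 : ∫ s in Ioi (0 : ℝ), ‖F s t‖ = Real.exp (-(ω.re * t)) * ∫ s in Ioi (0 : ℝ),
        ((1 + s) ^ a * s ^ (-b) * s⁻¹ ^ 1 * Real.exp (-(c * t) * s⁻¹)) := by
      rw [← integral_const_mul]
      exact setIntegral_congr_fun measurableSet_Ioi fun s hs => hFn s t hs
    have e2 : laplaceInt a b 1 (c * t) = ((∫ s in Ioi (0 : ℝ),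
        ((1 + s) ^ a * s ^ (-b) * s⁻¹ ^ 1 * Real.exp (-(c * t) * s⁻¹)) : ℝ) : ℂ) := by
      rw [laplaceInt_eq _ _ _ (mul_pos hc0 ht.1).le, ← integral_complex_ofReal]
      congr 1
      funext s
      push_cast
      ring
    have e3 : 0 ≤ ∫ s in Ioi (0 : ℝ),
        ((1 + s) ^ a * s ^ (-b) * s⁻¹ ^ 1 * Real.exp (-(c * t) * s⁻¹)) :=
      setIntegral_nonneg measurableSet_Ioi fun s hs => by
        have : (0 : ℝ) < s := hs
        positivity
    simp only [Function.uncurry_apply_pair]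
    rw [e1, e2, norm_mul, Complex.norm_real, Complex.norm_real, Real.norm_of_nonneg e3,
      Real.norm_of_nonneg (Real.exp_pos _).le]
  have hpt : ∀ s ∈ Ioi (0 : ℝ), Complex.exp (-ω) * kern a b κ 0 1 z s =
      kern a b 0 0 1 z s - ω * ∫ t in Ioo (0 : ℝ) 1, F s t := by
    intro s hs
    have hs0 : (0 : ℝ) < s := hs
    have h := exp_neg_mul_div_eq_integral ω z hs0 (ofReal_add_ne_zero hz hs0.le)
    have e1 : ω * ∫ t in Ioo (0 : ℝ) 1, F s t = (((1 + s) ^ a * s ^ (-b) : ℝ) : ℂ) *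
        ∫ t in Ioo (0 : ℝ) 1, ω * (s : ℂ)⁻¹ *
        (Complex.exp (-(ω * t)) * Complex.exp (-(ω * z * t) * (s : ℂ)⁻¹)) := by
      rw [← integral_const_mul, ← integral_const_mul]
      congr 1
      funext t
      simp only [hF, hωz]
      push_cast
      ring
    have e2 : (κ : ℂ) * (z * conj z) = ω * z := by rw [hω]; ring
    rw [e1]
    simp only [kern, e2, pow_one, pow_zero, mul_one]
    simp only [Complex.ofReal_zero, zero_mul, neg_zero, Complex.exp_zero, mul_one]
    linear_combination (((1 + s) ^ a * s ^ (-b) : ℝ) : ℂ) * h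
  have hint2 : Integrable (fun s => ∫ t in Ioo (0 : ℝ) 1, F s t) (volume.restrict (Ioi (0 : ℝ))) :=
    hprod.integral_prod_left
  rw [kernInt, ← integral_const_mul, setIntegral_congr_fun measurableSet_Ioi hpt,
    integral_sub hi0 (hint2.const_mul ω), integral_const_mul, kernInt]
  congr 2
  rw [integral_integral_swap hprod]
  exact setIntegral_congr_fun measurableSet_Ioo fun t ht => hFI t ht.1

/-! ### Dimensionless parameters and the coordinate `z`. -/

namespace Model

/-- The standing assumptions on the parameters. -/
structure Admissible (m : Model) : Prop where
  hμ : 0 < m.μ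
  he : m.e < 0
  hB : 0 < m.B
  hc : 0 < m.c
  hhbar : 0 < m.hbar
  hR : 0 < m.R
  hα : 0 < m.α
  hαβ : m.α < m.β
  hβ : m.β < 1

/-- The inverse square `μ ω_c / ħ` of the magnetic length. -/
noncomputable def k (m : Model) : ℝ := m.μ * m.ωc / m.hbar

/-- `D / 2`. -/
noncomputable def κ (m : Model) : ℝ := m.k * m.R ^ 2 / 2

/-- The common normalization of `ψ₁` and `φ` in the variable `z`. -/
noncomputable def amp (m : Model) : ℝ :=
  √(m.k / (2 * Real.pi * Real.Gamma (1 + m.α))) * (√(m.k / 2) * m.R) ^ m.α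

/-- The Gaussian factor `e^{-k|x|²/4}`. -/
noncomputable def gauss (m : Model) (x : ℂ) : ℂ := Complex.exp (-(m.k / 4 * (x * conj x)))

/-- The coordinate `(R - x) / R`. -/
noncomputable def coord (m : Model) (x : ℂ) : ℂ := 1 + (-m.R⁻¹ : ℝ) * x

variable {m : Model}

namespace Admissible

theorem hβ0 (h : m.Admissible) : 0 < m.β := h.hα.trans h.hαβ

theorem k_eq (h : m.Admissible) : m.k = -(m.e * m.B / (m.hbar * m.c)) := by
  have := h.hμ.ne'; have := h.hc.ne'; have := h.hhbar.ne'
  rw [k, ωc, abs_of_neg h.he]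
  field_simp

theorem k_pos (h : m.Admissible) : 0 < m.k := by
  rw [h.k_eq, ← neg_div, ← neg_mul]
  have := neg_pos.2 h.he; have := h.hB; have := h.hc; have := h.hhbar
  positivity

theorem κ_pos (h : m.Admissible) : 0 < m.κ := by
  have := h.k_pos; have := h.hR
  unfold κ; positivity

theorem D_eq (h : m.Admissible) : m.D = 2 * m.κ := by
  rw [κ, h.k_eq, D, abs_of_neg h.he]
  have := h.hc.ne'; have := h.hhbar.ne'
  field_simp

theorem sin_pos (h : m.Admissible) : 0 < Real.sin (Real.pi * m.β) := by
  refine Real.sin_pos_of_pos_of_lt_pi (mul_pos Real.pi_pos h.hβ0) ?_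
  nlinarith [Real.pi_pos, h.hβ]

theorem amp_pos (h : m.Admissible) : 0 < m.amp := by
  have := h.k_pos; have := h.hR
  have := Real.Gamma_pos_of_pos (show 0 < 1 + m.α by linarith [h.hα])
  have := Real.pi_pos
  unfold amp
  refine mul_pos (Real.sqrt_pos.2 (by positivity)) (Real.rpow_pos_of_pos ?_ _)
  exact mul_pos (Real.sqrt_pos.2 (by positivity)) ‹_›

theorem coord_eq (h : m.Admissible) (x : ℂ) : m.coord x = (m.R - x) / m.R := by
  have : (m.R : ℂ) ≠ 0 := by exact_mod_cast h.hR.ne'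
  rw [coord]; push_cast; field_simp; ring

theorem sub_eq (h : m.Admissible) (x : ℂ) : m.b - x = m.R * m.coord x := by
  have : (m.R : ℂ) ≠ 0 := by exact_mod_cast h.hR.ne'
  rw [h.coord_eq, b]; field_simp

theorem eq_mul (h : m.Admissible) (x : ℂ) : x = m.R * (1 - m.coord x) := by
  have : (m.R : ℂ) ≠ 0 := by exact_mod_cast h.hR.ne'
  rw [h.coord_eq]; field_simp; ring

theorem rb_eq (h : m.Admissible) (x : ℂ) : m.rb x = m.R * ‖m.coord x‖ := by
  rw [rb, h.sub_eq, norm_mul, Complex.norm_real, Real.norm_of_nonneg h.hR.le]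

theorem θb_eq (h : m.Admissible) (x : ℂ) : m.θb x = (m.coord x).arg := by
  rw [θb, h.sub_eq, Complex.arg_real_mul _ h.hR]

theorem z_eq (h : m.Admissible) (x : ℂ) : m.z x = m.coord x := by
  rw [z, h.rb_eq, h.θb_eq, mul_div_cancel_left₀ _ h.hR.ne', mul_comm Complex.I,
    Complex.norm_mul_exp_arg_mul_I]

theorem zbar_eq (h : m.Admissible) (x : ℂ) : m.zbar x = conj (m.coord x) := by
  rw [← h.z_eq, z, zbar, map_mul, Complex.conj_ofReal, ← Complex.exp_conj, map_mul, Complex.conj_I,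
    Complex.conj_ofReal, neg_mul]

theorem coord_re (h : m.Admissible) (x : ℂ) : (m.coord x).re = (m.R - x.re) / m.R := by
  rw [h.coord_eq, Complex.div_ofReal_re]; simp

theorem coord_im (h : m.Admissible) (x : ℂ) : (m.coord x).im = -x.im / m.R := by
  rw [h.coord_eq, Complex.div_ofReal_im]; simp

theorem coord_mem_slitPlane_iff (h : m.Admissible) {x : ℂ} :
    m.coord x ∈ Complex.slitPlane ↔ x.re < m.R ∨ x.im ≠ 0 := by
  rw [Complex.mem_slitPlane_iff, h.coord_re, h.coord_im]
  have := h.hR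
  simp only [ne_eq, div_eq_zero_iff, neg_eq_zero, h.hR.ne', or_false]
  rw [lt_div_iff₀ this, zero_mul, sub_pos]

theorem mem_cutPlane_iff (h : m.Admissible) {x : ℂ} :
    x ∈ m.cutPlane ↔ x ∈ Complex.slitPlane ∧ m.coord x ∈ Complex.slitPlane := by
  rw [h.coord_mem_slitPlane_iff, Complex.mem_slitPlane_iff]
  simp only [cutPlane, La, Lb, a, b, mem_compl_iff, mem_union, mem_ofPred_eq, Complex.zero_re,
    Complex.ofReal_re, not_or, not_and, not_le]
  tauto

theorem one_sub_coord_mem (h : m.Admissible) {x : ℂ} :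
    1 - m.coord x ∈ Complex.slitPlane ↔ x ∈ Complex.slitPlane := by
  rw [show 1 - m.coord x = ((m.R⁻¹ : ℝ) : ℂ) * x by rw [coord]; push_cast; ring]
  have := inv_pos.2 h.hR
  simp only [Complex.mem_slitPlane_iff, Complex.re_ofReal_mul, Complex.im_ofReal_mul, ne_eq,
    mul_eq_zero, h.hR.ne', inv_eq_zero, false_or]
  constructor
  · exact fun H => H.imp (fun H => pos_of_mul_pos_right H this.le) id
  · exact fun H => H.imp (fun H => mul_pos this H) id

end Admissible

end Model

/-! ### The functions `φ` and `ψ₁` in the coordinate `z`. -/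

/-- The substitution `s = r e^{-u}`. -/
theorem integral_comp_mul_exp_neg {r : ℝ} (hr : 0 < r) (f : ℝ → ℂ) :
    ∫ u : ℝ, ((r * Real.exp (-u) : ℝ) : ℂ) * f (r * Real.exp (-u)) = ∫ s in Ioi (0 : ℝ), f s ∧
    (IntegrableOn f (Ioi 0) →
      Integrable fun u : ℝ => ((r * Real.exp (-u) : ℝ) : ℂ) * f (r * Real.exp (-u))) := by
  have himg : (fun u : ℝ => r * Real.exp (-u)) '' univ = Ioi 0 := by
    ext s
    simp only [image_univ, mem_range, mem_Ioi]
    constructor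
    · rintro ⟨u, rfl⟩; positivity
    · intro hs
      refine ⟨-Real.log (s / r), ?_⟩
      rw [neg_neg, Real.exp_log (by positivity)]
      field_simp
  have hd : ∀ u ∈ (univ : Set ℝ), HasDerivWithinAt (fun u : ℝ => r * Real.exp (-u))
      (-(r * Real.exp (-u))) univ u := by
    intro u _
    have h := (((hasDerivAt_neg' u).exp).const_mul r).hasDerivWithinAt (s := univ)
    convert! h using 1
    ring
  have hinj : InjOn (fun u : ℝ => r * Real.exp (-u)) univ := by
    intro u _ v _ huv
    have := Real.exp_injective (mul_left_cancel₀ hr.ne' huv)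
    linarith
  have habs : ∀ u : ℝ, |-(r * Real.exp (-u))| = r * Real.exp (-u) := fun u => by
    rw [abs_neg, abs_of_pos (by positivity)]
  have h1 := integral_image_eq_integral_abs_deriv_smul MeasurableSet.univ hd hinj f
  have h2 := integrableOn_image_iff_integrableOn_abs_deriv_smul MeasurableSet.univ hd hinj f
  simp only [himg, habs, Complex.real_smul, Measure.restrict_univ, integrableOn_univ] at h1 h2
  exact ⟨h1.symm, h2.1⟩

namespace Model.Admissible

variable {m : Model}

/-- With `s = |z|e^{-u}` one has `e^{u+iθ} = z/s`, so `e^{β(u+iθ)} = z^β s^{-β}` and `1/(1 +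
e^{u+iθ}) = s/(s + z)`. The spare factor `s` is the Jacobian. -/
theorem φIntegrand_eq (h : m.Admissible) {x : ℂ} (hx : m.coord x ∈ Complex.slitPlane) (u : ℝ) :
    m.φIntegrand x u = (((√(m.k / 2) * m.R) ^ m.α : ℝ) : ℂ) * m.coord x ^ (m.β : ℂ) *
      (((‖m.coord x‖ * Real.exp (-u) : ℝ) : ℂ) *
        kern m.α m.β m.κ 0 1 (m.coord x) (‖m.coord x‖ * Real.exp (-u))) := by
  have hz0 := Complex.slitPlane_ne_zero hx
  have hk := h.k_pos
  have hR := h.hR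
  rw [φIntegrand, h.rb_eq, h.θb_eq]
  have hk2 : m.μ * m.ωc / (2 * m.hbar) = m.k / 2 := by rw [k]; ring
  have hk3 : m.μ * m.ωc * m.R * (m.R * ‖m.coord x‖) / (2 * m.hbar) = m.κ * ‖m.coord x‖ := by
    rw [κ, k]; ring
  rw [hk2, hk3]
  generalize hz : m.coord x = z at *
  have hr : 0 < ‖z‖ := norm_pos_iff.2 hz0
  set s : ℝ := ‖z‖ * Real.exp (-u) with hs
  have hs0 : 0 < s := by positivity
  have hsu : Real.exp u = ‖z‖ / s := by
    rw [hs, Real.exp_neg]; field_simp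
  have hne := ofReal_add_ne_zero hx hs0.le
  have hsC : (s : ℂ) ≠ 0 := by exact_mod_cast hs0.ne'
  have e1 : Complex.exp ((u : ℂ) + Complex.I * (z.arg : ℂ)) = z / s := by
    rw [Complex.exp_add, ← Complex.ofReal_exp, hsu, mul_comm Complex.I]
    have := Complex.norm_mul_exp_arg_mul_I z
    push_cast
    rw [div_mul_eq_mul_div, this]
  have e2 : Complex.exp ((m.β : ℂ) * ((u : ℂ) + Complex.I * (z.arg : ℂ))) =
      z ^ (m.β : ℂ) * ((s ^ (-m.β) : ℝ) : ℂ) := by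
    rw [Complex.cpow_def_of_ne_zero hz0, Real.rpow_def_of_pos hs0, Complex.ofReal_exp,
      ← Complex.exp_add, Complex.log, hs, Real.log_mul hr.ne' (Real.exp_pos _).ne', Real.log_exp]
    congr 1
    push_cast
    ring
  have e3 : √(m.k / 2) * (m.R + m.R * ‖z‖ * Real.exp (-u)) = √(m.k / 2) * m.R * (1 + s) := by
    rw [hs]; ring
  have e4 : ((Real.exp (-(m.κ * ‖z‖) * Real.exp u) : ℝ) : ℂ) =
      Complex.exp (-(m.κ * (z * conj z)) * (s : ℂ)⁻¹) := by
    rw [hsu, Complex.mul_conj, Complex.normSq_eq_norm_sq]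
    push_cast
    congr 1
    field_simp
  rw [e1, e2, e3, e4, Real.mul_rpow (by positivity) (by positivity)]
  simp only [kern, pow_zero, pow_one, mul_one]
  push_cast
  field_simp

theorem integrable_φIntegrand (h : m.Admissible) {x : ℂ} (hx : m.coord x ∈ Complex.slitPlane) :
    Integrable (m.φIntegrand x) := by
  have h1 := (integral_comp_mul_exp_neg (norm_pos_iff.2 (Complex.slitPlane_ne_zero hx))
    (kern m.α m.β m.κ 0 1 (m.coord x))).2
    (integrableOn_kern h.hαβ h.hβ h.κ_pos.le hx le_rfl (Or.inr h.κ_pos))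
  exact (h1.const_mul (((√(m.k / 2) * m.R) ^ m.α : ℝ) * m.coord x ^ (m.β : ℂ))).congr
    (.of_forall fun u => (h.φIntegrand_eq hx u).symm)

theorem integral_φIntegrand (h : m.Admissible) {x : ℂ} (hx : m.coord x ∈ Complex.slitPlane) :
    ∫ u, m.φIntegrand x u = (((√(m.k / 2) * m.R) ^ m.α : ℝ) : ℂ) * m.coord x ^ (m.β : ℂ) *
      kernInt m.α m.β m.κ 0 1 (m.coord x) := by
  rw [kernInt, ← (integral_comp_mul_exp_neg (norm_pos_iff.2 (Complex.slitPlane_ne_zero hx))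
    (kern m.α m.β m.κ 0 1 (m.coord x))).1, ← integral_const_mul]
  exact integral_congr_ae (.of_forall fun u => h.φIntegrand_eq hx u)

theorem norm_sq_coord (h : m.Admissible) (x : ℂ) :
    m.R ^ 2 * (m.coord x * conj (m.coord x)) = (m.R - x) * (m.R - conj x) := by
  have : (m.R : ℂ) ≠ 0 := by exact_mod_cast h.hR.ne'
  rw [h.coord_eq]
  simp only [map_div₀, map_sub, Complex.conj_ofReal]
  field_simp

/-- The correction `φ` through the kernel integral. -/
theorem φ_eq (h : m.Admissible) {x : ℂ} (hx : m.coord x ∈ Complex.slitPlane) :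
    m.φ x = ((-(m.amp * (Real.sin (Real.pi * m.β) / Real.pi)) : ℝ) : ℂ) *
      (m.gauss x * corr m.α m.β m.κ (m.coord x)) := by
  have hR0 : (m.R : ℂ) ≠ 0 := by exact_mod_cast h.hR.ne'
  rw [φ, h.integral_φIntegrand hx, corr, gauss, amp]
  have e1 : m.μ * m.ωc / (2 * Real.pi * Real.Gamma (1 + m.α) * m.hbar) =
      m.k / (2 * Real.pi * Real.Gamma (1 + m.α)) := by rw [k]; ring
  have e2 : m.μ * m.ωc / (4 * m.hbar) = m.k / 4 := by rw [k]; ring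
  have e3 : m.μ * m.ωc / (2 * m.hbar) = m.k / 2 := by rw [k]; ring
  -- The magnetic phase completes the Gaussian: `-(k/4)(R² + r_b²) + i(k/2) x ∧ b = -(k/4)|x|² -
  -- κz̄`.
  have e4 : Complex.exp (((-(m.k / 4) * (m.R ^ 2 + m.rb x ^ 2) : ℝ) : ℂ) +
      Complex.I * ((m.k / 2 * wedge x m.b : ℝ) : ℂ)) =
      Complex.exp (-(m.k / 4 * (x * conj x))) * Complex.exp (-(m.κ * conj (m.coord x))) := by
    rw [← Complex.exp_add]
    congr 1
    have h1 : ((m.rb x : ℝ) : ℂ) ^ 2 = (m.R - x) * (m.R - conj x) := by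
      rw [← h.norm_sq_coord, h.rb_eq, Complex.mul_conj, Complex.normSq_eq_norm_sq]
      push_cast; ring
    have h2 : ((wedge x m.b : ℝ) : ℂ) = -(m.R * x.im) := by
      simp [wedge, b, mul_comm]
    have h3 : (m.κ : ℂ) * conj (m.coord x) = m.k / 2 * m.R * (m.R - conj x) := by
      rw [h.coord_eq, κ]
      simp only [map_div₀, map_sub, Complex.conj_ofReal]
      push_cast
      field_simp
    have h4 : x - conj x = 2 * x.im * Complex.I := by rw [Complex.sub_conj]; push_cast; ring
    push_cast
    rw [h1, h2, h3]
    linear_combination (m.k / 4 * m.R : ℂ) * h4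
  rw [e1, e2, e3, e4]
  push_cast
  ring

/-- The one-solenoid eigenfunction in the coordinate of the other solenoid. -/
theorem ψ₁_eq (h : m.Admissible) {x : ℂ} (hx : x ≠ 0) :
    m.ψ₁ x = (m.amp : ℂ) * (m.gauss x * (1 - m.coord x) ^ (m.α : ℂ)) := by
  have hR := h.hR
  have hk := h.k_pos
  have hr : 0 < ‖x‖ := norm_pos_iff.2 hx
  have e1 : m.μ * m.ωc / (2 * Real.pi * Real.Gamma (1 + m.α) * m.hbar) =
      m.k / (2 * Real.pi * Real.Gamma (1 + m.α)) := by rw [k]; ring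
  have e2 : m.μ * m.ωc / (4 * m.hbar) = m.k / 4 := by rw [k]; ring
  have e3 : m.μ * m.ωc / (2 * m.hbar) = m.k / 2 := by rw [k]; ring
  have e4 : 1 - m.coord x = ((m.R⁻¹ : ℝ) : ℂ) * x := by rw [coord]; push_cast; ring
  have e5 : (((√(m.k / 2) * ‖x‖) ^ m.α : ℝ) : ℂ) * Complex.exp (Complex.I * ((m.α * x.arg : ℝ) : ℂ)) =
      (((√(m.k / 2) * m.R) ^ m.α : ℝ) : ℂ) * (((m.R⁻¹ : ℝ) : ℂ) * x) ^ (m.α : ℂ) := by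
    have h1 : √(m.k / 2) * ‖x‖ = √(m.k / 2) * m.R * (m.R⁻¹ * ‖x‖) := by field_simp
    have h2 : ((m.R⁻¹ : ℝ) : ℂ) * x ≠ 0 := mul_ne_zero (by exact_mod_cast (inv_pos.2 hR).ne') hx
    rw [h1, Real.mul_rpow (by positivity) (by positivity), Complex.cpow_def_of_ne_zero h2,
      Complex.log, norm_mul, Complex.norm_real, Real.norm_of_nonneg (inv_pos.2 hR).le,
      Complex.arg_real_mul _ (inv_pos.2 hR), Complex.ofReal_mul, mul_assoc]
    congr 1
    rw [Real.rpow_def_of_pos (by positivity), Complex.ofReal_exp, ← Complex.exp_add]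
    congr 1
    push_cast
    ring
  rw [ψ₁, e1, e2, e3, ← Real.sqrt_eq_rpow, amp, gauss, e4]
  simp only [ra, θa, a, sub_zero, mul_assoc, e5]
  have e6 : ((-(m.k / 4) * ‖x‖ ^ 2 : ℝ) : ℂ) + Complex.I * ((m.k / 2 * wedge x 0 : ℝ) : ℂ) =
      -(m.k / 4 * (x * conj x)) := by
    rw [Complex.mul_conj, Complex.normSq_eq_norm_sq, wedge]
    push_cast; simp
  rw [← neg_mul, e6]
  push_cast
  ring_nf

end Model.Admissible

/-! ### The hypergeometric form of `φ`. -/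

namespace Model.Admissible

variable {m : Model}

/-- The Beta constant is a quotient of Gamma values; reflection at `β` removes the sine, and the
functional equation at `-α` produces the sign. -/
theorem hypergeometric_coeff (h : m.Admissible) :
    Real.sin (Real.pi * m.β) / Real.pi * (m.α / m.β * betaConst m.α m.β) =
      -(Real.Gamma (m.β - m.α) / (Real.Gamma (-m.α) * Real.Gamma (m.β + 1))) := by
  have hb0 := h.hβ0
  have ha := h.hα
  have hab := h.hαβ
  have hb := h.hβ
  have hsin := h.sin_pos.ne'
  have hG := Real.Gamma_mul_Gamma_one_sub m.β
  have g1 := Real.Gamma_add_one hb0.ne'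
  have g2 := Real.Gamma_add_one (neg_ne_zero.2 ha.ne')
  rw [show -m.α + 1 = 1 - m.α by ring] at g2
  have n2 : Real.Gamma (1 - m.β) ≠ 0 := (Real.Gamma_pos_of_pos (by linarith)).ne'
  have n3 : Real.Gamma m.β ≠ 0 := (Real.Gamma_pos_of_pos hb0).ne'
  have n4 : Real.Gamma (1 - m.α) ≠ 0 := (Real.Gamma_pos_of_pos (by linarith)).ne'
  have n5 : Real.Gamma (-m.α) ≠ 0 := fun h => n4 (by rw [g2, h, mul_zero])
  have hpi := Real.pi_ne_zero
  have hs : Real.sin (Real.pi * m.β) = Real.pi / (Real.Gamma m.β * Real.Gamma (1 - m.β)) := by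
    rw [hG]; field_simp
  rw [betaConst_eq hab hb, hs, g1, g2]
  field_simp

/-- Principal branches agree here because `log z̄` is the conjugate of `log z` off the cut, so that
`log z + log z̄ = 2 log |z|`. -/
theorem cpow_mul_rpow_norm (β κ : ℝ) (hκ : 0 < κ) {z : ℂ} (hz : z ∈ Complex.slitPlane) :
    z ^ (β : ℂ) * (((κ * ‖z‖ ^ 2) ^ (-β) : ℝ) : ℂ) = (κ * conj z) ^ (-(β : ℂ)) := by
  have hz0 := Complex.slitPlane_ne_zero hz
  have hr : 0 < ‖z‖ := norm_pos_iff.2 hz0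
  have hk0 : (κ : ℂ) ≠ 0 := by exact_mod_cast hκ.ne'
  have hc0 : conj z ≠ 0 := by simpa using hz0
  rw [Complex.cpow_def_of_ne_zero hz0, Real.rpow_def_of_pos (by positivity),
    Complex.cpow_def_of_ne_zero (mul_ne_zero hk0 hc0), Complex.ofReal_exp, ← Complex.exp_add,
    Complex.log_ofReal_mul hκ hc0, Complex.log_conj _ (Complex.mem_slitPlane_iff_arg.1 hz).1,
    Real.log_mul hκ.ne' (by positivity), Real.log_pow]
  congr 1
  have h2 : Complex.log z + conj (Complex.log z) = 2 * (Real.log ‖z‖ : ℂ) := by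
    rw [Complex.add_conj, Complex.log_re]; push_cast; ring
  push_cast
  linear_combination (β : ℂ) * h2

theorem laplaceInt_eq_φHypIntegrand (h : m.Admissible) {x : ℂ} (hx : m.coord x ∈ Complex.slitPlane)
    {t : ℝ} (ht : 0 < t) :
    Complex.exp (-(m.κ * conj (m.coord x) * t)) *
        laplaceInt m.α m.β 1 (m.κ * ‖m.coord x‖ ^ 2 * t) =
      ((Real.Gamma (m.β - m.α) * (m.κ * ‖m.coord x‖ ^ 2) ^ (-m.β) : ℝ) : ℂ) *
        m.φHypIntegrand x t := by
  have hr : 0 < ‖m.coord x‖ := norm_pos_iff.2 (Complex.slitPlane_ne_zero hx)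
  have hκ := h.κ_pos
  rw [laplaceInt_eq_hypU h.hα h.hαβ h.hβ (by positivity), φHypIntegrand, h.D_eq, h.z_eq, h.zbar_eq,
    Real.mul_rpow (by positivity) ht.le]
  have e1 : ((2 * m.κ : ℝ) : ℂ) * m.coord x * conj (m.coord x) * t / 2 =
      ((m.κ * ‖m.coord x‖ ^ 2 * t : ℝ) : ℂ) := by
    rw [mul_assoc ((2 * m.κ : ℝ) : ℂ), Complex.mul_conj, Complex.normSq_eq_norm_sq]
    push_cast; ring
  have e2 : ((2 * m.κ : ℝ) : ℂ) * conj (m.coord x) * t / 2 = m.κ * conj (m.coord x) * t := by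
    push_cast; ring
  rw [e1, e2]
  push_cast
  ring

theorem intervalIntegrable_φHypIntegrand (h : m.Admissible) {x : ℂ}
    (hx : m.coord x ∈ Complex.slitPlane) :
    IntervalIntegrable (m.φHypIntegrand x) volume 0 1 := by
  have hr : 0 < ‖m.coord x‖ := norm_pos_iff.2 (Complex.slitPlane_ne_zero hx)
  have hκ := h.κ_pos
  rw [intervalIntegrable_iff_integrableOn_Ioo_of_le zero_le_one]
  have h0 : 0 < Real.Gamma (m.β - m.α) * (m.κ * ‖m.coord x‖ ^ 2) ^ (-m.β) :=
    mul_pos (Real.Gamma_pos_of_pos (sub_pos.2 h.hαβ)) (by positivity)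
  have h1 : IntegrableOn (fun t : ℝ => Complex.exp (-(m.κ * conj (m.coord x) * t)) *
        laplaceInt m.α m.β 1 (m.κ * ‖m.coord x‖ ^ 2 * t)) (Ioo 0 1) :=
    (((integrableOn_Icc_iff_integrableOn_Ioo).2 (integrableOn_laplaceInt h.hα.le h.hαβ h.hβ
      (by positivity))).continuousOn_mul
      (g := fun t : ℝ => Complex.exp (-(m.κ * conj (m.coord x) * t))) (by fun_prop)
      isCompact_Icc).mono_set Ioo_subset_Icc_self
  refine IntegrableOn.congr_fun (h1.const_mul
    (((Real.Gamma (m.β - m.α) * (m.κ * ‖m.coord x‖ ^ 2) ^ (-m.β) : ℝ) : ℂ)⁻¹)) (fun t ht => ?_) measurableSet_Ioo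
  rw [h.laplaceInt_eq_φHypIntegrand hx ht.1, inv_mul_cancel_left₀]
  exact_mod_cast h0.ne'

/-- The decomposition behind both the hypergeometric formula and the boundary conditions: the term
without `z^β` is exactly `(1 - z)^α`, which cancels `ψ₁`, and the bracket multiplying `z^β` is not
singular on the negative axis. -/
theorem corr_eq_incBeta (h : m.Admissible) {z : ℂ} (hz : z ∈ Complex.slitPlane)
    (hz1 : 1 - z ∈ Complex.slitPlane) :
    ((Real.sin (Real.pi * m.β) / Real.pi : ℝ) : ℂ) * corr m.α m.β m.κ z =
      (1 - z) ^ (m.α : ℂ) + ((Real.sin (Real.pi * m.β) / Real.pi : ℝ) : ℂ) * z ^ (m.β : ℂ) *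
        (m.α * betaConst m.α m.β * ((1 - z) ^ (m.α : ℂ) * incBeta m.α m.β z) -
          m.κ * conj z * ∫ t in Ioo (0 : ℝ) 1, Complex.exp (-(m.κ * conj z * t)) *
            laplaceInt m.α m.β 1 (m.κ * ‖z‖ ^ 2 * t)) := by
  have h1 := exp_mul_kernInt_eq h.hα.le h.hαβ h.hβ h.κ_pos hz
  have h2 := stieltjes_eq h.hα.le h.hαβ h.hβ hz hz1
  have h3 : ((Real.sin (Real.pi * m.β) / Real.pi : ℝ) : ℂ) *
      ((Real.pi / Real.sin (Real.pi * m.β) : ℝ) : ℂ) = 1 := by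
    rw [← Complex.ofReal_mul]
    have := h.sin_pos.ne'
    have := Real.pi_ne_zero
    norm_cast
    field_simp
  rw [corr, mul_assoc (z ^ (m.β : ℂ)), h1]
  linear_combination ((Real.sin (Real.pi * m.β) / Real.pi : ℝ) : ℂ) * h2 +
    (1 - z) ^ (m.α : ℂ) * h3

theorem gauss_eq (h : m.Admissible) (x : ℂ) :
    m.gauss x = ((Real.exp (-(m.k / 4) * (m.R ^ 2 + m.rb x ^ 2) +
      m.k / 2 * m.R * m.rb x * Real.cos (m.θb x)) : ℝ) : ℂ) := by
  rw [gauss, Complex.ofReal_exp]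
  congr 1
  have hR0 := h.hR.ne'
  have h1 : m.rb x * Real.cos (m.θb x) = m.R - x.re := by
    have := Complex.norm_mul_cos_arg (m.b - x)
    rw [rb, θb, this]; simp [b]
  have h2 : m.rb x ^ 2 = (m.R - x.re) ^ 2 + x.im ^ 2 := by
    rw [rb, ← Complex.normSq_eq_norm_sq, Complex.normSq_apply]; simp [b]; ring
  have h3 : -(m.k / 4) * (m.R ^ 2 + m.rb x ^ 2) + m.k / 2 * m.R * m.rb x * Real.cos (m.θb x) =
      -(m.k / 4 * Complex.normSq x) := by
    rw [h2, Complex.normSq_apply]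
    linear_combination m.k / 2 * m.R * h1
  rw [h3, Complex.mul_conj]
  push_cast
  ring

/-- The hypergeometric form of the correction. -/
theorem φ_eq_φHyp (h : m.Admissible) {x : ℂ} (hx : m.coord x ∈ Complex.slitPlane)
    (hr : m.rb x < m.R) : m.φ x = m.φHyp x := by
  have hz : ‖m.coord x‖ < 1 := by
    rw [h.rb_eq] at hr
    exact (mul_lt_iff_lt_one_right h.hR).1 hr
  have hz1 : 1 - m.coord x ∈ Complex.slitPlane := by
    left
    have := (Complex.re_le_norm (m.coord x)).trans_lt hz
    simpa using this
  have hb0 : (m.β : ℂ) ≠ 0 := by exact_mod_cast h.hβ0.ne'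
  have h1 := h.corr_eq_incBeta hx hz1
  have h2 := incBeta_eq_hypergeometric h.hα.le h.hαβ hz
  have hn : 0 < ‖m.coord x‖ := norm_pos_iff.2 (Complex.slitPlane_ne_zero hx)
  have hk := h.k_pos
  have hκ := h.κ_pos
  have hR := h.hR
  have h3 : ∫ t in Ioo (0 : ℝ) 1, Complex.exp (-(m.κ * conj (m.coord x) * t)) *
        laplaceInt m.α m.β 1 (m.κ * ‖m.coord x‖ ^ 2 * t) =
      ((Real.Gamma (m.β - m.α) * (m.κ * ‖m.coord x‖ ^ 2) ^ (-m.β) : ℝ) : ℂ) *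
        ∫ t in (0 : ℝ)..1, m.φHypIntegrand x t := by
    rw [intervalIntegral.integral_of_le zero_le_one, integral_Ioc_eq_integral_Ioo,
      ← integral_const_mul]
    exact setIntegral_congr_fun measurableSet_Ioo fun t ht => h.laplaceInt_eq_φHypIntegrand hx ht.1
  have hω : (m.κ : ℂ) * conj (m.coord x) ≠ 0 := by
    have : conj (m.coord x) ≠ 0 := by simpa using Complex.slitPlane_ne_zero hx
    exact mul_ne_zero (by exact_mod_cast hκ.ne') this
  have h4 := cpow_mul_rpow_norm m.β m.κ hκ hx
  have h5 : (m.κ * conj (m.coord x)) ^ (1 - (m.β : ℂ)) =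
      m.κ * conj (m.coord x) * (m.κ * conj (m.coord x)) ^ (-(m.β : ℂ)) := by
    rw [sub_eq_add_neg, Complex.cpow_add _ _ hω, Complex.cpow_one]
  have h6 := congrArg (fun r : ℝ => (r : ℂ)) h.hypergeometric_coeff
  have e1 : m.μ * m.ωc / (2 * Real.pi * Real.Gamma (m.α + 1) * m.hbar) =
      m.k / (2 * Real.pi * Real.Gamma (1 + m.α)) := by rw [k, add_comm]; ring
  have e2 : m.μ * m.ωc / (4 * m.hbar) = m.k / 4 := by rw [k]; ring
  have e3 : m.μ * m.ωc / (2 * m.hbar) = m.k / 2 := by rw [k]; ring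
  have e4 : m.μ * m.ωc * m.R * m.rb x / (2 * m.hbar) = m.k / 2 * m.R * m.rb x := by rw [k]; ring
  have e5 : (m.D : ℂ) * m.zbar x / 2 = m.κ * conj (m.coord x) := by
    rw [h.D_eq, h.zbar_eq]; push_cast; ring
  rw [h.φ_eq hx, φHyp, e1, e2, e3, e4, e5, h.z_eq, h5, h.gauss_eq x, amp]
  generalize ∫ t in (0 : ℝ)..1, m.φHypIntegrand x t = J at *
  rw [h3] at h1
  have hF : (m.β : ℂ) * (1 - m.coord x) ^ (m.α : ℂ) * incBeta m.α m.β (m.coord x) =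
    ordinaryHypergeometric (1 : ℂ) ((m.β : ℂ) - (m.α : ℂ)) ((m.β : ℂ) + 1) (m.coord x) := by
    linear_combination h2
  generalize ordinaryHypergeometric (1 : ℂ) ((m.β : ℂ) - (m.α : ℂ)) ((m.β : ℂ) + 1) (m.coord x) = F
    at *
  set E := Real.exp (-(m.k / 4) * (m.R ^ 2 + m.rb x ^ 2) +
      m.k / 2 * m.R * m.rb x * Real.cos (m.θb x))
  set P := √(m.k / (2 * Real.pi * Real.Gamma (1 + m.α)))
  set Q := (√(m.k / 2) * m.R) ^ m.α
  have key : ((Real.sin (Real.pi * m.β) / Real.pi : ℝ) : ℂ) * corr m.α m.β m.κ (m.coord x) =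
      ((1 - m.coord x) ^ (m.α : ℂ) -
      ((Real.Gamma (m.β - m.α) / (Real.Gamma (-m.α) * Real.Gamma (m.β + 1)) : ℝ) : ℂ) *
        F * m.coord x ^ (m.β : ℂ) -
      ((Real.sin (Real.pi * m.β) * Real.Gamma (m.β - m.α) / Real.pi : ℝ) : ℂ) *
        (m.κ * conj (m.coord x) * (m.κ * conj (m.coord x)) ^ (-(m.β : ℂ))) * J) := by
    rw [h1, ← h4, ← hF]
    push_cast at h6 ⊢
    have h7 : (m.α : ℂ) / m.β * m.β = m.α := by field_simp
    linear_combination (m.coord x ^ (m.β : ℂ) * m.β * (1 - m.coord x) ^ (m.α : ℂ) *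
      incBeta m.α m.β (m.coord x)) * h6 - (Complex.sin (Real.pi * m.β) / Real.pi *
      betaConst m.α m.β * m.coord x ^ (m.β : ℂ) * (1 - m.coord x) ^ (m.α : ℂ) *
      incBeta m.α m.β (m.coord x)) * h7
  rw [← key]
  push_cast
  ring

end Model.Admissible

/-! ### Integration by parts and the maximal operator. -/

theorem HasWirtingerAt.fderiv_one {f : ℂ → ℂ} {a b z : ℂ} (h : HasWirtingerAt f a b z) :
    fderiv ℝ f z 1 = a + b := by
  rw [h.hasFDerivAt.fderiv, wirtinger_apply]; simp

theorem HasWirtingerAt.fderiv_I {f : ℂ → ℂ} {a b z : ℂ} (h : HasWirtingerAt f a b z) :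
    fderiv ℝ f z Complex.I = Complex.I * (a - b) := by
  rw [h.hasFDerivAt.fderiv, wirtinger_apply, Complex.conj_I]; ring

theorem exists_hasWirtingerAt {f : ℂ → ℂ} {z : ℂ} (h : DifferentiableAt ℝ f z) :
    ∃ a b, HasWirtingerAt f a b z := by
  set L := fderiv ℝ f z with hL
  refine ⟨(L 1 - Complex.I * L Complex.I) / 2, (L 1 + Complex.I * L Complex.I) / 2, ?_⟩
  have h1 := h.hasFDerivAt
  unfold HasWirtingerAt
  convert! h1 using 1
  ext v
  rw [wirtinger_apply, ← hL]
  have h2 : L v = v.re * L 1 + v.im * L Complex.I := by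
    conv_lhs => rw [← Complex.re_add_im v]
    have e : (v.re : ℂ) + v.im * Complex.I = v.re • (1 : ℂ) + v.im • Complex.I := by
      simp
    rw [e, map_add, map_smul, map_smul]; simp
  rw [h2]
  apply Complex.ext <;> simp <;> ring

/-- The mixed second Wirtinger derivatives agree. -/
theorem wirtinger_symmetric {f f₁ f₂ : ℂ → ℂ} {a b c d z : ℂ}
    (h : ∀ᶠ w in 𝓝 z, HasWirtingerAt f (f₁ w) (f₂ w) w) (h₁ : HasWirtingerAt f₁ a b z)
    (h₂ : HasWirtingerAt f₂ c d z) : b = c := by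
  have h3 := (h₁.hasFDerivAt.smul_const (ContinuousLinearMap.id ℝ ℂ)).add
    (h₂.hasFDerivAt.smul_const (Complex.conjCLE : ℂ →L[ℝ] ℂ))
  have h4 := second_derivative_symmetric_of_eventually (f := f)
    (f' := fun w => wirtinger (f₁ w) (f₂ w)) (h.mono fun w hw => hw.hasFDerivAt) h3 1 Complex.I
  simp [wirtinger_apply] at h4
  have h5 : 2 * Complex.I * (b - c) = 0 := by linear_combination h4
  have h6 : (2 : ℂ) * Complex.I ≠ 0 := by simp
  exact sub_eq_zero.1 ((mul_eq_zero.1 h5).resolve_left h6)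

theorem integrable_mul_of_tsupport_subset {f g : ℂ → ℂ} {U : Set ℂ} (hU : IsOpen U)
    (hf : ContinuousOn f U) (hg : Continuous g) (hgc : HasCompactSupport g) (hgU : tsupport g ⊆ U) :
    Integrable (fun x => f x * g x) := by
  have h1 : tsupport (fun x => f x * g x) ⊆ tsupport g :=
    closure_mono (Function.support_mul_subset_right f g)
  refine Continuous.integrable_of_hasCompactSupport ?_ hgc.mul_left
  exact (hf.mul hg.continuousOn).continuous_of_tsupport_subset hU (h1.trans hgU)

/-- Integration by parts for a covariant derivative. -/
theorem integral_conj_mul_covariant {f g : ℂ → ℂ} {U : Set ℂ} (hU : IsOpen U) {v : ℂ} {A : ℂ → ℝ}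
    (hA : Continuous A) (hf : ContDiffOn ℝ 1 f U) (hg : ContDiff ℝ 1 g) (hgc : HasCompactSupport g)
    (hgU : tsupport g ⊆ U) :
    ∫ x, conj (f x) * (fderiv ℝ g x v + Complex.I * A x * g x) =
      -∫ x, conj (fderiv ℝ f x v + Complex.I * A x * f x) * g x := by
  have hcj : Continuous (fun w : ℂ => conj w) := Complex.continuous_conj
  have hfd : ∀ x ∈ U, HasFDerivAt (fun w => conj (f w))
      ((Complex.conjCLE : ℂ →L[ℝ] ℂ).comp (fderiv ℝ f x)) x := fun x hx =>
    (Complex.conjCLE : ℂ →L[ℝ] ℂ).hasFDerivAt.comp x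
      ((hf.differentiableOn one_ne_zero).differentiableAt (hU.mem_nhds hx)).hasFDerivAt
  have hfv : ContinuousOn (fun x => fderiv ℝ f x v) U :=
    (hf.continuousOn_fderiv_of_isOpen hU le_rfl).clm_apply continuousOn_const
  have hgd : Continuous (fun x => fderiv ℝ g x v) :=
    (hg.continuous_fderiv one_ne_zero).clm_apply continuous_const
  have hgs : tsupport (fun x => fderiv ℝ g x v) ⊆ U :=
    (tsupport_fderiv_apply_subset ℝ v).trans hgU
  have hAc : Continuous (fun x => Complex.I * (A x : ℂ)) :=
    continuous_const.mul (Complex.continuous_ofReal.comp hA)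
  have i1 := integrable_mul_of_tsupport_subset (f := fun x => conj (fderiv ℝ f x v)) hU
    (hcj.comp_continuousOn hfv) hg.continuous hgc hgU
  have i2 := integrable_mul_of_tsupport_subset (f := fun x => conj (f x)) hU
    (hcj.comp_continuousOn hf.continuousOn) hgd
    (hgc.fderiv_apply (𝕜 := ℝ) v) hgs
  have i3 := integrable_mul_of_tsupport_subset (f := fun x => conj (f x)) hU
    (hcj.comp_continuousOn hf.continuousOn)
    hg.continuous hgc hgU
  have i4 := integrable_mul_of_tsupport_subset (f := fun x => Complex.I * A x * conj (f x)) hU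
    (hAc.continuousOn.mul
    (hcj.comp_continuousOn hf.continuousOn)) hg.continuous hgc hgU
  -- Outside `U` nothing is known about the derivative of `f`, but there `g` vanishes.
  have e0 : ∀ x, fderiv ℝ (fun w => conj (f w)) x v * g x = conj (fderiv ℝ f x v) * g x := by
    intro x
    by_cases hx : x ∈ U
    · rw [(hfd x hx).fderiv]; simp
    · rw [image_eq_zero_of_notMem_tsupport fun h => hx (hgU h), mul_zero, mul_zero]
  have key := integral_mul_fderiv_eq_neg_fderiv_mul_of_integrable (μ := volume)
    (f := fun w => conj (f w)) (g := g) (v := v) (i1.congr (.of_forall fun x => (e0 x).symm)) i2 i3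
    (fun x hx => (hfd x (hgU hx)).differentiableAt)
    (fun x _ => hg.differentiable one_ne_zero x)
  simp only [e0] at key
  have l1 : ∫ x, conj (f x) * (fderiv ℝ g x v + Complex.I * A x * g x) =
      (∫ x, conj (f x) * fderiv ℝ g x v) + ∫ x, (Complex.I * A x * conj (f x)) * g x := by
    rw [← integral_add i2 i4]
    congr 1; funext x; ring
  have l2 : ∫ x, conj (fderiv ℝ f x v + Complex.I * A x * f x) * g x =
      (∫ x, conj (fderiv ℝ f x v) * g x) - ∫ x, (Complex.I * A x * conj (f x)) * g x := by
    rw [← integral_sub i1 i4]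
    congr 1; funext x
    simp only [map_add, map_mul, Complex.conj_I, Complex.conj_ofReal]
    ring
  rw [l1, l2, key]
  ring

namespace Model

variable {m : Model}

theorem cov₁_contDiffOn {f : ℂ → ℂ} {n : ℕ} {U : Set ℂ} (hU : IsOpen U)
    (hf : ContDiffOn ℝ (n + 1) f U) : ContDiffOn ℝ n (m.cov₁ f) U := by
  have h1 : ContDiffOn ℝ n (fun x => fderiv ℝ f x 1) U :=
    (hf.fderiv_of_isOpen hU le_rfl).clm_apply contDiffOn_const
  have h2 : ContDiff ℝ n (fun x : ℂ => ((m.e * m.B / (2 * m.hbar * m.c) * x.im : ℝ) : ℂ)) :=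
    Complex.ofRealCLM.contDiff.comp (contDiff_const.mul Complex.imCLM.contDiff)
  exact h1.add ((contDiffOn_const.mul h2.contDiffOn).mul
    (hf.of_le (by exact_mod_cast Nat.le_succ n)))

theorem cov₂_contDiffOn {f : ℂ → ℂ} {n : ℕ} {U : Set ℂ} (hU : IsOpen U)
    (hf : ContDiffOn ℝ (n + 1) f U) : ContDiffOn ℝ n (m.cov₂ f) U := by
  have h1 : ContDiffOn ℝ n (fun x => fderiv ℝ f x Complex.I) U :=
    (hf.fderiv_of_isOpen hU le_rfl).clm_apply contDiffOn_const
  have h2 : ContDiff ℝ n (fun x : ℂ => ((m.e * m.B / (2 * m.hbar * m.c) * x.re : ℝ) : ℂ)) :=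
    Complex.ofRealCLM.contDiff.comp (contDiff_const.mul Complex.reCLM.contDiff)
  exact h1.sub ((contDiffOn_const.mul h2.contDiffOn).mul
    (hf.of_le (by exact_mod_cast Nat.le_succ n)))

theorem tsupport_cov₁ (f : ℂ → ℂ) : tsupport (m.cov₁ f) ⊆ tsupport f :=
  (tsupport_add _ _).trans (union_subset (tsupport_fderiv_apply_subset ℝ 1)
    (closure_mono (Function.support_mul_subset_right _ _)))

theorem cov₂_eq (f : ℂ → ℂ) (x : ℂ) : m.cov₂ f x = fderiv ℝ f x Complex.I +
    Complex.I * ((-(m.e * m.B / (2 * m.hbar * m.c) * x.re) : ℝ) : ℂ) * f x := by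
  rw [cov₂]; push_cast; ring

theorem tsupport_cov₂ (f : ℂ → ℂ) : tsupport (m.cov₂ f) ⊆ tsupport f := by
  rw [funext (cov₂_eq f)]
  exact (tsupport_add _ _).trans (union_subset (tsupport_fderiv_apply_subset ℝ Complex.I)
    (closure_mono (Function.support_mul_subset_right _ _)))

theorem integral_conj_mul_cov₁ {f g : ℂ → ℂ} {U : Set ℂ} (hU : IsOpen U)
    (hf : ContDiffOn ℝ 1 f U) (hg : ContDiff ℝ 1 g) (hgc : HasCompactSupport g)
    (hgU : tsupport g ⊆ U) :
    ∫ x, conj (f x) * m.cov₁ g x = -∫ x, conj (m.cov₁ f x) * g x :=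
  integral_conj_mul_covariant hU (by fun_prop) hf hg hgc hgU

theorem integral_conj_mul_cov₂ {f g : ℂ → ℂ} {U : Set ℂ} (hU : IsOpen U)
    (hf : ContDiffOn ℝ 1 f U) (hg : ContDiff ℝ 1 g) (hgc : HasCompactSupport g)
    (hgU : tsupport g ⊆ U) :
    ∫ x, conj (f x) * m.cov₂ g x = -∫ x, conj (m.cov₂ f x) * g x := by
  simp only [cov₂_eq]
  exact integral_conj_mul_covariant hU (by fun_prop) hf hg hgc hgU

open scoped ContDiff in
/-- The differential expression is formally self-adjoint. -/
theorem integral_conj_mul_HB {f g : ℂ → ℂ} {U : Set ℂ} (hU : IsOpen U)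
    (hf : ContDiffOn ℝ 2 f U) (hg : ContDiff ℝ ∞ g) (hgc : HasCompactSupport g)
    (hgU : tsupport g ⊆ U) :
    ∫ x, conj (f x) * m.HB g x = ∫ x, conj (m.HB f x) * g x := by
  have hf1 : ContDiffOn ℝ 1 f U := hf.of_le (by norm_num)
  have c1 : ContDiffOn ℝ 1 (m.cov₁ f) U := cov₁_contDiffOn (n := 1) hU (by simpa [one_add_one_eq_two] using hf)
  have c2 : ContDiffOn ℝ 1 (m.cov₂ f) U := cov₂_contDiffOn (n := 1) hU (by simpa [one_add_one_eq_two] using hf)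
  have d1 : ContinuousOn (m.cov₁ (m.cov₁ f)) U :=
    (cov₁_contDiffOn (n := 0) hU (by simpa using c1)).continuousOn
  have d2 : ContinuousOn (m.cov₂ (m.cov₂ f)) U :=
    (cov₂_contDiffOn (n := 0) hU (by simpa using c2)).continuousOn
  have g1 := m.cov₁_smooth hg
  have g2 := m.cov₂_smooth hg
  have hcj : Continuous (fun w : ℂ => conj w) := Complex.continuous_conj
  have g1' : ContDiff ℝ 1 (m.cov₁ g) := g1.of_le (by exact_mod_cast le_top)
  have g2' : ContDiff ℝ 1 (m.cov₂ g) := g2.of_le (by exact_mod_cast le_top)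
  have g0' : ContDiff ℝ 1 g := hg.of_le (by exact_mod_cast le_top)
  have s1 : tsupport (m.cov₁ g) ⊆ U := (tsupport_cov₁ g).trans hgU
  have s2 : tsupport (m.cov₂ g) ⊆ U := (tsupport_cov₂ g).trans hgU
  have e1 := integral_conj_mul_cov₁ (m := m) hU hf1 g1' (m.cov₁_supp hgc) s1
  have e1' := integral_conj_mul_cov₁ (m := m) hU c1 g0' hgc hgU
  have e2 := integral_conj_mul_cov₂ (m := m) hU hf1 g2' (m.cov₂_supp hgc) s2
  have e2' := integral_conj_mul_cov₂ (m := m) hU c2 g0' hgc hgU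
  have i1 := integrable_mul_of_tsupport_subset (f := fun x => conj (f x)) hU
    (hcj.comp_continuousOn hf1.continuousOn)
    (m.cov₁_smooth g1).continuous (m.cov₁_supp (m.cov₁_supp hgc)) ((tsupport_cov₁ _).trans s1)
  have i2 := integrable_mul_of_tsupport_subset (f := fun x => conj (f x)) hU
    (hcj.comp_continuousOn hf1.continuousOn)
    (m.cov₂_smooth g2).continuous (m.cov₂_supp (m.cov₂_supp hgc)) ((tsupport_cov₂ _).trans s2)
  have j1 := integrable_mul_of_tsupport_subset 
    (f := fun x => conj (m.cov₁ (m.cov₁ f) x)) hU (hcj.comp_continuousOn d1) hg.continuous hgc hgU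
  have j2 := integrable_mul_of_tsupport_subset 
    (f := fun x => conj (m.cov₂ (m.cov₂ f) x)) hU (hcj.comp_continuousOn d2) hg.continuous hgc hgU
  have l1 : ∫ x, conj (f x) * m.HB g x = ((-(m.hbar ^ 2 / (2 * m.μ)) : ℝ) : ℂ) *
      ((∫ x, conj (f x) * m.cov₁ (m.cov₁ g) x) + ∫ x, conj (f x) * m.cov₂ (m.cov₂ g) x) := by
    rw [← integral_add i1 i2, ← integral_const_mul]
    congr 1; funext x
    simp only [HB]; ring
  have l2 : ∫ x, conj (m.HB f x) * g x = ((-(m.hbar ^ 2 / (2 * m.μ)) : ℝ) : ℂ) *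
      ((∫ x, conj (m.cov₁ (m.cov₁ f) x) * g x) + ∫ x, conj (m.cov₂ (m.cov₂ f) x) * g x) := by
    rw [← integral_add j1 j2, ← integral_const_mul]
    congr 1; funext x
    simp only [HB, map_mul, map_add, Complex.conj_ofReal]; ring
  rw [l1, l2, e1, e1', e2, e2', neg_neg, neg_neg]

theorem restrict_cutPlane (m : Model) : (volume : Measure ℂ).restrict m.cutPlane = volume :=
  Measure.restrict_eq_self_of_ae_mem m.ae_mem_cutPlane

theorem aestronglyMeasurable_of_continuousOn {f : ℂ → ℂ} (hf : ContinuousOn f m.cutPlane) :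
    AEStronglyMeasurable f volume := by
  rw [← m.restrict_cutPlane]
  exact hf.aestronglyMeasurable m.isOpen_cutPlane.measurableSet

/-- A square integrable classical solution of the eigenvalue equation off the cuts is an
eigenfunction of the maximal operator. -/
theorem isEigenfunction_of_classical {f : ℂ → ℂ} {E : ℝ} (hL : MemLp f 2 volume)
    (hf : ContDiffOn ℝ 2 f m.cutPlane) (hHB : ∀ x ∈ m.cutPlane, m.HB f x = (E : ℂ) * f x)
    (hne : ∃ x ∈ m.cutPlane, f x ≠ 0) : m.IsEigenfunction E f := by
  -- The defining relation of the adjoint. Test functions are supported inside the cut plane, so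
  -- integration by parts leaves no term on the cuts.
  have key : ∀ x : m.HBdot.domain,
      inner ℂ ((E : ℂ) • hL.toLp f) (x : L2) = inner ℂ (hL.toLp f) (m.HBdot x) := by
    rintro ⟨_, g, rfl⟩
    have hx : m.HBdot ⟨m.testToL2 g, LinearMap.mem_range_self _ _⟩ = m.HBtest g := by
      change m.HBtest ((LinearEquiv.ofInjective m.testToL2 m.testToL2_injective).symm _) = _
      congr 1
      exact (LinearEquiv.ofInjective m.testToL2 m.testToL2_injective).symm_apply_apply g
    rw [hx, inner_smul_left, Complex.conj_ofReal, L2.inner_def, L2.inner_def]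
    have e1 : ∫ x, inner ℂ ((hL.toLp f : L2) x) ((m.testToL2 g : L2) x) =
        ∫ x, conj (f x) * (g : ℂ → ℂ) x := by
      refine integral_congr_ae ?_
      filter_upwards [hL.coeFn_toLp, (m.test_memLp g).coeFn_toLp] with x h1 h2
      have h2' : (m.testToL2 g : L2) x = (g : ℂ → ℂ) x := h2
      rw [h1, h2', RCLike.inner_apply, mul_comm]
    have e2 : ∫ x, inner ℂ ((hL.toLp f : L2) x) ((m.HBtest g : L2) x) =
        ∫ x, conj (f x) * m.HB g x := by
      refine integral_congr_ae ?_
      filter_upwards [hL.coeFn_toLp, (m.HB_test_memLp g).coeFn_toLp] with x h1 h2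
      have h2' : (m.HBtest g : L2) x = m.HB g x := h2
      rw [h1, h2', RCLike.inner_apply, mul_comm]
    rw [e1, e2, integral_conj_mul_HB m.isOpen_cutPlane hf g.2.1 g.2.2.1 g.2.2.2,
      ← integral_const_mul]
    refine integral_congr_ae ?_
    filter_upwards [m.ae_mem_cutPlane] with x hx
    rw [hHB x hx, map_mul, Complex.conj_ofReal, mul_assoc]
  refine ⟨hL, ?_, LinearPMap.mem_adjoint_domain_of_exists _ ⟨_, key⟩,
    LinearPMap.adjoint_apply_eq m.HBdot_dense _ key⟩
  intro h0
  obtain ⟨x, hx, hfx⟩ := hne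
  have h1 : f =ᵐ[volume] 0 := (MemLp.toLp_eq_toLp_iff hL MemLp.zero).1 (h0.trans (MemLp.toLp_zero _).symm)
  have h2 : f =ᵐ[volume.restrict m.cutPlane] fun _ => (0 : ℂ) := by rw [m.restrict_cutPlane]; exact h1
  exact hfx (Measure.eqOn_open_of_ae_eq h2 m.isOpen_cutPlane hf.continuousOn continuousOn_const hx)

end Model

/-! ### The reduced eigenvalue equation. -/

namespace Model

variable {m : Model}

theorem gauss_wirtinger (m : Model) (x : ℂ) :
    HasWirtingerAt m.gauss (-(m.k / 4 * conj x) * m.gauss x) (-(m.k / 4 * x) * m.gauss x) x := by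
  have h := HasWirtingerAt.comp_deriv (φ := Complex.exp) (Complex.hasDerivAt_exp _)
    (((HasWirtingerAt.id x).mul (HasWirtingerAt.conj_id x)).const_mul (m.k / 4 : ℂ)).neg
  exact h.congr_val (by simp only [gauss]; ring) (by simp only [gauss]; ring)

theorem contDiff_gauss (m : Model) {n : WithTop ℕ∞} : ContDiff ℝ n m.gauss :=
  ((contDiff_const.mul (contDiff_id.mul (Complex.conjCLE : ℂ →L[ℝ] ℂ).contDiff)).neg).cexp

theorem cov₁_congr {f g : ℂ → ℂ} {x : ℂ} (h : f =ᶠ[𝓝 x] g) : m.cov₁ f =ᶠ[𝓝 x] m.cov₁ g := by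
  filter_upwards [h.eventuallyEq_nhds] with y hy
  rw [cov₁, cov₁, hy.fderiv_eq, hy.self_of_nhds]

theorem cov₂_congr {f g : ℂ → ℂ} {x : ℂ} (h : f =ᶠ[𝓝 x] g) : m.cov₂ f =ᶠ[𝓝 x] m.cov₂ g := by
  filter_upwards [h.eventuallyEq_nhds] with y hy
  rw [cov₂, cov₂, hy.fderiv_eq, hy.self_of_nhds]

theorem HB_congr {f g : ℂ → ℂ} {x : ℂ} (h : f =ᶠ[𝓝 x] g) : m.HB f x = m.HB g x := by
  rw [HB, HB, (cov₁_congr (cov₁_congr h)).self_of_nhds, (cov₂_congr (cov₂_congr h)).self_of_nhds]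

namespace Admissible

/-- The Gaussian contributes `-(k/2) Re x` and the vector potential `-(k/2) i Im x`; together they
are multiplication by `-(k/2) x`, without `x̄`. -/
theorem cov₁_gauss_mul (h : m.Admissible) {f : ℂ → ℂ} {p q x : ℂ} (hf : HasWirtingerAt f p q x) :
    m.cov₁ (fun y => m.gauss y * f y) x = m.gauss x * (p + q - m.k / 2 * (x * f x)) := by
  have e : m.e * m.B / (2 * m.hbar * m.c) = -(m.k / 2) := by rw [h.k_eq]; ring
  rw [cov₁, ((m.gauss_wirtinger x).mul hf).fderiv_one, e]
  have h1 : x + conj x = 2 * x.re := by rw [Complex.add_conj]; push_cast; ring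
  have h2 := Complex.re_add_im x
  push_cast
  linear_combination (-(m.k / 4 : ℂ) * m.gauss x * f x) * h1 + (-(m.k / 2 : ℂ) * m.gauss x * f x) * h2

theorem cov₂_gauss_mul (h : m.Admissible) {f : ℂ → ℂ} {p q x : ℂ} (hf : HasWirtingerAt f p q x) :
    m.cov₂ (fun y => m.gauss y * f y) x =
      m.gauss x * (Complex.I * (p - q + m.k / 2 * (x * f x))) := by
  have e : m.e * m.B / (2 * m.hbar * m.c) = -(m.k / 2) := by rw [h.k_eq]; ring
  rw [cov₂, ((m.gauss_wirtinger x).mul hf).fderiv_I, e]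
  have h1 : x + conj x = 2 * x.re := by rw [Complex.add_conj]; push_cast; ring
  push_cast
  linear_combination (-(m.k / 4 : ℂ) * Complex.I * m.gauss x * f x) * h1

/-- The action of `H_B` on a Gaussian times `f`, through the Wirtinger derivatives of `f`. -/
theorem HB_gauss_mul (h : m.Admissible) {f f₁ f₂ : ℂ → ℂ} {x s d : ℂ}
    (hf : ∀ᶠ y in 𝓝 x, HasWirtingerAt f (f₁ y) (f₂ y) y) (h₁ : DifferentiableAt ℝ f₁ x)
    (h₂ : HasWirtingerAt f₂ s d x) :
    m.HB (fun y => m.gauss y * f y) x = ((-(m.hbar ^ 2 / (2 * m.μ)) : ℝ) : ℂ) *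
      (m.gauss x * (4 * s - 2 * m.k * x * f₁ x - m.k * f x)) := by
  obtain ⟨s₁, d₁, h₁⟩ := exists_hasWirtingerAt h₁
  -- The mixed derivatives are identified with `s`. The pure ones, `s₁` and `d`, have opposite signs
  -- in the two squared covariant derivatives and cancel.
  have hs := wirtinger_symmetric hf h₁ h₂
  have hfx := hf.self_of_nhds
  have c1 : m.cov₁ (fun y => m.gauss y * f y) =ᶠ[𝓝 x]
      fun y => m.gauss y * (f₁ y + f₂ y - m.k / 2 * (y * f y)) :=
    hf.mono fun y hy => h.cov₁_gauss_mul hy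
  have c2 : m.cov₂ (fun y => m.gauss y * f y) =ᶠ[𝓝 x]
      fun y => m.gauss y * (Complex.I * (f₁ y - f₂ y + m.k / 2 * (y * f y))) :=
    hf.mono fun y hy => h.cov₂_gauss_mul hy
  have hxf := ((HasWirtingerAt.id x).mul hfx).const_mul (m.k / 2 : ℂ)
  rw [HB, (cov₁_congr c1).self_of_nhds, (cov₂_congr c2).self_of_nhds,
    h.cov₁_gauss_mul ((h₁.add h₂).sub hxf),
    h.cov₂_gauss_mul (((h₁.sub h₂).add hxf).const_mul Complex.I)]
  have hI := Complex.I_mul_I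
  subst hs
  linear_combination (((-(m.hbar ^ 2 / (2 * m.μ)) : ℝ) : ℂ) * m.gauss x *
    (s₁ - 2 * d₁ + d + m.k / 2 * f x + m.k * x * f₁ x - m.k * x * f₂ x +
      m.k ^ 2 / 4 * f x * x ^ 2)) * hI

end Admissible

end Model

/-- `G` with Wirtinger derivatives `G₁`, `G₂` satisfies `∂∂̄G + κ((1 - z)∂G + aG) = 0` on `V`. -/
def ReducedSolution (a κ : ℝ) (V : Set ℂ) (G G₁ G₂ : ℂ → ℂ) : Prop :=
  ∀ z ∈ V, HasWirtingerAt G (G₁ z) (G₂ z) z ∧ DifferentiableAt ℝ G₁ z ∧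
    ∃ d, HasWirtingerAt G₂ (-κ * ((1 - z) * G₁ z + a * G z)) d z

namespace ReducedSolution

variable {a κ : ℝ} {V : Set ℂ} {G G₁ G₂ F F₁ F₂ : ℂ → ℂ}

theorem const_mul (c : ℂ) (hG : ReducedSolution a κ V G G₁ G₂) :
    ReducedSolution a κ V (fun z => c * G z) (fun z => c * G₁ z) (fun z => c * G₂ z) := by
  intro z hz
  obtain ⟨h1, h2, d, h3⟩ := hG z hz
  exact ⟨h1.const_mul c, h2.const_mul c, _, (h3.const_mul c).congr_val (by ring) rfl⟩

theorem sub (hG : ReducedSolution a κ V G G₁ G₂) (hF : ReducedSolution a κ V F F₁ F₂) :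
    ReducedSolution a κ V (fun z => G z - F z) (fun z => G₁ z - F₁ z) (fun z => G₂ z - F₂ z) := by
  intro z hz
  obtain ⟨h1, h2, d, h3⟩ := hG z hz
  obtain ⟨h1', h2', d', h3'⟩ := hF z hz
  exact ⟨h1.sub h1', h2.sub h2', _, (h3.sub h3').congr_val (by ring) rfl⟩

theorem mono {U : Set ℂ} (hG : ReducedSolution a κ V G G₁ G₂) (h : U ⊆ V) :
    ReducedSolution a κ U G G₁ G₂ := fun z hz => hG z (h hz)

end ReducedSolution

theorem reducedSolution_corr {a b κ : ℝ} (hab : a < b) (hb : b < 1) (hκ : 0 < κ) :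
    ReducedSolution a κ Complex.slitPlane (corr a b κ) (corr₁ a b κ) (corr₂ a b κ) :=
  fun _ hz => ⟨corr_wirtinger hab hb hκ hz, (differentiableOn_corr₁ hab hb hκ).differentiableAt
    (Complex.isOpen_slitPlane.mem_nhds hz), corr₂_wirtinger hab hb hκ hz⟩

theorem hasDerivAt_one_sub_cpow (c : ℂ) {z : ℂ} (hz : 1 - z ∈ Complex.slitPlane) :
    HasDerivAt (fun z : ℂ => (1 - z) ^ c) (-c * (1 - z) ^ (c - 1)) z := by
  have h := ((hasDerivAt_id' z).const_sub 1).cpow_const (c := c) hz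
  convert! h using 1
  ring

/-- It solves both halves separately: `∂̄` annihilates it, and so does `(1 - z)∂ + a`. -/
theorem reducedSolution_one_sub_cpow (a κ : ℝ) :
    ReducedSolution a κ {z | 1 - z ∈ Complex.slitPlane} (fun z => (1 - z) ^ (a : ℂ))
      (fun z => -a * (1 - z) ^ ((a : ℂ) - 1)) (fun _ => 0) := by
  intro z hz
  have hz0 := Complex.slitPlane_ne_zero hz
  refine ⟨HasWirtingerAt.of_hasDerivAt (hasDerivAt_one_sub_cpow _ hz),
    ((hasDerivAt_one_sub_cpow _ hz).differentiableAt.const_mul _).restrictScalars ℝ, 0,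
    (HasWirtingerAt.const 0 z).congr_val ?_ rfl⟩
  beta_reduce
  rw [Complex.cpow_sub _ _ hz0, Complex.cpow_one]
  field_simp
  ring

theorem contDiffOn_one_sub_cpow (a : ℂ) {n : WithTop ℕ∞} :
    ContDiffOn ℝ n (fun z : ℂ => (1 - z) ^ a) {z | 1 - z ∈ Complex.slitPlane} := by
  have h : ContDiffOn ℂ n (fun z : ℂ => (1 - z) ^ a) {z | 1 - z ∈ Complex.slitPlane} :=
    DifferentiableOn.contDiffOn (fun z hz =>
      (hasDerivAt_one_sub_cpow a hz).differentiableAt.differentiableWithinAt)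
      (Complex.isOpen_slitPlane.preimage (by fun_prop))
  exact h.restrict_scalars ℝ

namespace Model.Admissible

variable {m : Model}

/-- With `x = R(1 - z)`, each Wirtinger derivative in `x` is `-1/R` times one in `z`. As `kR² = 2κ`,
the reduced equation turns `4∂∂̄f - 2kx∂f - kf` into `-(2α + 1)kf`, which is `E₁` after the factor
`-ħ²/2μ`. -/
theorem HB_gauss_mul_comp (h : m.Admissible) {V : Set ℂ} (hV : IsOpen V) {G G₁ G₂ : ℂ → ℂ}
    (hG : ReducedSolution m.α m.κ V G G₁ G₂) {x : ℂ} (hx : m.coord x ∈ V) :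
    m.HB (fun y => m.gauss y * G (m.coord y)) x = (m.E₁ : ℂ) * (m.gauss x * G (m.coord x)) := by
  have hco : Continuous m.coord := by unfold coord; fun_prop
  have hf : ∀ᶠ y in 𝓝 x, HasWirtingerAt (fun y => G (m.coord y)) ((-m.R⁻¹ : ℝ) * G₁ (m.coord y))
      ((-m.R⁻¹ : ℝ) * G₂ (m.coord y)) y := by
    filter_upwards [hco.continuousAt.eventually (hV.mem_nhds hx)] with y hy
    have h1 := (hG _ hy).1
    have h2 := HasWirtingerAt.comp_affine (z := y) (f := G) 1 (-m.R⁻¹) (a := G₁ (m.coord y))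
      (b := G₂ (m.coord y)) (by simpa [coord] using h1)
    simpa [coord] using h2
  obtain ⟨-, h2, d, h3⟩ := hG _ hx
  have hd1 : DifferentiableAt ℝ (fun y => ((-m.R⁻¹ : ℝ) : ℂ) * G₁ (m.coord y)) x := by
    refine DifferentiableAt.const_mul ?_ _
    refine DifferentiableAt.comp (f := m.coord) x h2 ?_
    unfold coord
    fun_prop
  have h4 := (HasWirtingerAt.comp_affine (z := x) (f := G₂) 1 (-m.R⁻¹)
    (a := -m.κ * ((1 - m.coord x) * G₁ (m.coord x) + m.α * G (m.coord x))) (b := d)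
    (by simpa [coord] using h3)).const_mul ((-m.R⁻¹ : ℝ) : ℂ)
  have h5 : ∀ w : ℂ, ((1 : ℝ) : ℂ) + (-m.R⁻¹ : ℝ) * w = m.coord w := fun w => by
    rw [coord, Complex.ofReal_one]
  simp only [h5] at h4
  rw [h.HB_gauss_mul hf hd1 h4]
  have hR : (m.R : ℂ) ≠ 0 := by exact_mod_cast h.hR.ne'
  have hμ : (m.μ : ℂ) ≠ 0 := by exact_mod_cast h.hμ.ne'
  have hh : (m.hbar : ℂ) ≠ 0 := by exact_mod_cast h.hhbar.ne'
  have e1 : (m.E₁ : ℂ) = (m.α + 1 / 2) * (m.hbar ^ 2 / m.μ * m.k) := by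
    rw [E₁, k]; push_cast; field_simp
  have e2 : x = m.R * (1 - m.coord x) := h.eq_mul x
  have e3 : (m.κ : ℂ) = m.k * m.R ^ 2 / 2 := by rw [κ]; push_cast; ring
  rw [e1, e3]
  generalize m.gauss x = g
  generalize hz : m.coord x = z at *
  rw [e2]
  push_cast
  field_simp
  ring

/-- `φ` on the complement of the cut `L_b`. -/
theorem φ_eq_gauss_mul (h : m.Admissible) {x : ℂ} (hx : m.coord x ∈ Complex.slitPlane) :
    m.φ x = m.gauss x *
      (((-(m.amp * (Real.sin (Real.pi * m.β) / Real.pi)) : ℝ) : ℂ) *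
        corr m.α m.β m.κ (m.coord x)) := by
  rw [h.φ_eq hx]; ring

theorem ψ₂approx_eq_gauss_mul (h : m.Admissible) {x : ℂ} (hx : x ∈ m.cutPlane) :
    m.ψ₂approx x = m.gauss x * ((m.amp : ℂ) * ((1 - m.coord x) ^ (m.α : ℂ) -
      ((Real.sin (Real.pi * m.β) / Real.pi : ℝ) : ℂ) * corr m.α m.β m.κ (m.coord x))) := by
  obtain ⟨h1, h2⟩ := h.mem_cutPlane_iff.1 hx
  rw [ψ₂approx, h.φ_eq h2, h.ψ₁_eq (Complex.slitPlane_ne_zero h1)]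
  push_cast
  ring

theorem isOpen_reduced : IsOpen ({z : ℂ | 1 - z ∈ Complex.slitPlane} ∩ Complex.slitPlane) :=
  (Complex.isOpen_slitPlane.preimage (by fun_prop)).inter Complex.isOpen_slitPlane

theorem mem_reduced_iff (h : m.Admissible) {x : ℂ} : x ∈ m.cutPlane ↔
    m.coord x ∈ {z : ℂ | 1 - z ∈ Complex.slitPlane} ∩ Complex.slitPlane := by
  rw [h.mem_cutPlane_iff, mem_inter_iff, mem_ofPred_eq, h.one_sub_coord_mem]

theorem contDiff_coord (m : Model) {n : WithTop ℕ∞} : ContDiff ℝ n m.coord :=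
  contDiff_const.add (contDiff_const.mul contDiff_id)

theorem HB_φ (h : m.Admissible) {x : ℂ} (hx : x ∈ m.cutPlane) :
    m.HB m.φ x = (m.E₁ : ℂ) * m.φ x := by
  have hx2 := (h.mem_cutPlane_iff.1 hx).2
  rw [h.φ_eq_gauss_mul hx2, ← h.HB_gauss_mul_comp Complex.isOpen_slitPlane
    ((reducedSolution_corr h.hαβ h.hβ h.κ_pos).const_mul _) hx2]
  refine HB_congr ?_
  filter_upwards [m.isOpen_cutPlane.mem_nhds hx] with y hy
  exact h.φ_eq_gauss_mul (h.mem_cutPlane_iff.1 hy).2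

theorem HB_ψ₂approx (h : m.Admissible) {x : ℂ} (hx : x ∈ m.cutPlane) :
    m.HB m.ψ₂approx x = (m.E₁ : ℂ) * m.ψ₂approx x := by
  rw [h.ψ₂approx_eq_gauss_mul hx, ← h.HB_gauss_mul_comp isOpen_reduced
    (((((reducedSolution_one_sub_cpow m.α m.κ).mono inter_subset_left).sub
    (((reducedSolution_corr h.hαβ h.hβ h.κ_pos).mono inter_subset_right).const_mul _))).const_mul _)
    (h.mem_reduced_iff.1 hx)]
  refine HB_congr ?_
  filter_upwards [m.isOpen_cutPlane.mem_nhds hx] with y hy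
  exact h.ψ₂approx_eq_gauss_mul hy

theorem contDiffOn_φ (h : m.Admissible) (n : ℕ) :
    ContDiffOn ℝ n m.φ {x | m.coord x ∈ Complex.slitPlane} := by
  have h1 : ContDiffOn ℝ n (fun x => m.gauss x *
      (((-(m.amp * (Real.sin (Real.pi * m.β) / Real.pi)) : ℝ) : ℂ) *
        corr m.α m.β m.κ (m.coord x))) {x | m.coord x ∈ Complex.slitPlane} :=
    m.contDiff_gauss.contDiffOn.mul (contDiffOn_const.mul
      ((contDiffOn_corr h.hαβ h.hβ h.κ_pos n).comp (contDiff_coord m).contDiffOn fun x hx => hx))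
  exact h1.congr fun x hx => h.φ_eq_gauss_mul hx

theorem contDiffOn_ψ₂approx (h : m.Admissible) (n : ℕ) :
    ContDiffOn ℝ n m.ψ₂approx m.cutPlane := by
  have h1 : ContDiffOn ℝ n (fun x => m.gauss x * ((m.amp : ℂ) * ((1 - m.coord x) ^ (m.α : ℂ) -
      ((Real.sin (Real.pi * m.β) / Real.pi : ℝ) : ℂ) * corr m.α m.β m.κ (m.coord x))))
      m.cutPlane := by
    refine m.contDiff_gauss.contDiffOn.mul (contDiffOn_const.mul (ContDiffOn.sub ?_
      (contDiffOn_const.mul ?_)))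
    · exact (contDiffOn_one_sub_cpow (m.α : ℂ)).comp (contDiff_coord m).contDiffOn fun x hx =>
        (h.mem_reduced_iff.1 hx).1
    · exact (contDiffOn_corr h.hαβ h.hβ h.κ_pos n).comp (contDiff_coord m).contDiffOn fun x hx =>
        (h.mem_reduced_iff.1 hx).2
  exact h1.congr fun x hx => h.ψ₂approx_eq_gauss_mul hx

end Model.Admissible

/-! ### Square integrability. -/

theorem integrable_comp_abs {f : ℝ → ℝ} (hf : IntegrableOn f (Ioi 0)) :
    Integrable fun x : ℝ => f |x| := by
  have h1 : IntegrableOn (fun x : ℝ => f |x|) (Ioi 0) :=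
    hf.congr_fun (fun x hx => by rw [abs_of_pos hx]) measurableSet_Ioi
  have h2 : IntegrableOn (fun x : ℝ => f |x|) (Iic 0) := by
    rw [← Measure.map_neg_eq_self (volume : Measure ℝ)]
    let m : MeasurableEmbedding fun x : ℝ => -x := (Homeomorph.neg ℝ).measurableEmbedding
    rw [m.integrableOn_map_iff]
    simp_rw [Function.comp_def, abs_neg, neg_preimage, neg_Iic, neg_zero]
    exact (integrableOn_Ici_iff_integrableOn_Ioi).2 h1
  rw [← integrableOn_univ, ← Iic_union_Ioi (a := (0 : ℝ))]
  exact h2.union h1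

theorem integrable_abs_rpow_mul_gaussian {c s : ℝ} (hc : 0 < c) (hs : -1 < s) :
    Integrable fun v : ℝ => |v| ^ s * Real.exp (-c * v ^ 2) := by
  have h := integrable_comp_abs (integrableOn_rpow_mul_exp_neg_mul_sq hc hs)
  simpa only [sq_abs] using h

theorem integrable_im_rpow_mul_gaussian {c s : ℝ} (hc : 0 < c) (hs : -1 < s) :
    Integrable fun z : ℂ => |z.im| ^ s * Real.exp (-c * ‖z‖ ^ 2) := by
  have h1 : Integrable (fun p : ℝ × ℝ => Real.exp (-c * p.1 ^ 2) *
      (|p.2| ^ s * Real.exp (-c * p.2 ^ 2))) (volume.prod volume) :=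
    (integrable_exp_neg_mul_sq hc).mul_prod (integrable_abs_rpow_mul_gaussian hc hs)
  have h2 := (Complex.volume_preserving_equiv_real_prod.integrable_comp_emb
    Complex.measurableEquivRealProd.measurableEmbedding).2 h1
  refine h2.congr (.of_forall fun z => ?_)
  have e : ‖z‖ ^ 2 = z.re ^ 2 + z.im ^ 2 := by
    rw [← Complex.normSq_eq_norm_sq, Complex.normSq_apply]; ring
  simp only [Function.comp_apply, Complex.measurableEquivRealProd_apply]
  rw [e, mul_add, Real.exp_add]
  ring

/-- The distance from `z` to the negative axis, interpolated between its two natural bounds. -/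
theorem inv_norm_ofReal_mul_add_le {z : ℂ} (hz : z.im ≠ 0) {t : ℝ} (ht : 0 < t) (ht1 : t ≠ 1) :
    ‖((‖z‖ * t : ℝ) : ℂ) + z‖⁻¹ ≤ ‖z‖ ^ (-(2 / 3) : ℝ) * (|z.im| / 2) ^ (-(1 / 3) : ℝ) *
      (|t - 1| ^ (-(2 / 3) : ℝ) * (1 + t) ^ (-(1 / 3) : ℝ)) := by
  have hz0 : z ≠ 0 := fun h => hz (by rw [h]; rfl)
  have hr : 0 < ‖z‖ := norm_pos_iff.2 hz0
  have hy : 0 < |z.im| := abs_pos.2 hz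
  have hA0 : 0 < ‖z‖ * |t - 1| := mul_pos hr (abs_pos.2 (sub_ne_zero.2 ht1))
  have hB0 : 0 < (1 + t) * (|z.im| / 2) := by positivity
  set X := ‖((‖z‖ * t : ℝ) : ℂ) + z‖ with hX
  have hA : ‖z‖ * |t - 1| ≤ X := by
    have h := abs_norm_sub_norm_le ((‖z‖ * t : ℝ) : ℂ) (-z)
    rw [sub_neg_eq_add, norm_neg, Complex.norm_real, Real.norm_of_nonneg (by positivity),
      show ‖z‖ * t - ‖z‖ = ‖z‖ * (t - 1) by ring, abs_mul, abs_norm] at h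
    exact h
  -- The half-angle bound at `s = |z|t`, together with `(Im z)² ≤ 2|z|(|z| + Re z)`.
  have hB : (1 + t) * (|z.im| / 2) ≤ X := by
    refine le_of_sq_le_sq ?_ (norm_nonneg _)
    refine le_trans ?_ (sq_add_norm_mul_le hz0 (‖z‖ * t))
    have h1 : z.im ^ 2 = (‖z‖ - z.re) * (‖z‖ + z.re) := by
      have : ‖z‖ ^ 2 = z.re ^ 2 + z.im ^ 2 := by
        rw [← Complex.normSq_eq_norm_sq, Complex.normSq_apply]; ring
      linear_combination -this
    have h2 := Complex.abs_re_le_norm z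
    have h3 : 0 ≤ ‖z‖ + z.re := by linarith [neg_abs_le z.re]
    have h4 : z.im ^ 2 ≤ 2 * ‖z‖ * (‖z‖ + z.re) := by
      rw [h1]
      refine mul_le_mul_of_nonneg_right ?_ h3
      linarith [neg_abs_le z.re]
    have h5 : (‖z‖ * t + ‖z‖) ^ 2 * ((‖z‖ + z.re) / (2 * ‖z‖)) =
        (1 + t) ^ 2 / 4 * (2 * ‖z‖ * (‖z‖ + z.re)) := by
      field_simp
      ring
    rw [h5, mul_pow, div_pow, sq_abs]
    have : 0 ≤ (1 + t) ^ 2 / 4 := by positivity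
    nlinarith
  have hX0 : 0 < X := hA0.trans_le hA
  -- The exponent `2/3` is below `1`, so `|t - 1|^{-2/3}` is integrable at `t = 1`; the
  -- complementary `1/3` is below `1/2`, so `|Im z|^{-1/3}` is locally square integrable.
  have h1 : (‖z‖ * |t - 1|) ^ (2 / 3 : ℝ) * ((1 + t) * (|z.im| / 2)) ^ (1 / 3 : ℝ) ≤ X := by
    calc _ ≤ X ^ (2 / 3 : ℝ) * X ^ (1 / 3 : ℝ) := by gcongr
      _ = X := by rw [← Real.rpow_add hX0]; norm_num
  refine (inv_anti₀ (by positivity) h1).trans_eq ?_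
  rw [mul_inv, ← Real.rpow_neg hA0.le, ← Real.rpow_neg hB0.le, Real.mul_rpow hr.le (abs_nonneg _),
    Real.mul_rpow (by positivity) (by positivity)]
  ring

/-- A majorant of the singular weight. -/
theorem singular_weight_le {a b : ℝ} (ha1 : a ≤ 1) (hb0 : 0 ≤ b) (hb : b ≤ 1) {t : ℝ}
    (ht : 0 < t) (ht1 : t ≠ 1) :
    (1 + t) ^ a * t ^ (-b) * (|t - 1| ^ (-(2 / 3) : ℝ) * (1 + t) ^ (-(1 / 3) : ℝ)) ≤
      3 * ((1 + t) ^ (a - 1) * t ^ (-b)) +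
        18 * (|t - 1| ^ (-(2 / 3) : ℝ) * Real.exp (-1 * (t - 1) ^ 2)) := by
  have hv : 0 < |t - 1| := abs_pos.2 (sub_ne_zero.2 ht1)
  have p1 : 0 ≤ (1 + t) ^ (a - 1) * t ^ (-b) := by positivity
  have p2 : 0 ≤ |t - 1| ^ (-(2 / 3) : ℝ) * Real.exp (-1 * (t - 1) ^ 2) := by positivity
  -- Away from `t = 1` the factor `|t - 1|` is comparable with `1 + t`. Otherwise `1/2 < t < 2`,
  -- where the weights are bounded by `3` and `2` and the Gaussian is at least `1/3`, whence `18 = 3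
  -- · 2 · 3`; the Gaussian only makes this term integrable on the line.
  by_cases h : (1 + t) / 3 ≤ |t - 1|
  · have h1 : |t - 1| ^ (-(2 / 3) : ℝ) ≤ 3 * (1 + t) ^ (-(2 / 3) : ℝ) := by
      calc _ ≤ ((1 + t) / 3) ^ (-(2 / 3) : ℝ) :=
            Real.rpow_le_rpow_of_nonpos (by positivity) h (by norm_num)
        _ = (3 : ℝ) ^ (2 / 3 : ℝ) * (1 + t) ^ (-(2 / 3) : ℝ) := by
            rw [Real.div_rpow (by positivity) (by norm_num), Real.rpow_neg (x := 3) (by norm_num),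
              div_inv_eq_mul, mul_comm]
        _ ≤ (3 : ℝ) ^ (1 : ℝ) * (1 + t) ^ (-(2 / 3) : ℝ) := by
            gcongr <;> norm_num
        _ = _ := by rw [Real.rpow_one]
    calc _ ≤ (1 + t) ^ a * t ^ (-b) *
          (3 * (1 + t) ^ (-(2 / 3) : ℝ) * (1 + t) ^ (-(1 / 3) : ℝ)) := by gcongr
      _ = 3 * ((1 + t) ^ (a - 1) * t ^ (-b)) := by
          have e : (1 + t) ^ (a - 1) = (1 + t) ^ a * ((1 + t) ^ (-(2 / 3) : ℝ) *
              (1 + t) ^ (-(1 / 3) : ℝ)) := by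
            rw [← Real.rpow_add (by positivity), ← Real.rpow_add (by positivity)]
            norm_num [sub_eq_add_neg]
          rw [e]; ring
      _ ≤ _ := by linarith
  · push Not at h
    have hlt : t < 2 := by
      by_contra hc
      push Not at hc
      rw [abs_of_nonneg (by linarith)] at h
      linarith
    have hgt : 1 / 2 < t := by
      by_contra hc
      push Not at hc
      rw [abs_of_nonpos (by linarith)] at h
      linarith
    have h1 : (1 + t) ^ a ≤ 3 := by
      calc _ ≤ (1 + t) ^ (1 : ℝ) := Real.rpow_le_rpow_of_exponent_le (by linarith) ha1
        _ ≤ 3 := by rw [Real.rpow_one]; linarith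
    have h2 : t ^ (-b) ≤ 2 := by
      calc _ ≤ (1 / 2 : ℝ) ^ (-b) :=
            Real.rpow_le_rpow_of_nonpos (by norm_num) hgt.le (by linarith)
        _ = 2 ^ b := by rw [one_div, Real.inv_rpow (by norm_num), Real.rpow_neg (by norm_num), inv_inv]
        _ ≤ (2 : ℝ) ^ (1 : ℝ) := Real.rpow_le_rpow_of_exponent_le (by norm_num) hb
        _ = 2 := Real.rpow_one _
    have h3 : (1 + t) ^ (-(1 / 3) : ℝ) ≤ 1 :=
      Real.rpow_le_one_of_one_le_of_nonpos (by linarith) (by norm_num)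
    have h4 : 1 ≤ 3 * Real.exp (-1 * (t - 1) ^ 2) := by
      have h5 : (t - 1) ^ 2 ≤ 1 := by nlinarith
      have h6 : Real.exp (-1) ≤ Real.exp (-1 * (t - 1) ^ 2) := Real.exp_le_exp.2 (by linarith)
      have h7 : Real.exp 1 < 3 := Real.exp_one_lt_three
      have h8 : Real.exp (-1) * Real.exp 1 = 1 := by rw [← Real.exp_add]; simp
      nlinarith [Real.exp_pos (-1)]
    calc _ ≤ 3 * 2 * (|t - 1| ^ (-(2 / 3) : ℝ) * 1) := by gcongr
      _ ≤ 3 * 2 * (|t - 1| ^ (-(2 / 3) : ℝ) * (3 * Real.exp (-1 * (t - 1) ^ 2))) := by gcongr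
      _ = 18 * (|t - 1| ^ (-(2 / 3) : ℝ) * Real.exp (-1 * (t - 1) ^ 2)) := by ring
      _ ≤ _ := by linarith

/-- Scaling `s = |z|t` moves the near singularity to `t = 1` for every `z`, and `|z|^b` cancels the
scaled power `s^{-b}`. The exponential is at most `1`, so the constant does not depend on `κ`. -/
theorem exists_norm_kernInt_le {a b : ℝ} (ha : 0 ≤ a) (hab : a < b) (hb : b < 1) :
    ∃ K : ℝ, 0 ≤ K ∧ ∀ κ : ℝ, 0 ≤ κ → ∀ z : ℂ, z.im ≠ 0 →
      ‖z‖ ^ b * ‖kernInt a b κ 0 1 z‖ ≤ K * ((1 + ‖z‖) ^ 2 * (|z.im| / 2) ^ (-(1 / 3) : ℝ)) := by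
  set w : ℝ → ℝ := fun t => 3 * ((1 + t) ^ (a - 1) * t ^ (-b)) +
        18 * (|t - 1| ^ (-(2 / 3) : ℝ) * Real.exp (-1 * (t - 1) ^ 2)) with hw
  have hwi : IntegrableOn w (Ioi 0) :=
    (integrableOn_bound hab hb 3).add ((((integrable_abs_rpow_mul_gaussian one_pos
      (s := -(2 / 3)) (by norm_num)).comp_sub_right 1).const_mul 18).integrableOn)
  refine ⟨∫ t in Ioi (0 : ℝ), w t, setIntegral_nonneg measurableSet_Ioi fun t ht => ?_,
    fun κ hκ z hz => ?_⟩
  · have : (0 : ℝ) < t := ht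
    simp only [hw]
    positivity
  · have hz0 : z ≠ 0 := fun h => hz (by rw [h]; rfl)
    have hr : 0 < ‖z‖ := norm_pos_iff.2 hz0
    have hy : 0 < |z.im| := abs_pos.2 hz
    set Y := (|z.im| / 2) ^ (-(1 / 3) : ℝ) with hY
    have hY0 : 0 < Y := by positivity
    have e1 : kernInt a b κ 0 1 z = ∫ t in Ioi (0 : ℝ), (‖z‖ : ℂ) * kern a b κ 0 1 z (‖z‖ * t) := by
      have h := integral_comp_mul_left_Ioi (kern a b κ 0 1 z) 0 hr
      rw [mul_zero, Complex.real_smul] at h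
      rw [integral_const_mul, h, kernInt, ← mul_assoc, Complex.ofReal_inv, mul_inv_cancel₀, one_mul]
      exact_mod_cast hr.ne'
    have e2 : ‖((‖z‖ ^ b : ℝ) : ℂ) * kernInt a b κ 0 1 z‖ ≤
        ∫ t in Ioi (0 : ℝ), (1 + ‖z‖) ^ 2 * Y * w t := by
      rw [e1, ← integral_const_mul]
      refine norm_integral_le_of_norm_le (hwi.const_mul _) ?_
      have hne : ∀ᵐ t : ℝ ∂(volume.restrict (Ioi 0)), t ≠ 1 :=
        ae_restrict_of_ae (Measure.ae_ne volume 1)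
      filter_upwards [hne, ae_restrict_mem measurableSet_Ioi] with t ht1 ht
      have ht0 : (0 : ℝ) < t := ht
      have hs : 0 < ‖z‖ * t := by positivity
      have hx : Real.exp (-(κ * ‖z‖ ^ 2) * (‖z‖ * t)⁻¹) ≤ 1 := by
        rw [Real.exp_le_one_iff, neg_mul]
        have : 0 ≤ κ * ‖z‖ ^ 2 * (‖z‖ * t)⁻¹ := by positivity
        linarith
      have h1 : (1 + ‖z‖ * t) ^ a ≤ (1 + ‖z‖) * (1 + t) ^ a := by
        calc _ ≤ ((1 + ‖z‖) * (1 + t)) ^ a := by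
              refine Real.rpow_le_rpow (by positivity) ?_ ha
              nlinarith
          _ = (1 + ‖z‖) ^ a * (1 + t) ^ a := Real.mul_rpow (by positivity) (by positivity)
          _ ≤ (1 + ‖z‖) ^ (1 : ℝ) * (1 + t) ^ a := by
              gcongr
              · linarith
              · linarith
          _ = _ := by rw [Real.rpow_one]
      have h2 := inv_norm_ofReal_mul_add_le hz ht0 ht1
      have h3 := singular_weight_le (a := a) (b := b) (by linarith) (by linarith) hb.le ht0 ht1
      have h4 : ‖z‖ ^ b * (‖z‖ * t) ^ (-b) = t ^ (-b) := by
        rw [Real.mul_rpow hr.le ht0.le, ← mul_assoc, ← Real.rpow_add hr]; simp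
      have h5 : ‖z‖ * ‖z‖ ^ (-(2 / 3) : ℝ) ≤ 1 + ‖z‖ := by
        have e : ‖z‖ * ‖z‖ ^ (-(2 / 3) : ℝ) = ‖z‖ ^ (1 / 3 : ℝ) := by
          nth_rewrite 1 [← Real.rpow_one ‖z‖]
          rw [← Real.rpow_add hr]; norm_num
        rw [e]
        calc ‖z‖ ^ (1 / 3 : ℝ) ≤ (1 + ‖z‖) ^ (1 / 3 : ℝ) := by gcongr; linarith
          _ ≤ (1 + ‖z‖) ^ (1 : ℝ) := Real.rpow_le_rpow_of_exponent_le (by linarith) (by norm_num)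
          _ = _ := Real.rpow_one _
      rw [norm_mul, norm_mul, norm_kern _ _ _ _ _ _ hs, Complex.norm_real, Complex.norm_real,
        Real.norm_of_nonneg hr.le, Real.norm_of_nonneg (by positivity), pow_zero, pow_one, mul_one]
      calc ‖z‖ ^ b * (‖z‖ * ((1 + ‖z‖ * t) ^ a * (‖z‖ * t) ^ (-b) *
            Real.exp (-(κ * ‖z‖ ^ 2) * (‖z‖ * t)⁻¹) * ‖((‖z‖ * t : ℝ) : ℂ) + z‖⁻¹))
          = ‖z‖ * (1 + ‖z‖ * t) ^ a * (‖z‖ ^ b * (‖z‖ * t) ^ (-b)) *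
            Real.exp (-(κ * ‖z‖ ^ 2) * (‖z‖ * t)⁻¹) * ‖((‖z‖ * t : ℝ) : ℂ) + z‖⁻¹ := by ring
        _ = ‖z‖ * (1 + ‖z‖ * t) ^ a * t ^ (-b) *
            Real.exp (-(κ * ‖z‖ ^ 2) * (‖z‖ * t)⁻¹) * ‖((‖z‖ * t : ℝ) : ℂ) + z‖⁻¹ := by rw [h4]
        _ ≤ ‖z‖ * ((1 + ‖z‖) * (1 + t) ^ a) * t ^ (-b) * 1 *
            (‖z‖ ^ (-(2 / 3) : ℝ) * Y *
            (|t - 1| ^ (-(2 / 3) : ℝ) * (1 + t) ^ (-(1 / 3) : ℝ))) := by gcongr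
        _ = (‖z‖ * ‖z‖ ^ (-(2 / 3) : ℝ)) * (1 + ‖z‖) * Y * ((1 + t) ^ a * t ^ (-b) *
            (|t - 1| ^ (-(2 / 3) : ℝ) * (1 + t) ^ (-(1 / 3) : ℝ))) := by ring
        _ ≤ (1 + ‖z‖) * (1 + ‖z‖) * Y * w t := by gcongr
        _ = _ := by ring
    rw [norm_mul, Complex.norm_real, Real.norm_of_nonneg (by positivity), integral_const_mul] at e2
    refine e2.trans_eq ?_
    ring

/-- The polynomial growth is paid for by one of the two Gaussian factors of the squared modulus. -/
theorem one_add_pow_four_le {κ r : ℝ} (hκ : 0 < κ) :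
    (1 + r) ^ 4 ≤ 4 * (1 + 4 / κ) ^ 2 * Real.exp (κ / 2 * r ^ 2) := by
  have h1 : 1 + r ^ 2 ≤ (1 + 4 / κ) * Real.exp (κ / 4 * r ^ 2) := by
    have h2 := Real.add_one_le_exp (κ / 4 * r ^ 2)
    have h3 : 0 < 4 / κ := by positivity
    calc 1 + r ^ 2 ≤ (1 + 4 / κ) * (κ / 4 * r ^ 2 + 1) := by
          have e : (1 + 4 / κ) * (κ / 4 * r ^ 2 + 1) = 1 + r ^ 2 + (κ / 4 * r ^ 2 + 4 / κ) := by
            field_simp; ring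
          rw [e]
          have : 0 ≤ κ / 4 * r ^ 2 := by positivity
          linarith
      _ ≤ _ := by gcongr
  have h4 : Real.exp (κ / 2 * r ^ 2) = Real.exp (κ / 4 * r ^ 2) ^ 2 := by
    rw [← Real.exp_nat_mul]; congr 1; push_cast; ring
  have h5 : (1 + r) ^ 2 ≤ 2 * (1 + r ^ 2) := by nlinarith [sq_nonneg (r - 1)]
  calc (1 + r) ^ 4 = ((1 + r) ^ 2) ^ 2 := by ring
    _ ≤ (2 * (1 + r ^ 2)) ^ 2 := by gcongr
    _ ≤ (2 * ((1 + 4 / κ) * Real.exp (κ / 4 * r ^ 2))) ^ 2 := by gcongr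
    _ = _ := by rw [h4]; ring

/-- The correction does not vanish on the positive axis. -/
theorem corr_ofReal_ne_zero {a b κ : ℝ} (hab : a < b) (hb : b < 1) (hκ : 0 < κ) {r : ℝ}
    (hr : 0 < r) : corr a b κ r ≠ 0 := by
  have hz : (r : ℂ) ∈ Complex.slitPlane := Complex.ofReal_mem_slitPlane.2 hr
  refine mul_ne_zero (mul_ne_zero ?_ (Complex.exp_ne_zero _)) ?_
  · rw [Ne, Complex.cpow_eq_zero_iff]
    exact fun h => hr.ne' (by exact_mod_cast h.1)
  · set f : ℝ → ℝ := fun s => (1 + s) ^ a * s ^ (-b) * Real.exp (-(κ * (r * r)) * s⁻¹) * (s + r)⁻¹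
      with hf
    have e : ∀ s, kern a b κ 0 1 r s = (f s : ℂ) := by
      intro s
      simp only [kern, hf, pow_zero, mul_one, pow_one, Complex.conj_ofReal]
      push_cast
      ring
    have hi := integrableOn_kern (a := a) hab hb hκ.le hz (p := 0) (n := 1) le_rfl (Or.inr hκ)
    have hfi : IntegrableOn f (Ioi 0) := by
      have h := hi.re
      refine h.congr (.of_forall fun s => ?_)
      simp [e]
    have hpos : 0 < ∫ s in Ioi (0 : ℝ), f s := by
      rw [setIntegral_pos_iff_support_of_nonneg_ae ?_ hfi]
      · refine lt_of_lt_of_le (b := volume (Ioi (0 : ℝ))) (by simp) (measure_mono fun s hs => ?_)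
        have hs0 : (0 : ℝ) < s := hs
        refine ⟨?_, hs⟩
        have : 0 < f s := by simp only [hf]; positivity
        exact this.ne'
      · refine (ae_restrict_iff' measurableSet_Ioi).2 (.of_forall fun s hs => ?_)
        have hs0 : (0 : ℝ) < s := hs
        simp only [hf, Pi.zero_apply]
        positivity
    rw [kernInt]
    simp only [e]
    rw [integral_complex_ofReal]
    exact_mod_cast hpos.ne'

namespace Model.Admissible

variable {m : Model}

theorem norm_gauss (m : Model) (x : ℂ) : ‖m.gauss x‖ = Real.exp (-(m.k / 4) * ‖x‖ ^ 2) := by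
  rw [gauss, Complex.mul_conj, Complex.normSq_eq_norm_sq, Complex.norm_exp]
  congr 1
  rw [← Complex.ofReal_ofNat 4, ← Complex.ofReal_div, ← Complex.ofReal_mul, ← Complex.ofReal_neg,
    Complex.ofReal_re]
  ring

/-- The terms linear in `Re z` cancel, and the product equals `e^{-κ(1+|z|²)/2}`. -/
theorem norm_gauss_mul_exp_le (h : m.Admissible) (x : ℂ) :
    ‖m.gauss x‖ * ‖Complex.exp (-(m.κ * conj (m.coord x)))‖ ≤
      Real.exp (-(m.κ / 2) * ‖m.coord x‖ ^ 2) := by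
  rw [norm_gauss, Complex.norm_exp, ← Real.exp_add, Real.exp_le_exp]
  have h1 : ‖x‖ ^ 2 = m.R ^ 2 * (1 - 2 * (m.coord x).re + ‖m.coord x‖ ^ 2) := by
    conv_lhs => rw [h.eq_mul x]
    rw [← Complex.normSq_eq_norm_sq, ← Complex.normSq_eq_norm_sq, Complex.normSq_apply,
      Complex.normSq_apply]
    simp
    ring
  have h2 : (-(m.κ * conj (m.coord x)) : ℂ).re = -(m.κ * (m.coord x).re) := by simp
  have h3 : m.k * m.R ^ 2 = 2 * m.κ := by rw [κ]; ring
  rw [h1, h2]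
  have h4 : -(m.k / 4) * (m.R ^ 2 * (1 - 2 * (m.coord x).re + ‖m.coord x‖ ^ 2)) =
      -(m.κ / 2) * (1 - 2 * (m.coord x).re + ‖m.coord x‖ ^ 2) := by
    linear_combination (-(1 / 4) * (1 - 2 * (m.coord x).re + ‖m.coord x‖ ^ 2)) * h3
  rw [h4]
  nlinarith [h.κ_pos]

theorem integrable_comp_coord (h : m.Admissible) {f : ℂ → ℝ} (hf : Integrable f) :
    Integrable fun x => f (m.coord x) := by
  have hR : -m.R⁻¹ ≠ 0 := neg_ne_zero.2 (inv_ne_zero h.hR.ne')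
  have h1 : Integrable fun y : ℂ => f (1 + y) := hf.comp_add_left 1
  have h2 := (integrable_comp_smul_iff volume (fun y : ℂ => f (1 + y)) hR).2 h1
  refine h2.congr (.of_forall fun x => ?_)
  simp only [coord, Complex.real_smul]

/-- The squared modulus is dominated by `|Im z|^{-2/3}` times a polynomial times a Gaussian, which
is integrable over the plane; the real axis, where the bound fails, is a null set. -/
theorem memLp_φ (h : m.Admissible) : MemLp m.φ 2 volume := by
  have hκ := h.κ_pos
  have hcont : ContinuousOn m.φ m.cutPlane :=
    (h.contDiffOn_φ 0).continuousOn.mono fun x hx => (h.mem_cutPlane_iff.1 hx).2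
  have hmeas := aestronglyMeasurable_of_continuousOn hcont
  rw [memLp_two_iff_integrable_sq_norm hmeas]
  obtain ⟨K, hK0, hK⟩ := exists_norm_kernInt_le h.hα.le h.hαβ h.hβ
  set c : ℝ := m.amp * (Real.sin (Real.pi * m.β) / Real.pi) with hc
  have hc0 : 0 ≤ c := by
    have := h.amp_pos; have := h.sin_pos; have := Real.pi_pos
    positivity
  set M : ℝ := (c * K) ^ 2 * (4 * (1 + 4 / m.κ) ^ 2) * (2 : ℝ) ^ (2 / 3 : ℝ) with hM
  have hdom : Integrable fun x => M * (|(m.coord x).im| ^ (-(2 / 3) : ℝ) *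
      Real.exp (-(m.κ / 2) * ‖m.coord x‖ ^ 2)) :=
    (h.integrable_comp_coord (integrable_im_rpow_mul_gaussian (half_pos hκ) (by norm_num))).const_mul M
  refine hdom.mono' (hmeas.norm.pow 2) ?_
  have him : ∀ᵐ x : ℂ, (m.coord x).im ≠ 0 := by
    have h0 : ∀ᵐ x : ℂ, x.im ≠ 0 := by
      have hv : volume ((LinearMap.ker Complex.imLm : Submodule ℝ ℂ) : Set ℂ) = 0 := by
        refine Measure.addHaar_submodule _ _ fun hT => ?_
        have : Complex.I ∈ (LinearMap.ker Complex.imLm : Submodule ℝ ℂ) := hT ▸ Submodule.mem_top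
        simp at this
      refine measure_mono_null (fun x hx => ?_) hv
      simpa using hx
    filter_upwards [h0] with x hx
    rw [h.coord_im]
    exact div_ne_zero (neg_ne_zero.2 hx) h.hR.ne'
  filter_upwards [him] with x hx
  have hz : m.coord x ∈ Complex.slitPlane := Or.inr hx
  have h1 := hK m.κ hκ.le (m.coord x) hx
  have h2 := h.norm_gauss_mul_exp_le x
  have hy : 0 < |(m.coord x).im| := abs_pos.2 hx
  rw [Real.norm_of_nonneg (by positivity)]
  have h3 : ‖m.φ x‖ ≤ c * (K * ((1 + ‖m.coord x‖) ^ 2 * (|(m.coord x).im| / 2) ^ (-(1 / 3) : ℝ)) *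
      Real.exp (-(m.κ / 2) * ‖m.coord x‖ ^ 2)) := by
    rw [h.φ_eq hz, norm_mul, Complex.norm_real, ← hc, norm_neg, Real.norm_of_nonneg hc0, corr]
    simp only [norm_mul, Complex.norm_cpow_real]
    calc _ = c * ((‖m.coord x‖ ^ m.β * ‖kernInt m.α m.β m.κ 0 1 (m.coord x)‖) *
          (‖m.gauss x‖ * ‖Complex.exp (-(m.κ * conj (m.coord x)))‖)) := by ring
      _ ≤ _ := by gcongr
  have h4 := one_add_pow_four_le (r := ‖m.coord x‖) hκ
  have h5 : ((|(m.coord x).im| / 2) ^ (-(1 / 3) : ℝ)) ^ 2 =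
      (2 : ℝ) ^ (2 / 3 : ℝ) * |(m.coord x).im| ^ (-(2 / 3) : ℝ) := by
    rw [← Real.rpow_natCast, ← Real.rpow_mul (by positivity), Real.div_rpow hy.le (by norm_num)]
    norm_num
    rw [Real.rpow_neg (x := 2) (by norm_num), div_inv_eq_mul, mul_comm]
  have h6 : Real.exp (-(m.κ / 2) * ‖m.coord x‖ ^ 2) ^ 2 =
      Real.exp (-(m.κ / 2) * ‖m.coord x‖ ^ 2) * Real.exp (-(m.κ / 2) * ‖m.coord x‖ ^ 2) := sq _
  have h7 : Real.exp (m.κ / 2 * ‖m.coord x‖ ^ 2) * Real.exp (-(m.κ / 2) * ‖m.coord x‖ ^ 2) = 1 := by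
    rw [← Real.exp_add]; simp
  calc ‖m.φ x‖ ^ 2 ≤ (c * (K * ((1 + ‖m.coord x‖) ^ 2 *
        (|(m.coord x).im| / 2) ^ (-(1 / 3) : ℝ)) *
        Real.exp (-(m.κ / 2) * ‖m.coord x‖ ^ 2))) ^ 2 := by gcongr
    _ = (c * K) ^ 2 * ((1 + ‖m.coord x‖) ^ 4) * ((|(m.coord x).im| / 2) ^ (-(1 / 3) : ℝ)) ^ 2 *
        Real.exp (-(m.κ / 2) * ‖m.coord x‖ ^ 2) ^ 2 := by ring
    _ ≤ (c * K) ^ 2 * (4 * (1 + 4 / m.κ) ^ 2 * Real.exp (m.κ / 2 * ‖m.coord x‖ ^ 2)) *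
        ((|(m.coord x).im| / 2) ^ (-(1 / 3) : ℝ)) ^ 2 *
        Real.exp (-(m.κ / 2) * ‖m.coord x‖ ^ 2) ^ 2 := by gcongr
    _ = M * (|(m.coord x).im| ^ (-(2 / 3) : ℝ) * Real.exp (-(m.κ / 2) * ‖m.coord x‖ ^ 2)) := by
        rw [h5, h6, hM]
        linear_combination ((c * K) ^ 2 * (4 * (1 + 4 / m.κ) ^ 2) * (2 : ℝ) ^ (2 / 3 : ℝ) *
          |(m.coord x).im| ^ (-(2 / 3) : ℝ) * Real.exp (-(m.κ / 2) * ‖m.coord x‖ ^ 2)) * h7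

theorem memLp_ψ₁ (h : m.Admissible) : MemLp m.ψ₁ 2 volume := by
  have hk := h.k_pos
  have hR := h.hR
  set f : ℂ → ℂ := fun x => (m.amp : ℂ) * (m.gauss x * (1 - m.coord x) ^ (m.α : ℂ)) with hf
  have hcont : ContinuousOn m.ψ₁ m.cutPlane := by
    have h1 : ContinuousOn f m.cutPlane :=
      continuousOn_const.mul ((m.contDiff_gauss (n := 0)).continuous.continuousOn.mul
        ((contDiffOn_one_sub_cpow (m.α : ℂ) (n := 0)).continuousOn.comp
          (contDiff_coord m (n := 0)).continuous.continuousOn fun x hx =>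
            (h.mem_reduced_iff.1 hx).1))
    exact h1.congr fun x hx => h.ψ₁_eq (Complex.slitPlane_ne_zero (h.mem_cutPlane_iff.1 hx).1)
  have hmeas := aestronglyMeasurable_of_continuousOn hcont
  rw [memLp_two_iff_integrable_sq_norm hmeas]
  set M : ℝ := m.amp ^ 2 * (1 + m.R⁻¹) ^ 2 * (4 * (1 + 4 / (m.k / 2)) ^ 2) with hM
  have hg : Integrable fun x : ℂ => Real.exp (-(m.k / 4) * ‖x‖ ^ 2) := by
    have h0 := integrable_im_rpow_mul_gaussian (c := m.k / 4) (s := 0) (by positivity) (by norm_num)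
    simpa using h0
  have hdom := hg.const_mul M
  refine hdom.mono' (hmeas.norm.pow 2) ?_
  filter_upwards [m.ae_mem_cutPlane] with x hx
  have hx1 := (h.mem_cutPlane_iff.1 hx).1
  have e4 : 1 - m.coord x = ((m.R⁻¹ : ℝ) : ℂ) * x := by rw [coord]; push_cast; ring
  rw [Real.norm_of_nonneg (by positivity), h.ψ₁_eq (Complex.slitPlane_ne_zero hx1), norm_mul,
    norm_mul, Complex.norm_cpow_real, e4, norm_mul, Complex.norm_real, Complex.norm_real,
    Real.norm_of_nonneg h.amp_pos.le, Real.norm_of_nonneg (inv_pos.2 hR).le, norm_gauss]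
  have h1 : (m.R⁻¹ * ‖x‖) ^ m.α ≤ (1 + m.R⁻¹) * (1 + ‖x‖) ^ 2 := by
    have hi := inv_pos.2 hR
    calc (m.R⁻¹ * ‖x‖) ^ m.α ≤ ((1 + m.R⁻¹) * (1 + ‖x‖)) ^ m.α := by
          refine Real.rpow_le_rpow (by positivity) ?_ h.hα.le
          nlinarith [norm_nonneg x]
      _ ≤ ((1 + m.R⁻¹) * (1 + ‖x‖)) ^ (1 : ℝ) :=
          Real.rpow_le_rpow_of_exponent_le (by nlinarith [norm_nonneg x])
            (by linarith [h.hαβ, h.hβ])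
      _ = (1 + m.R⁻¹) * (1 + ‖x‖) := Real.rpow_one _
      _ ≤ _ := by
          gcongr
          nlinarith [norm_nonneg x]
  have h4 := one_add_pow_four_le (κ := m.k / 2) (r := ‖x‖) (half_pos hk)
  have h6 : Real.exp (-(m.k / 4) * ‖x‖ ^ 2) ^ 2 =
      Real.exp (-(m.k / 4) * ‖x‖ ^ 2) * Real.exp (-(m.k / 4) * ‖x‖ ^ 2) := sq _
  have h7 : Real.exp (m.k / 2 / 2 * ‖x‖ ^ 2) * Real.exp (-(m.k / 4) * ‖x‖ ^ 2) = 1 := by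
    rw [← Real.exp_add, ← Real.exp_zero]; congr 1; ring
  have ha := h.amp_pos
  calc (m.amp * (Real.exp (-(m.k / 4) * ‖x‖ ^ 2) * (m.R⁻¹ * ‖x‖) ^ m.α)) ^ 2
      ≤ (m.amp * (Real.exp (-(m.k / 4) * ‖x‖ ^ 2) * ((1 + m.R⁻¹) * (1 + ‖x‖) ^ 2))) ^ 2 := by
        gcongr
    _ = m.amp ^ 2 * (1 + m.R⁻¹) ^ 2 * (1 + ‖x‖) ^ 4 * Real.exp (-(m.k / 4) * ‖x‖ ^ 2) ^ 2 := by
        ring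
    _ ≤ m.amp ^ 2 * (1 + m.R⁻¹) ^ 2 * (4 * (1 + 4 / (m.k / 2)) ^ 2 *
        Real.exp (m.k / 2 / 2 * ‖x‖ ^ 2)) * Real.exp (-(m.k / 4) * ‖x‖ ^ 2) ^ 2 := by gcongr
    _ = M * Real.exp (-(m.k / 4) * ‖x‖ ^ 2) := by
        rw [h6, hM]
        linear_combination (m.amp ^ 2 * (1 + m.R⁻¹) ^ 2 * (4 * (1 + 4 / (m.k / 2)) ^ 2) *
          Real.exp (-(m.k / 4) * ‖x‖ ^ 2)) * h7

/-! ### Nonvanishing. -/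

theorem coord_ofReal (h : m.Admissible) (t : ℝ) : m.coord ((m.R * (1 - t) : ℝ) : ℂ) = t := by
  have : (m.R : ℂ) ≠ 0 := by exact_mod_cast h.hR.ne'
  rw [h.coord_eq]; push_cast; field_simp; ring

theorem mem_cutPlane_ofReal (h : m.Admissible) {t : ℝ} (h0 : 0 < t) (h1 : t < 1) :
    ((m.R * (1 - t) : ℝ) : ℂ) ∈ m.cutPlane := by
  rw [h.mem_cutPlane_iff, h.coord_ofReal]
  exact ⟨Complex.ofReal_mem_slitPlane.2 (mul_pos h.hR (sub_pos.2 h1)),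
    Complex.ofReal_mem_slitPlane.2 h0⟩

theorem exists_φ_ne_zero (h : m.Admissible) : ∃ x ∈ m.cutPlane, m.φ x ≠ 0 := by
  have hx := h.mem_cutPlane_ofReal (t := 1 / 2) (by norm_num) (by norm_num)
  refine ⟨_, hx, ?_⟩
  rw [h.φ_eq (h.mem_cutPlane_iff.1 hx).2, h.coord_ofReal]
  have h1 := h.amp_pos
  have h2 := h.sin_pos
  have h3 := Real.pi_pos
  refine mul_ne_zero ?_ (mul_ne_zero (Complex.exp_ne_zero _)
    (corr_ofReal_ne_zero h.hαβ h.hβ h.κ_pos (by norm_num)))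
  have h4 : m.amp * (Real.sin (Real.pi * m.β) / Real.pi) ≠ 0 := by positivity
  exact_mod_cast neg_ne_zero.2 h4

/-- If `ψ̃₂` vanished, `(1 - t)^α` would be a multiple of `corr` on `(0, 1)`. As `t → 1`, at the
first solenoid, the former tends to `0`, whereas `corr` is continuous and nonzero at `1`. -/
theorem exists_ψ₂approx_ne_zero (h : m.Admissible) : ∃ x ∈ m.cutPlane, m.ψ₂approx x ≠ 0 := by
  by_contra hc
  push Not at hc
  have hs : ((Real.sin (Real.pi * m.β) / Real.pi : ℝ) : ℂ) ≠ 0 := by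
    have : Real.sin (Real.pi * m.β) / Real.pi ≠ 0 := div_ne_zero h.sin_pos.ne' Real.pi_ne_zero
    exact_mod_cast this
  have h1 : ∀ t ∈ Ioo (0 : ℝ) 1, (((1 - t) ^ m.α : ℝ) : ℂ) =
      ((Real.sin (Real.pi * m.β) / Real.pi : ℝ) : ℂ) * corr m.α m.β m.κ t := by
    intro t ht
    have hx := h.mem_cutPlane_ofReal ht.1 ht.2
    have h2 := hc _ hx
    rw [h.ψ₂approx_eq_gauss_mul hx, h.coord_ofReal, mul_eq_zero, mul_eq_zero] at h2
    have h3 := (h2.resolve_left (Complex.exp_ne_zero _)).resolve_left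
      (by exact_mod_cast h.amp_pos.ne')
    rw [Complex.ofReal_cpow (by linarith [ht.2])]
    push_cast at h3 ⊢
    exact sub_eq_zero.1 h3
  have h2 : ContinuousAt (fun t : ℝ => ((Real.sin (Real.pi * m.β) / Real.pi : ℝ) : ℂ) *
      corr m.α m.β m.κ t) 1 := by
    have h3 : ContinuousAt (corr m.α m.β m.κ) ((1 : ℝ) : ℂ) := (corr_wirtinger h.hαβ h.hβ h.κ_pos
      (Complex.ofReal_mem_slitPlane.2 one_pos)).continuousAt
    exact continuousAt_const.mul (h3.comp (f := fun t : ℝ => (t : ℂ))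
      Complex.continuous_ofReal.continuousAt)
  have h3 : ContinuousAt (fun t : ℝ => (((1 - t) ^ m.α : ℝ) : ℂ)) 1 := by
    refine Complex.continuous_ofReal.continuousAt.comp ?_
    exact ContinuousAt.rpow_const (by fun_prop) (Or.inr h.hα.le)
  have h4 := h2.tendsto.mono_left (nhdsWithin_le_nhds (s := Iio 1))
  have h5 := h3.tendsto.mono_left (nhdsWithin_le_nhds (s := Iio 1))
  have h6 := tendsto_nhds_unique (h5.congr' (by
    filter_upwards [Ioo_mem_nhdsLT (show (0 : ℝ) < 1 from one_pos)] with t ht using h1 t ht)) h4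
  rw [sub_self, Real.zero_rpow h.hα.ne', Complex.ofReal_zero] at h6
  exact mul_ne_zero hs (corr_ofReal_ne_zero h.hαβ h.hβ h.κ_pos one_pos) h6.symm

theorem isEigenfunction_φ (h : m.Admissible) : m.IsEigenfunction m.E₁ m.φ :=
  isEigenfunction_of_classical h.memLp_φ
    ((h.contDiffOn_φ 2).mono fun _ hx => (h.mem_cutPlane_iff.1 hx).2) (fun _ hx => h.HB_φ hx)
    h.exists_φ_ne_zero

theorem isEigenfunction_ψ₂approx (h : m.Admissible) : m.IsEigenfunction m.E₁ m.ψ₂approx :=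
  isEigenfunction_of_classical (h.memLp_ψ₁.add h.memLp_φ) (h.contDiffOn_ψ₂approx 2)
    (fun _ hx => h.HB_ψ₂approx hx) h.exists_ψ₂approx_ne_zero

end Model.Admissible

/-! ### Parameter integrals of class `C¹`. -/

theorem exists_bound_nhds {U : Set ℂ} (hU : IsOpen U) {F : ℂ → ℝ → ℂ}
    (hF : ContinuousOn (Function.uncurry F) (U ×ˢ Icc 0 1)) {z : ℂ} (hz : z ∈ U) :
    ∃ s ∈ 𝓝 z, s ⊆ U ∧ ∃ C, ∀ w ∈ s, ∀ t ∈ Icc (0 : ℝ) 1, ‖F w t‖ ≤ C := by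
  obtain ⟨ε, hε, hs⟩ := Metric.nhds_basis_closedBall.mem_iff.1 (hU.mem_nhds hz)
  obtain ⟨C, hC⟩ := ((isCompact_closedBall z ε).prod (isCompact_Icc (a := (0 : ℝ))
    (b := 1))).exists_bound_of_continuousOn (hF.mono (prod_mono hs subset_rfl))
  exact ⟨_, Metric.closedBall_mem_nhds z hε, hs, C, fun w hw t ht => hC (w, t) ⟨hw, ht⟩⟩

theorem aestronglyMeasurable_weight_mul {w : ℝ → ℂ} (hw : IntegrableOn w (Ioo 0 1)) {U : Set ℂ}
    {F : ℂ → ℝ → ℂ} (hF : ContinuousOn (Function.uncurry F) (U ×ˢ Icc 0 1)) {z : ℂ} (hz : z ∈ U) :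
    AEStronglyMeasurable (fun t => w t * F z t) (volume.restrict (Ioo 0 1)) := by
  refine hw.aestronglyMeasurable.mul (ContinuousOn.aestronglyMeasurable ?_ measurableSet_Ioo)
  exact hF.comp (f := fun t : ℝ => (z, t)) (by fun_prop) fun t ht => ⟨hz, Ioo_subset_Icc_self ht⟩

theorem continuousOn_integral_weight_mul {w : ℝ → ℂ} (hw : IntegrableOn w (Ioo 0 1)) {U : Set ℂ}
    (hU : IsOpen U) {F : ℂ → ℝ → ℂ} (hF : ContinuousOn (Function.uncurry F) (U ×ˢ Icc 0 1)) :
    ContinuousOn (fun z => ∫ t in Ioo (0 : ℝ) 1, w t * F z t) U := by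
  intro z hz
  obtain ⟨s, hs, hsU, C, hC⟩ := exists_bound_nhds hU hF hz
  refine ContinuousAt.continuousWithinAt (continuousAt_of_dominated
    (bound := fun t => ‖w t‖ * C) ?_ ?_ (hw.norm.mul_const C) ?_)
  · filter_upwards [hs] with y hy using aestronglyMeasurable_weight_mul hw hF (hsU hy)
  · filter_upwards [hs] with y hy
    refine (ae_restrict_iff' measurableSet_Ioo).2 (.of_forall fun t ht => ?_)
    rw [norm_mul]
    gcongr
    exact hC y hy t (Ioo_subset_Icc_self ht)
  · refine (ae_restrict_iff' measurableSet_Ioo).2 (.of_forall fun t ht => ?_)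
    have h1 : ContinuousOn (fun y : ℂ => F y t) U :=
      hF.comp (f := fun y : ℂ => (y, t)) (by fun_prop) fun y hy => ⟨hy, Ioo_subset_Icc_self ht⟩
    exact continuousAt_const.mul (h1.continuousAt (hU.mem_nhds hz))

/-- An integral over a compact interval of a kernel of class `C¹` with an integrable weight. -/
theorem contDiffOn_integral_weight_mul {w : ℝ → ℂ} (hw : IntegrableOn w (Ioo 0 1)) {U : Set ℂ}
    (hU : IsOpen U) {F F₁ F₂ : ℂ → ℝ → ℂ}
    (hFm : ∀ z, AEStronglyMeasurable (F z) (volume.restrict (Ioo 0 1)))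
    (hF : ContinuousOn (Function.uncurry F) (U ×ˢ Icc 0 1))
    (hF₁ : ContinuousOn (Function.uncurry F₁) (U ×ˢ Icc 0 1))
    (hF₂ : ContinuousOn (Function.uncurry F₂) (U ×ˢ Icc 0 1))
    (hd : ∀ z ∈ U, ∀ t ∈ Ioo (0 : ℝ) 1, HasWirtingerAt (fun z => F z t) (F₁ z t) (F₂ z t) z) :
    ContDiffOn ℝ 1 (fun z => ∫ t in Ioo (0 : ℝ) 1, w t * F z t) U := by
  refine contDiffOn_succ_of_wirtinger (n := 0) hU (fun z hz => ?_)
    (contDiffOn_zero.2 (continuousOn_integral_weight_mul hw hU hF₁))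
    (contDiffOn_zero.2 (continuousOn_integral_weight_mul hw hU hF₂))
  obtain ⟨s₀, hs₀, hsU₀, C₀, hC₀⟩ := exists_bound_nhds hU hF hz
  obtain ⟨s₁, hs₁, hsU₁, C₁, hC₁⟩ := exists_bound_nhds hU hF₁ hz
  obtain ⟨s₂, hs₂, hsU₂, C₂, hC₂⟩ := exists_bound_nhds hU hF₂ hz
  refine HasWirtingerAt.integral (bound := fun t => ‖w t‖ * max C₁ C₂) (inter_mem hs₁ hs₂)
    (F := fun z t => w t * F z t) (F₁ := fun z t => w t * F₁ z t) (F₂ := fun z t => w t * F₂ z t)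
    (fun y => hw.aestronglyMeasurable.mul (hFm y)) ?_
    (aestronglyMeasurable_weight_mul hw hF₁ hz) (aestronglyMeasurable_weight_mul hw hF₂ hz)
    (hw.norm.mul_const _) ?_ ?_ ?_
  · refine (hw.norm.mul_const C₀).mono' (aestronglyMeasurable_weight_mul hw hF hz) ?_
    refine (ae_restrict_iff' measurableSet_Ioo).2 (.of_forall fun t ht => ?_)
    rw [norm_mul]
    gcongr
    exact hC₀ z (mem_of_mem_nhds hs₀) t (Ioo_subset_Icc_self ht)
  · refine (ae_restrict_iff' measurableSet_Ioo).2 (.of_forall fun t ht y hy => ?_)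
    rw [norm_mul]
    gcongr
    exact (hC₁ y hy.1 t (Ioo_subset_Icc_self ht)).trans (le_max_left _ _)
  · refine (ae_restrict_iff' measurableSet_Ioo).2 (.of_forall fun t ht y hy => ?_)
    rw [norm_mul]
    gcongr
    exact (hC₂ y hy.2 t (Ioo_subset_Icc_self ht)).trans (le_max_right _ _)
  · exact (ae_restrict_iff' measurableSet_Ioo).2 (.of_forall fun t ht y hy =>
      (hd y (hsU₁ hy.1) t ht).const_mul _)

theorem integrableOn_rpow_Ioo {r : ℝ} (hr : -1 < r) :
    IntegrableOn (fun t : ℝ => ((t ^ r : ℝ) : ℂ)) (Ioo 0 1) := by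
  have h := intervalIntegral.intervalIntegrable_rpow' (a := 0) (b := 1) hr
  rw [intervalIntegrable_iff_integrableOn_Ioo_of_le zero_le_one] at h
  exact h.ofReal

theorem contDiffOn_incBeta {a b : ℝ} (hb : 0 < b) :
    ContDiffOn ℝ 1 (incBeta a b) {z | 1 - z ∈ Complex.slitPlane} := by
  have hU : IsOpen {z : ℂ | 1 - z ∈ Complex.slitPlane} :=
    Complex.isOpen_slitPlane.preimage (by fun_prop)
  have hmem : ∀ p ∈ {z : ℂ | 1 - z ∈ Complex.slitPlane} ×ˢ Icc (0 : ℝ) 1,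
      1 - (p.2 : ℂ) * p.1 ∈ Complex.slitPlane := fun p hp =>
    one_sub_mul_mem_slitPlane hp.1 hp.2.1 hp.2.2
  have hc : ∀ c : ℂ, ContinuousOn (fun p : ℂ × ℝ => (1 - (p.2 : ℂ) * p.1) ^ c)
      ({z : ℂ | 1 - z ∈ Complex.slitPlane} ×ˢ Icc (0 : ℝ) 1) := fun c =>
    ContinuousOn.cpow_const (by fun_prop) hmem
  have h := contDiffOn_integral_weight_mul (integrableOn_rpow_Ioo (r := b - 1) (by linarith)) hU
    (F := fun z t => (1 - (t : ℂ) * z) ^ (-(a : ℂ) - 1))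
    (F₁ := fun z t => (a + 1) * t * (1 - (t : ℂ) * z) ^ (-(a : ℂ) - 1 - 1)) (F₂ := fun _ _ => 0)
    (fun z => (by fun_prop : Measurable _).aestronglyMeasurable) (hc _)
    (ContinuousOn.mul (by fun_prop) (hc _)) continuousOn_const ?_
  · refine h.congr fun z hz => ?_
    rw [incBeta, intervalIntegral.integral_of_le zero_le_one, integral_Ioc_eq_integral_Ioo]
  · intro z hz t ht
    have h1 := (((hasDerivAt_id' z).const_mul (t : ℂ)).const_sub 1).cpow_const
      (c := -(a : ℂ) - 1) (hmem (z, t) ⟨hz, Ioo_subset_Icc_self ht⟩)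
    exact (HasWirtingerAt.of_hasDerivAt h1).congr_val (by ring) rfl

/-- The singularity in `t` is confined to the weight. The kernel is an entire function of
polynomials in `z`, `z̄`, `t`, so no branch cut enters. -/
theorem contDiffOn_integral_exp_mul {κ : ℝ} {w : ℝ → ℂ} (hw : IntegrableOn w (Ioo 0 1)) {u : ℂ → ℂ}
    (hu : Differentiable ℂ u) :
    ContDiffOn ℝ 1 (fun z => ∫ t in Ioo (0 : ℝ) 1,
      w t * (Complex.exp (-(κ * conj z * t)) * u (κ * (z * conj z) * t))) univ := by
  have hcu : Continuous u := hu.continuous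
  have hcu' : Continuous (deriv u) := (hu.contDiff (n := 1)).continuous_deriv le_rfl
  have hcj : Continuous (fun z : ℂ => conj z) := Complex.continuous_conj
  refine contDiffOn_integral_weight_mul hw isOpen_univ
    (F₁ := fun z t => Complex.exp (-(κ * conj z * t)) *
      (deriv u (κ * (z * conj z) * t) * (κ * conj z * t)))
    (F₂ := fun z t => Complex.exp (-(κ * conj z * t)) *
      (-(κ * t) * u (κ * (z * conj z) * t) + deriv u (κ * (z * conj z) * t) * (κ * z * t)))
    (fun z => Continuous.aestronglyMeasurable (by fun_prop)) ?_ ?_ ?_ ?_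
  · exact Continuous.continuousOn (by simp only [Function.uncurry_def]; fun_prop)
  · exact Continuous.continuousOn (by simp only [Function.uncurry_def]; fun_prop)
  · exact Continuous.continuousOn (by simp only [Function.uncurry_def]; fun_prop)
  · intro z _ t _
    have h1 := HasWirtingerAt.comp_deriv (φ := Complex.exp) (Complex.hasDerivAt_exp _)
      ((HasWirtingerAt.conj_id z).const_mul (-(κ * t) : ℂ))
    have h2 := HasWirtingerAt.comp_deriv (φ := u) (hu _).hasDerivAt
      (((HasWirtingerAt.id z).mul (HasWirtingerAt.conj_id z)).const_mul (κ * t : ℂ))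
    refine ((h1.mul h2).congr_val ?_ ?_).congr_of_eventuallyEq (.of_forall fun y => ?_)
    · rw [show (-(κ * t) : ℂ) * conj z = -(κ * conj z * t) by ring,
        show (κ * t : ℂ) * (z * conj z) = κ * (z * conj z) * t by ring]
      ring
    · rw [show (-(κ * t) : ℂ) * conj z = -(κ * conj z * t) by ring,
        show (κ * t : ℂ) * (z * conj z) = κ * (z * conj z) * t by ring]
      ring
    · beta_reduce
      rw [show (-(κ * t) : ℂ) * conj y = -(κ * conj y * t) by ring,
        show (κ * t : ℂ) * (y * conj y) = κ * (y * conj y) * t by ring]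

/-- In the two-term Kummer expansion, `z` enters through entire functions and the power
`(κ|z|²)^{-b}`. Hence only the origin is excluded, and the integral is `C¹` across the negative
axis. -/
theorem contDiffOn_integral_laplaceInt {a b κ : ℝ} (ha : 0 ≤ a) (hab : a < b) (hb : b < 1)
    (hκ : 0 < κ) :
    ContDiffOn ℝ 1 (fun z : ℂ => ∫ t in Ioo (0 : ℝ) 1, Complex.exp (-(κ * conj z * t)) *
      laplaceInt a b 1 (κ * ‖z‖ ^ 2 * t)) {0}ᶜ := by
  set u := hyp1F1 (-(a : ℂ)) ((1 - b : ℝ) : ℂ) with hu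
  set m := hyp1F1 ((b - a : ℝ) : ℂ) ((b + 1 : ℝ) : ℂ) with hm
  have hdu : Differentiable ℂ u := differentiable_hyp1F1 _ _
  have hdm : Differentiable ℂ m := differentiable_hyp1F1 _ _
  have hw1 := integrableOn_rpow_Ioo (r := -b) (by linarith)
  have hw2 : IntegrableOn (fun _ : ℝ => (1 : ℂ)) (Ioo 0 1) :=
    (continuous_const.integrableOn_Icc (a := 0) (b := 1)).mono_set Ioo_subset_Icc_self
  have c1 := (contDiffOn_integral_exp_mul (κ := κ) hw1 hdu).mono (subset_univ {0}ᶜ)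
  have c2 := (contDiffOn_integral_exp_mul (κ := κ) hw2 hdm).mono (subset_univ {0}ᶜ)
  have c3 : ContDiffOn ℝ 1 (fun z : ℂ => ((Real.Gamma b * (κ * ‖z‖ ^ 2) ^ (-b) : ℝ) : ℂ)) {0}ᶜ := by
    refine Complex.ofRealCLM.contDiff.comp_contDiffOn (contDiffOn_const.mul ?_)
    refine ContDiffOn.rpow_const_of_ne (contDiff_const.mul (contDiff_norm_sq ℝ)).contDiffOn
      fun z hz => ?_
    have : 0 < ‖z‖ := norm_pos_iff.2 hz
    positivity
  refine ((c3.mul c1).add (contDiffOn_const (c := ((a / b * betaConst a b : ℝ) : ℂ)).mul c2)).congr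
    fun z hz => ?_
  have hz0 : 0 < ‖z‖ := norm_pos_iff.2 hz
  have hcj : Continuous (fun z : ℂ => conj z) := Complex.continuous_conj
  have i1 : IntegrableOn (fun t : ℝ => ((t ^ (-b) : ℝ) : ℂ) *
      (Complex.exp (-(κ * conj z * t)) * u (κ * (z * conj z) * t))) (Ioo 0 1) :=
    (((integrableOn_Icc_iff_integrableOn_Ioo).2 hw1).mul_continuousOn
      (g' := fun t : ℝ => Complex.exp (-(κ * conj z * t)) * u (κ * (z * conj z) * t))
      (by have := hdu.continuous; fun_prop) isCompact_Icc).mono_set Ioo_subset_Icc_self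
  have i2 : IntegrableOn (fun t : ℝ => (1 : ℂ) *
      (Complex.exp (-(κ * conj z * t)) * m (κ * (z * conj z) * t))) (Ioo 0 1) :=
    (((integrableOn_Icc_iff_integrableOn_Ioo).2 hw2).mul_continuousOn
      (g' := fun t : ℝ => Complex.exp (-(κ * conj z * t)) * m (κ * (z * conj z) * t))
      (by have := hdm.continuous; fun_prop) isCompact_Icc).mono_set Ioo_subset_Icc_self
  rw [← integral_const_mul, ← integral_const_mul, ← integral_add (i1.const_mul _) (i2.const_mul _)]
  refine setIntegral_congr_fun measurableSet_Ioo fun t ht => ?_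
  have ht0 : 0 < t := ht.1
  have e : (κ : ℂ) * (z * conj z) * t = ((κ * ‖z‖ ^ 2 * t : ℝ) : ℂ) := by
    rw [Complex.mul_conj, Complex.normSq_eq_norm_sq]; push_cast; ring
  rw [laplaceInt_eq_kummer ha hab hb (by positivity), e, Real.mul_rpow (by positivity) ht0.le, ← hu,
    ← hm]
  push_cast
  ring

/-! ### The boundary conditions on `L_b`. -/

/-- `ρ^β e^{iβθ} T(ρ e^{iθ})`. -/
noncomputable def twisted (β : ℝ) (T : ℂ → ℂ) (ρ θ : ℝ) : ℂ :=
  ((ρ ^ β : ℝ) : ℂ) * (Complex.exp (Complex.I * (β * θ)) * T (ρ * Complex.exp (Complex.I * θ)))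

/-- The angular derivative of `twisted`. -/
noncomputable def twistedDeriv (β : ℝ) (T : ℂ → ℂ) (ρ θ : ℝ) : ℂ :=
  ((ρ ^ β : ℝ) : ℂ) * (Complex.exp (Complex.I * (β * θ)) *
    (Complex.I * β * T (ρ * Complex.exp (Complex.I * θ)) +
      fderiv ℝ T (ρ * Complex.exp (Complex.I * θ))
        (Complex.I * (ρ * Complex.exp (Complex.I * θ)))))

theorem hasDerivAt_twisted {β : ℝ} {T : ℂ → ℂ} {ρ θ : ℝ}
    (hT : DifferentiableAt ℝ T (ρ * Complex.exp (Complex.I * θ))) :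
    HasDerivAt (twisted β T ρ) (twistedDeriv β T ρ θ) θ := by
  have h0 : HasDerivAt (fun θ : ℝ => (θ : ℂ)) 1 θ := (hasDerivAt_id' θ).ofReal_comp
  have h1 := ((h0.const_mul (β : ℂ)).const_mul Complex.I).cexp
  have h2 := ((h0.const_mul Complex.I).cexp).const_mul (ρ : ℂ)
  have h3 := hT.hasFDerivAt.comp_hasDerivAt θ h2
  have h4 := (h1.mul h3).const_mul ((ρ ^ β : ℝ) : ℂ)
  convert! h4 using 1
  rw [twistedDeriv, show (ρ : ℂ) * (Complex.exp (Complex.I * θ) * (Complex.I * 1)) =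
    Complex.I * (ρ * Complex.exp (Complex.I * θ)) by ring]
  simp only [Function.comp_apply]
  ring

theorem exp_neg_pi_shift (β : ℝ) :
    Complex.exp (Complex.I * (β * Real.pi)) =
      Complex.exp (2 * Real.pi * Complex.I * β) *
        Complex.exp (Complex.I * (β * ((-Real.pi : ℝ) : ℂ))) := by
  rw [← Complex.exp_add]; congr 1; push_cast; ring

theorem exp_I_pi : Complex.exp (Complex.I * Real.pi) = -1 := by
  rw [mul_comm, Complex.exp_pi_mul_I]

theorem exp_I_neg_pi : Complex.exp (Complex.I * ((-Real.pi : ℝ) : ℂ)) = -1 := by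
  rw [Complex.ofReal_neg, mul_neg, Complex.exp_neg, exp_I_pi]; norm_num

/-- The angles `±π` give the same point, hence the same value of `T`; only `e^{iβθ}` differs. -/
theorem twisted_pi (β : ℝ) (T : ℂ → ℂ) (ρ : ℝ) : twisted β T ρ Real.pi =
    Complex.exp (2 * Real.pi * Complex.I * β) * twisted β T ρ (-Real.pi) := by
  rw [twisted, twisted, exp_neg_pi_shift, exp_I_pi, exp_I_neg_pi]; ring

theorem twistedDeriv_pi (β : ℝ) (T : ℂ → ℂ) (ρ : ℝ) : twistedDeriv β T ρ Real.pi =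
    Complex.exp (2 * Real.pi * Complex.I * β) * twistedDeriv β T ρ (-Real.pi) := by
  rw [twistedDeriv, twistedDeriv, exp_neg_pi_shift, exp_I_pi, exp_I_neg_pi]; ring

section

variable {β : ℝ} {T : ℂ → ℂ} {ρ θ : ℝ}

theorem continuousAt_twisted (hT : ContinuousAt T (ρ * Complex.exp (Complex.I * θ))) (hρ : 0 < ρ) :
    ContinuousAt (fun p : ℝ × ℝ => twisted β T p.1 p.2) (ρ, θ) := by
  have h1 : ContinuousAt (fun p : ℝ × ℝ => ((p.1 ^ β : ℝ) : ℂ)) (ρ, θ) :=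
    Complex.continuous_ofReal.continuousAt.comp
      (ContinuousAt.rpow_const continuousAt_fst (Or.inl hρ.ne'))
  have h2 : ContinuousAt (fun p : ℝ × ℝ => (p.1 : ℂ) * Complex.exp (Complex.I * p.2)) (ρ, θ) := by
    fun_prop
  exact h1.mul (ContinuousAt.mul (by fun_prop) (ContinuousAt.comp (g := T)
    (f := fun p : ℝ × ℝ => (p.1 : ℂ) * Complex.exp (Complex.I * p.2)) hT h2))

theorem continuousAt_twistedDeriv (hT : ContinuousAt T (ρ * Complex.exp (Complex.I * θ)))
    (hT' : ContinuousAt (fderiv ℝ T) (ρ * Complex.exp (Complex.I * θ))) (hρ : 0 < ρ) :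
    ContinuousAt (fun p : ℝ × ℝ => twistedDeriv β T p.1 p.2) (ρ, θ) := by
  have h1 : ContinuousAt (fun p : ℝ × ℝ => ((p.1 ^ β : ℝ) : ℂ)) (ρ, θ) :=
    Complex.continuous_ofReal.continuousAt.comp
      (ContinuousAt.rpow_const continuousAt_fst (Or.inl hρ.ne'))
  have h2 : ContinuousAt (fun p : ℝ × ℝ => (p.1 : ℂ) * Complex.exp (Complex.I * p.2)) (ρ, θ) := by
    fun_prop
  have h3 := ContinuousAt.comp (g := T)
    (f := fun p : ℝ × ℝ => (p.1 : ℂ) * Complex.exp (Complex.I * p.2)) hT h2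
  have h4 := ContinuousAt.comp (g := fderiv ℝ T)
    (f := fun p : ℝ × ℝ => (p.1 : ℂ) * Complex.exp (Complex.I * p.2)) hT' h2
  exact h1.mul (ContinuousAt.mul (by fun_prop) ((continuousAt_const.mul h3).add
    (h4.clm_apply (continuousAt_const.mul h2))))

end

theorem isOpen_angles : IsOpen {θ : ℝ | Real.pi / 2 < |θ| ∧ |θ| < Real.pi} :=
  (isOpen_lt continuous_const continuous_abs).inter (isOpen_lt continuous_abs continuous_const)

theorem cos_neg_of_mem_angles {θ : ℝ} (h1 : Real.pi / 2 < |θ|) (h2 : |θ| < Real.pi) :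
    Real.cos θ < 0 := by
  rw [← Real.cos_abs]
  exact Real.cos_neg_of_pi_div_two_lt_of_lt h1 (by linarith [Real.pi_pos])

theorem ofReal_mul_exp_re (ρ θ : ℝ) :
    ((ρ : ℂ) * Complex.exp (Complex.I * θ)).re = ρ * Real.cos θ := by
  rw [Complex.re_ofReal_mul, mul_comm Complex.I, Complex.exp_ofReal_mul_I_re]

theorem arg_ofReal_mul_exp {ρ θ : ℝ} (hρ : 0 < ρ) (hθ : |θ| < Real.pi) :
    Complex.arg ((ρ : ℂ) * Complex.exp (Complex.I * θ)) = θ := by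
  rw [mul_comm Complex.I, Complex.exp_mul_I]
  exact Complex.arg_mul_cos_add_sin_mul_I hρ ⟨(abs_lt.1 hθ).1, (abs_lt.1 hθ).2.le⟩

namespace Model.Admissible

variable {m : Model}

/-- A function `z^β T(z)` with `T` of class `C¹` across the cut satisfies the boundary conditions. -/
theorem boundaryConditionsLb_of_twisted (h : m.Admissible) {f T : ℂ → ℂ}
    (hT : ContDiffOn ℝ 1 T {z | z.re < 0})
    (hf : ∀ x ∈ m.cutPlane, (m.coord x).re < 0 → f x = m.coord x ^ (m.β : ℂ) * T (m.coord x)) :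
    m.BoundaryConditionsLb f := by
  have hR := h.hR
  have hR0 : (m.R : ℂ) ≠ 0 := by exact_mod_cast hR.ne'
  have hopen : IsOpen {z : ℂ | z.re < 0} := isOpen_lt Complex.continuous_re continuous_const
  have hTd : ∀ z : ℂ, z.re < 0 → DifferentiableAt ℝ T z := fun z hz =>
    (hT.differentiableOn one_ne_zero).differentiableAt (hopen.mem_nhds hz)
  have hTc : ∀ z : ℂ, z.re < 0 → ContinuousAt (fderiv ℝ T) z := fun z hz =>
    (hT.continuousOn_fderiv_of_isOpen hopen le_rfl).continuousAt (hopen.mem_nhds hz)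
  -- For `π/2 < |θ| < π` the point lies in `Re z < 0` off the cut and `θ` is its principal argument,
  -- so the principal power is `ρ^β e^{iβθ}`; the twisted expression continues it to `θ = ±π`.
  have hpol : ∀ r θ : ℝ, 0 < r → Real.pi / 2 < |θ| → |θ| < Real.pi →
      m.polarB f r θ = twisted m.β T (r / m.R) θ := by
    intro r θ hr h1 h2
    have hρ : 0 < r / m.R := by positivity
    have hco : m.coord (m.b - r * Complex.exp (Complex.I * θ)) =
        ((r / m.R : ℝ) : ℂ) * Complex.exp (Complex.I * θ) := by
      rw [h.coord_eq, b]; push_cast; field_simp; ring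
    have hre : (((r / m.R : ℝ) : ℂ) * Complex.exp (Complex.I * θ)).re < 0 := by
      rw [ofReal_mul_exp_re]
      exact mul_neg_of_pos_of_neg hρ (cos_neg_of_mem_angles h1 h2)
    have hz0 : ((r / m.R : ℝ) : ℂ) * Complex.exp (Complex.I * θ) ≠ 0 :=
      mul_ne_zero (by exact_mod_cast hρ.ne') (Complex.exp_ne_zero _)
    have harg := arg_ofReal_mul_exp hρ h2
    have hslit : ((r / m.R : ℝ) : ℂ) * Complex.exp (Complex.I * θ) ∈ Complex.slitPlane := by
      rw [Complex.mem_slitPlane_iff_arg, harg]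
      exact ⟨fun hc => by rw [hc, abs_of_pos Real.pi_pos] at h2; exact lt_irrefl _ h2, hz0⟩
    have hmem : m.b - r * Complex.exp (Complex.I * θ) ∈ m.cutPlane := by
      rw [h.mem_reduced_iff, hco]
      refine ⟨Or.inl ?_, hslit⟩
      rw [Complex.sub_re, Complex.one_re]
      linarith
    have hpow : (((r / m.R : ℝ) : ℂ) * Complex.exp (Complex.I * θ)) ^ (m.β : ℂ) =
        (((r / m.R) ^ m.β : ℝ) : ℂ) * Complex.exp (Complex.I * (m.β * θ)) := by
      have hn : ‖((r / m.R : ℝ) : ℂ) * Complex.exp (Complex.I * θ)‖ = r / m.R := by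
        rw [norm_mul, mul_comm Complex.I, Complex.norm_exp_ofReal_mul_I, mul_one, Complex.norm_real,
          Real.norm_of_nonneg hρ.le]
      rw [Complex.cpow_def_of_ne_zero hz0, Complex.log, harg, hn, Real.rpow_def_of_pos hρ,
        Complex.ofReal_exp, ← Complex.exp_add]
      congr 1
      push_cast
      ring
    rw [polarB, hf _ hmem (by rw [hco]; exact hre), hco, hpow, twisted, mul_assoc]
  have hder : ∀ r θ : ℝ, 0 < r → Real.pi / 2 < |θ| → |θ| < Real.pi →
      HasDerivAt (m.polarB f r) (twistedDeriv m.β T (r / m.R) θ) θ := by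
    intro r θ hr h1 h2
    have hre : (((r / m.R : ℝ) : ℂ) * Complex.exp (Complex.I * θ)).re < 0 := by
      rw [ofReal_mul_exp_re]
      exact mul_neg_of_pos_of_neg (by positivity) (cos_neg_of_mem_angles h1 h2)
    refine (hasDerivAt_twisted (hTd _ hre)).congr_of_eventuallyEq ?_
    filter_upwards [isOpen_angles.mem_nhds (show θ ∈ _ from ⟨h1, h2⟩)] with t ht
    exact hpol r t hr ht.1 ht.2
  intro r hr
  have hρ : 0 < r / m.R := by positivity
  have hrpos : ∀ᶠ s in 𝓝 r, 0 < s := lt_mem_nhds hr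
  have hpi := Real.pi_pos
  have hpm : ∀ᶠ θ in 𝓝[<] Real.pi, Real.pi / 2 < |θ| ∧ |θ| < Real.pi := by
    filter_upwards [Ioo_mem_nhdsLT (show Real.pi / 2 < Real.pi by linarith)] with θ hθ
    rw [abs_of_pos (by linarith [hθ.1])]
    exact hθ
  have hmm : ∀ᶠ θ in 𝓝[>] (-Real.pi), Real.pi / 2 < |θ| ∧ |θ| < Real.pi := by
    filter_upwards [Ioo_mem_nhdsGT (show -Real.pi < -(Real.pi / 2) by linarith)] with θ hθ
    rw [abs_of_neg (by linarith [hθ.2])]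
    exact ⟨by linarith [hθ.2], by linarith [hθ.1]⟩
  have hrep : (((r / m.R : ℝ) : ℂ) * Complex.exp (Complex.I * Real.pi)).re < 0 := by
    rw [exp_I_pi, mul_neg_one, Complex.neg_re, Complex.ofReal_re]; linarith
  have hrem : (((r / m.R : ℝ) : ℂ) * Complex.exp (Complex.I * ((-Real.pi : ℝ) : ℂ))).re < 0 := by
    rw [exp_I_neg_pi, mul_neg_one, Complex.neg_re, Complex.ofReal_re]; linarith
  have hscale : ∀ θ : ℝ, Tendsto (fun p : ℝ × ℝ => (p.1 / m.R, p.2)) (𝓝 (r, θ))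
      (𝓝 (r / m.R, θ)) := fun θ =>
    (show Continuous fun p : ℝ × ℝ => (p.1 / m.R, p.2) by fun_prop).tendsto (r, θ)
  have hlp : 𝓝 r ×ˢ 𝓝[<] Real.pi ≤ 𝓝 (r, Real.pi) := by
    rw [nhds_prod_eq]; exact prod_mono le_rfl nhdsWithin_le_nhds
  have hlm : 𝓝 r ×ˢ 𝓝[>] (-Real.pi) ≤ 𝓝 (r, -Real.pi) := by
    rw [nhds_prod_eq]; exact prod_mono le_rfl nhdsWithin_le_nhds
  have evp := hrpos.prod_mk hpm
  have evm := hrpos.prod_mk hmm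
  refine ⟨evp.mono fun p hp => (hder _ _ hp.1 hp.2.1 hp.2.2).differentiableAt,
    evm.mono fun p hp => (hder _ _ hp.1 hp.2.1 hp.2.2).differentiableAt,
    twisted m.β T (r / m.R) (-Real.pi), twistedDeriv m.β T (r / m.R) (-Real.pi), ?_, ?_, ?_, ?_⟩
  · refine Tendsto.congr' (evm.mono fun p hp => (hpol _ _ hp.1 hp.2.1 hp.2.2).symm) ?_
    exact ((continuousAt_twisted (hTd _ hrem).continuousAt hρ).tendsto.comp
      (hscale _)).mono_left hlm
  · rw [← twisted_pi]
    refine Tendsto.congr' (evp.mono fun p hp => (hpol _ _ hp.1 hp.2.1 hp.2.2).symm) ?_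
    exact ((continuousAt_twisted (hTd _ hrep).continuousAt hρ).tendsto.comp
      (hscale _)).mono_left hlp
  · refine Tendsto.congr' (evm.mono fun p hp => (hder _ _ hp.1 hp.2.1 hp.2.2).deriv.symm) ?_
    exact ((continuousAt_twistedDeriv (hTd _ hrem).continuousAt (hTc _ hrem) hρ).tendsto.comp
      (hscale _)).mono_left hlm
  · rw [← twistedDeriv_pi]
    refine Tendsto.congr' (evp.mono fun p hp => (hder _ _ hp.1 hp.2.1 hp.2.2).deriv.symm) ?_
    exact ((continuousAt_twistedDeriv (hTd _ hrep).continuousAt (hTc _ hrep) hρ).tendsto.comp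
      (hscale _)).mono_left hlp

/-- The isolated `(1 - z)^α` of `corr_eq_incBeta` cancels `ψ₁`. The factor `T` left beside `z^β`
consists of the Gaussian, the Laplace part and the incomplete Beta part, each `C¹` on the half plane
`Re z < 0`, which contains the cut. -/
theorem boundaryConditionsLb_ψ₂approx (h : m.Admissible) :
    m.BoundaryConditionsLb m.ψ₂approx := by
  set σ : ℂ := ((Real.sin (Real.pi * m.β) / Real.pi : ℝ) : ℂ) with hσ
  have hsub1 : {z : ℂ | z.re < 0} ⊆ {z | 1 - z ∈ Complex.slitPlane} := fun z hz => by
    have hz' : z.re < 0 := hz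
    left
    rw [Complex.sub_re, Complex.one_re]
    linarith
  have hsub2 : {z : ℂ | z.re < 0} ⊆ {0}ᶜ := fun z hz h0 => by
    have hz' : z.re < 0 := hz
    rw [mem_singleton_iff.1 h0] at hz'
    exact lt_irrefl _ hz'
  have hconj : ContDiff ℝ 1 (fun z : ℂ => conj z) := (Complex.conjCLE : ℂ →L[ℝ] ℂ).contDiff
  refine h.boundaryConditionsLb_of_twisted (T := fun z => m.gauss (m.R * (1 - z)) *
    ((m.amp : ℂ) * (σ * (m.κ * conj z * (∫ t in Ioo (0 : ℝ) 1, Complex.exp (-(m.κ * conj z * t)) *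
      laplaceInt m.α m.β 1 (m.κ * ‖z‖ ^ 2 * t)) - m.α * betaConst m.α m.β *
      ((1 - z) ^ (m.α : ℂ) * incBeta m.α m.β z))))) ?_ ?_
  · refine ContDiffOn.mul ?_ (contDiffOn_const.mul (contDiffOn_const.mul (ContDiffOn.sub ?_ ?_)))
    · exact ((m.contDiff_gauss (n := 1)).comp (contDiff_const.mul
        (contDiff_const.sub contDiff_id))).contDiffOn
    · exact (contDiff_const.mul hconj).contDiffOn.mul
        ((contDiffOn_integral_laplaceInt h.hα.le h.hαβ h.hβ h.κ_pos).mono hsub2)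
    · exact contDiffOn_const.mul (((contDiffOn_one_sub_cpow (m.α : ℂ)).mono hsub1).mul
        ((contDiffOn_incBeta h.hβ0).mono hsub1))
  · intro x hx hre
    obtain ⟨h1, h2⟩ := h.mem_reduced_iff.1 hx
    rw [h.ψ₂approx_eq_gauss_mul hx, h.corr_eq_incBeta h2 h1, ← h.eq_mul x]
    ring

end Model.Admissible

end TwoSolenoid

theorem mainTheorem3 (m : TwoSolenoid.Model)
    (hμ : 0 < m.μ) (he : m.e < 0) (hB : 0 < m.B) (hc : 0 < m.c) (hhbar : 0 < m.hbar)
    (hR : 0 < m.R) (hα : 0 < m.α) (hαβ : m.α < m.β) (hβ : m.β < 1) :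
    -- the integral formula for `φ` makes sense off the cuts
    (∀ x ∈ m.cutPlane, MeasureTheory.Integrable (m.φIntegrand x)) ∧
    -- the second form of `φ`
    (∀ x ∈ m.cutPlane, m.rb x < m.R →
      IntervalIntegrable (m.φHypIntegrand x) MeasureTheory.volume 0 1 ∧ m.φ x = m.φHyp x) ∧
    -- the eigenvalue equation, for `φ` and for `ψ̃₂ = ψ₁ + φ`
    m.IsEigenfunction m.E₁ m.φ ∧
    m.IsEigenfunction m.E₁ m.ψ₂approx ∧
    -- the eigenvalue equation for `ψ̃₂` in the classical sense off the cuts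
    ContDiffOn ℝ 2 m.ψ₂approx m.cutPlane ∧
    (∀ x ∈ m.cutPlane, m.HB m.ψ₂approx x = (m.E₁ : ℂ) * m.ψ₂approx x) ∧
    -- the boundary conditions on `L_b`
    m.BoundaryConditionsLb m.ψ₂approx := by
  have h : m.Admissible := ⟨hμ, he, hB, hc, hhbar, hR, hα, hαβ, hβ⟩
  exact ⟨fun x hx => h.integrable_φIntegrand (h.mem_cutPlane_iff.1 hx).2,
    fun x hx hr => ⟨h.intervalIntegrable_φHypIntegrand (h.mem_cutPlane_iff.1 hx).2,
      h.φ_eq_φHyp (h.mem_cutPlane_iff.1 hx).2 hr⟩,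
    h.isEigenfunction_φ, h.isEigenfunction_ψ₂approx, h.contDiffOn_ψ₂approx 2,
    fun x hx => h.HB_ψ₂approx hx, h.boundaryConditionsLb_ψ₂approx⟩
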